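/- Let $\mathcal L$ be a geometric lattice, that is, a finite lattice that is well-ranked (for each $F$ all maximal chains from $\hat 0$ to $F$ have the same length $\mathrm{rk}\,F$), atomic (every element is a join of atoms) and semimodular ($\mathrm{rk}(F\wedge G)+\mathrm{rk}(F\vee G)\le \mathrm{rk}\,F+\mathrm{rk}\,G$). Call $F\in\mathcal L$ modular if $\mathrm{rk}(F\wedge G)+\mathrm{rk}(F\vee G)=\mathrm{rk}\,F+\mathrm{rk}\,G$ for all $G\in\mathcal L$, and call $\mathcal L$ supersolvable if it has a maximal chain consisting of modular elements. The Orlik–Solomon algebra of $\mathcal L$ is the graded commutative $\mathbb Q$-algebra $$\mathrm{OS}(\mathcal L)=\Lambda^\bullet[e_H \mid H \text{ an atom of }\mathcal L,\ \deg e_H=1]\,\big/\,(\delta e_C \mid C \text{ a circuit of }\mathcal L),$$ where $\delta$ is the antiderivation with $\delta e_H=1$ for all $H$, $e_C=\pm\prod_{H\in C}e_H$, and a set $C$ of atoms is a circuit if $\mathrm{rk}(\bigvee C)=\#C-1$ and $\mathrm{rk}(\bigvee (C\setminus\{c\}))=\#C-1$ for all $c\in C$. A graded commutative $\mathbb Q$-algebra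 $A$ is quadratic if $A\cong\Lambda^\bullet V/(R)$ with $V$ a finite-dimensional space in degree $1$ and $R\subseteq\Lambda^2V$. Its Lie Koszul dual is $A^!=\mathrm{Lie}(V^*)/(R^\perp)$, where $\mathrm{Lie}(V^*)$ is the free Lie algebra on $V^*$ (in degree $0$) and $R^\perp\subseteq\Lambda^2V^*=\mathrm{Lie}_2(V^*)$ is the annihilator of $R$; it is graded by weight, with $V^*$ in weight $1$. A quadratic algebra $A$ is Koszul if a finite zig-zag of quasi-isomorphisms of commutative differential graded $\mathbb Q$-algebras joins $A$ (with zero differential) to the Chevalley–Eilenberg complex $C^\bullet_{CE}$ of the weight-graded dual Lie coalgebra $(A^!)^\vee=\bigoplus_w (A^!_w)^*$, that is, to $\Lambda^\bullet\big((A^!)^\vee\big)$, with $(A^!)^\vee$ in degree $1$ and with the derivation $d$ of degree $1$ given by $(df)(x,y)=-f([x,y])$ for $f\in (A^!)^\vee$. **Theorem.** If a geometric lattice $\mathcal L$ is supersolvable, then $\mathrm{OS}(\mathcal L)$ is Koszul (in particular quadratic). -/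

import Mathlib

universe u

/-! ### Geometric lattices -/

section Lattice

/-- The rank of an element of a finite lattice: the length of the longest chain that ends in it. -/
noncomputable def latticeRank {L : Type*} [Lattice L] (F : L) : ℕ := (Order.height F).toNat

/-- A (finite, bounded) lattice is geometric if it is well-ranked (all maximal chains from `⊥` to
a given element have the same cardinality), atomic and semimodular. -/
structure IsGeometricLattice (L : Type*) [Lattice L] [BoundedOrder L] : Prop where
  finite : Finite L
  wellRanked : ∀ (F : L) (c c' : Flag (Set.Iic F)), c.carrier.ncard = c'.carrier.ncard
  atomic : IsAtomistic L
  semimodular : ∀ F G : L,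
    latticeRank (F ⊓ G) + latticeRank (F ⊔ G) ≤ latticeRank F + latticeRank G

/-- An element `F` is modular if `rk (F ∧ G) + rk (F ∨ G) = rk F + rk G` for all `G`. -/
def IsModularFlat {L : Type*} [Lattice L] (F : L) : Prop :=
  ∀ G : L, latticeRank (F ⊓ G) + latticeRank (F ⊔ G) = latticeRank F + latticeRank G

/-- A lattice is supersolvable if it has a maximal chain that consists of modular elements. -/
def IsSupersolvableLattice (L : Type*) [Lattice L] : Prop :=
  ∃ c : Flag L, ∀ F ∈ c, IsModularFlat F

/-- The type of atoms of a lattice. -/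
abbrev LatticeAtom (L : Type*) [Lattice L] [BoundedOrder L] : Type _ := {H : L // IsAtom H}

/-- The rank of a finite set of atoms is the rank of its join. -/
noncomputable def atomsRank {L : Type*} [Lattice L] [BoundedOrder L]
    (C : Finset (LatticeAtom L)) : ℕ :=
  latticeRank (C.sup fun H => (H : L))

open Classical in
/-- A set `C` of atoms is a circuit if `rk C = #C - 1` and `rk (C \ {c}) = #C - 1` for all `c`
in `C`. -/
def IsLatticeCircuit {L : Type*} [Lattice L] [BoundedOrder L]
    (C : Finset (LatticeAtom L)) : Prop :=
  atomsRank C + 1 = C.card ∧ ∀ c ∈ C, atomsRank (C.erase c) + 1 = C.card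

end Lattice

/-! ### Graded commutative algebras and commutative differential graded algebras over `ℚ` -/

section Cdga

/-- A graded commutative algebra over `ℚ`: the product satisfies `a b = (-1)^{ij} b a` for `a` of
degree `i` and `b` of degree `j`. -/
structure GradedCommAlg : Type (u + 1) where
  carrier : Type u
  [ring : Ring carrier]
  [algebra : Algebra ℚ carrier]
  /-- the homogeneous component of each degree -/
  deg : ℕ → Submodule ℚ carrier
  [graded : GradedAlgebra deg]
  graded_comm : ∀ i j : ℕ, ∀ a ∈ deg i, ∀ b ∈ deg j, a * b = (-1) ^ (i * j) * (b * a)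

attribute [instance] GradedCommAlg.ring GradedCommAlg.algebra GradedCommAlg.graded

/-- A commutative differential graded algebra over `ℚ`, with differential of degree `+1`. -/
structure Cdga : Type (u + 1) extends GradedCommAlg.{u} where
  d : carrier →ₗ[ℚ] carrier
  d_mem : ∀ i : ℕ, ∀ a ∈ deg i, d a ∈ deg (i + 1)
  d_d : ∀ a, d (d a) = 0
  leibniz : ∀ i : ℕ, ∀ a ∈ deg i, ∀ b, d (a * b) = d a * b + (-1) ^ i * (a * d b)

/-- A graded commutative algebra, seen as a cdga with zero differential. -/
def GradedCommAlg.toCdga (A : GradedCommAlg.{u}) : Cdga.{u} where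
  toGradedCommAlg := A
  d := 0
  d_mem _ _ _ := by simp
  d_d _ := by simp
  leibniz _ _ _ _ := by simp

namespace Cdga

/-- Morphisms of cdgas. -/
structure Hom (A B : Cdga.{u}) : Type u where
  toAlgHom : A.carrier →ₐ[ℚ] B.carrier
  map_deg : ∀ i : ℕ, ∀ a ∈ A.deg i, toAlgHom a ∈ B.deg i
  map_d : ∀ a, toAlgHom (A.d a) = B.d (toAlgHom a)

/-- The cocycles. -/
abbrev cocycles (A : Cdga.{u}) : Submodule ℚ A.carrier := LinearMap.ker A.d

/-- The (total) cohomology `ker d / im d`; it is the direct sum of the cohomology spaces in the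
various degrees. -/
abbrev Cohomology (A : Cdga.{u}) : Type u :=
  A.cocycles ⧸ (LinearMap.range A.d).comap A.cocycles.subtype

/-- The map on cocycles given by a morphism of cdgas. -/
def Hom.mapCocycles {A B : Cdga.{u}} (f : Hom A B) : A.cocycles →ₗ[ℚ] B.cocycles :=
  f.toAlgHom.toLinearMap.restrict fun a ha => by
    have h : A.d a = 0 := ha
    change B.d (f.toAlgHom a) = 0
    rw [← f.map_d, h, map_zero]

/-- The map on cohomology given by a morphism of cdgas. -/
def Hom.mapCohomology {A B : Cdga.{u}} (f : Hom A B) : A.Cohomology →ₗ[ℚ] B.Cohomology :=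
  Submodule.mapQ _ _ f.mapCocycles fun a ha => by
    obtain ⟨c, hc⟩ := ha
    exact ⟨f.toAlgHom c, by rw [← f.map_d, hc]; rfl⟩

/-- A quasi-isomorphism is a morphism that is bijective on cohomology. -/
def Hom.IsQuasiIso {A B : Cdga.{u}} (f : Hom A B) : Prop := Function.Bijective f.mapCohomology

/-- Two cdgas are quasi-isomorphic if a finite zig-zag of quasi-isomorphisms of cdgas joins
them. -/
def QuasiIsomorphic (A B : Cdga.{u}) : Prop :=
  Relation.EqvGen (fun A B : Cdga.{u} => ∃ f : Hom A B, f.IsQuasiIso) A B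

end Cdga

end Cdga

/-! ### Exterior algebras -/

section Exterior

variable {M : Type u} [AddCommGroup M] [Module ℚ M]

namespace ExteriorAux

open ExteriorAlgebra

theorem ι_anticomm (v w : M) : ι ℚ v * ι ℚ w = -(ι ℚ w * ι ℚ v) :=
  eq_neg_of_add_eq_zero_left (ExteriorAlgebra.ι_add_mul_swap v w)

theorem ι_mem (v : M) : ι ℚ v ∈ ⋀[ℚ]^1 M := by
  change ι ℚ v ∈ LinearMap.range (ι ℚ : M →ₗ[ℚ] ExteriorAlgebra ℚ M) ^ 1
  rw [pow_one]; exact ⟨v, rfl⟩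

theorem ι_mul_homogeneous (v : M) {j : ℕ} {b : ExteriorAlgebra ℚ M} (hb : b ∈ ⋀[ℚ]^j M) :
    ι ℚ v * b = (-1) ^ j * (b * ι ℚ v) := by
  induction hb using Submodule.pow_induction_on_left' with
  | algebraMap r => simp [Algebra.commutes]
  | add x y i _ _ hx hy => rw [mul_add, hx, hy, add_mul, mul_add]
  | mem_mul m hm i x _ hx =>
    obtain ⟨w, rfl⟩ := hm
    have hc : ((-1) ^ i : ExteriorAlgebra ℚ M) * ι ℚ w = ι ℚ w * (-1) ^ i :=
      (Commute.neg_one_left _).pow_left i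
    rw [← mul_assoc, ι_anticomm, neg_mul, mul_assoc, hx, ← mul_assoc, ← hc, pow_succ']
    simp [mul_assoc]

theorem graded_comm (i j : ℕ) (a : ExteriorAlgebra ℚ M) (ha : a ∈ ⋀[ℚ]^i M)
    (b : ExteriorAlgebra ℚ M) (hb : b ∈ ⋀[ℚ]^j M) :
    a * b = (-1) ^ (i * j) * (b * a) := by
  induction ha using Submodule.pow_induction_on_left' with
  | algebraMap r => simp [Algebra.commutes]
  | add x y i _ _ hx hy => rw [add_mul, hx, hy, mul_add, mul_add]
  | mem_mul m hm i x _ hx =>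
    obtain ⟨w, rfl⟩ := hm
    have hc : ((-1) ^ (i * j) : ExteriorAlgebra ℚ M) * ι ℚ w = ι ℚ w * (-1) ^ (i * j) :=
      (Commute.neg_one_left _).pow_left _
    rw [mul_assoc, hx, ← mul_assoc, ← hc, mul_assoc, ← mul_assoc (ι ℚ w) b, ι_mul_homogeneous w hb,
      Nat.succ_mul, pow_add]
    simp [mul_assoc]

end ExteriorAux

/-- The exterior algebra `Λ M`, with `M` in degree `1`. -/
noncomputable def exteriorGradedCommAlg (M : Type u) [AddCommGroup M] [Module ℚ M] :
    GradedCommAlg.{u} where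
  carrier := ExteriorAlgebra ℚ M
  deg i := ⋀[ℚ]^i M
  graded_comm := ExteriorAux.graded_comm

end Exterior

/-! ### Quotients of exterior algebras by homogeneous relations -/

section Quotient

open ExteriorAlgebra DirectSum

variable {M : Type u} [AddCommGroup M] [Module ℚ M]

/-- The two-sided ideal of `Λ M` generated by a set. -/
abbrev relIdeal (S : Set (ExteriorAlgebra ℚ M)) : Ideal (ExteriorAlgebra ℚ M) :=
  (TwoSidedIdeal.span S).asIdeal

/-- The image of `Λ^i M` in the quotient of `Λ M` by the ideal generated by `S`. -/
def quotDeg (S : Set (ExteriorAlgebra ℚ M)) (i : ℕ) :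
    Submodule ℚ (ExteriorAlgebra ℚ M ⧸ relIdeal S) :=
  (⋀[ℚ]^i M).map (Ideal.Quotient.mkₐ ℚ (relIdeal S)).toLinearMap

theorem mk_mem_quotDeg (S : Set (ExteriorAlgebra ℚ M)) {i : ℕ} {a : ExteriorAlgebra ℚ M}
    (ha : a ∈ ⋀[ℚ]^i M) : Ideal.Quotient.mkₐ ℚ (relIdeal S) a ∈ quotDeg S i :=
  Submodule.mem_map_of_mem ha

instance quotDeg_gradedMonoid (S : Set (ExteriorAlgebra ℚ M)) :
    SetLike.GradedMonoid (quotDeg S) where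
  one_mem := ⟨1, SetLike.GradedOne.one_mem, map_one (Ideal.Quotient.mkₐ ℚ (relIdeal S))⟩
  mul_mem := by
    rintro i j _ _ ⟨a, ha, rfl⟩ ⟨b, hb, rfl⟩
    exact ⟨a * b, SetLike.GradedMul.mul_mem ha hb, map_mul (Ideal.Quotient.mkₐ ℚ (relIdeal S)) a b⟩

/-- Auxiliary: the map from `Λ M` to the direct sum of the graded pieces of the quotient. -/
noncomputable def quotDecomposeAux (S : Set (ExteriorAlgebra ℚ M)) :
    ExteriorAlgebra ℚ M →ₐ[ℚ] ⨁ i, quotDeg S i :=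
  ExteriorAlgebra.lift ℚ ⟨DirectSum.lof ℚ ℕ (fun i => quotDeg S i) 1 ∘ₗ
    ((Ideal.Quotient.mkₐ ℚ (relIdeal S)).toLinearMap ∘ₗ ι ℚ).codRestrict (quotDeg S 1)
      (fun m => mk_mem_quotDeg S (ExteriorAux.ι_mem m)), fun m => by
    simp only [LinearMap.comp_apply, DirectSum.lof_eq_of]
    rw [DirectSum.of_mul_of]
    refine DFinsupp.single_eq_zero.mpr (Subtype.ext ?_)
    change Ideal.Quotient.mkₐ ℚ (relIdeal S) (ι ℚ m) * Ideal.Quotient.mkₐ ℚ (relIdeal S) (ι ℚ m) = 0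
    rw [← map_mul, ι_sq_zero, map_zero]⟩

theorem quotDecomposeAux_ι (S : Set (ExteriorAlgebra ℚ M)) (m : M) :
    quotDecomposeAux S (ι ℚ m) = DirectSum.of (fun i => quotDeg S i) 1
      ⟨Ideal.Quotient.mkₐ ℚ (relIdeal S) (ι ℚ m), mk_mem_quotDeg S (ExteriorAux.ι_mem m)⟩ := by
  rw [quotDecomposeAux, ExteriorAlgebra.lift_ι_apply]
  rfl

theorem quotDecomposeAux_eq (S : Set (ExteriorAlgebra ℚ M)) {i : ℕ} {a : ExteriorAlgebra ℚ M}
    (ha : a ∈ ⋀[ℚ]^i M) :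
    quotDecomposeAux S a = DirectSum.of (fun i => quotDeg S i) i
      ⟨Ideal.Quotient.mkₐ ℚ (relIdeal S) a, mk_mem_quotDeg S ha⟩ := by
  induction ha using Submodule.pow_induction_on_left' with
  | algebraMap r => rw [AlgHom.commutes, DirectSum.algebraMap_apply]; rfl
  | add x y i hx hy ihx ihy => rw [map_add, ihx, ihy, ← map_add]; rfl
  | mem_mul m hm i x hx ih =>
    obtain ⟨w, rfl⟩ := hm
    rw [map_mul, ih, quotDecomposeAux_ι, DirectSum.of_mul_of]
    exact DirectSum.of_eq_of_gradedMonoid_eq (Sigma.subtype_ext (add_comm _ _) rfl)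

theorem quotDecomposeAux_eq_zero (S : Set (ExteriorAlgebra ℚ M))
    (hS : ∀ s ∈ S, ∃ k : ℕ, s ∈ ⋀[ℚ]^k M) (a : ExteriorAlgebra ℚ M) (ha : a ∈ relIdeal S) :
    quotDecomposeAux S a = 0 := by
  have h : TwoSidedIdeal.span S ≤ TwoSidedIdeal.ker (quotDecomposeAux S) := by
    rw [TwoSidedIdeal.span_le]
    intro s hs
    obtain ⟨k, hk⟩ := hS s hs
    rw [SetLike.mem_coe, TwoSidedIdeal.mem_ker, quotDecomposeAux_eq S hk]
    refine DFinsupp.single_eq_zero.mpr (Subtype.ext ?_)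
    exact Ideal.Quotient.eq_zero_iff_mem.mpr
      (TwoSidedIdeal.mem_asIdeal.mpr (TwoSidedIdeal.subset_span hs))
  exact (TwoSidedIdeal.mem_ker _).mp (h (TwoSidedIdeal.mem_asIdeal.mp ha))

/-- The grading of the quotient of `Λ M` by homogeneous relations. -/
@[reducible]
noncomputable def quotGraded (S : Set (ExteriorAlgebra ℚ M))
    (hS : ∀ s ∈ S, ∃ k : ℕ, s ∈ ⋀[ℚ]^k M) : GradedAlgebra (quotDeg S) :=
  GradedAlgebra.ofAlgHom _
    (Ideal.Quotient.liftₐ (relIdeal S) (quotDecomposeAux S) (quotDecomposeAux_eq_zero S hS))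
    (by
      apply Ideal.Quotient.algHom_ext
      ext m
      simp only [LinearMap.comp_apply, AlgHom.toLinearMap_apply, AlgHom.comp_apply, AlgHom.id_apply]
      have h : (Ideal.Quotient.liftₐ (relIdeal S) (quotDecomposeAux S)
        (quotDecomposeAux_eq_zero S hS)) (Ideal.Quotient.mkₐ ℚ (relIdeal S) (ι ℚ m)) =
          quotDecomposeAux S (ι ℚ m) := rfl
      rw [h, quotDecomposeAux_ι, DirectSum.coeAlgHom_of])
    (by
      rintro i ⟨_, a, ha, rfl⟩
      exact quotDecomposeAux_eq S ha)

/-- The graded commutative algebra `Λ M / (S)`, where `S` is a set of homogeneous elements. -/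
noncomputable def exteriorQuotient (S : Set (ExteriorAlgebra ℚ M))
    (hS : ∀ s ∈ S, ∃ k : ℕ, s ∈ ⋀[ℚ]^k M) : GradedCommAlg.{u} :=
  letI := quotGraded S hS
  { carrier := ExteriorAlgebra ℚ M ⧸ relIdeal S
    deg := quotDeg S
    graded_comm := by
      rintro i j _ ⟨a, ha, rfl⟩ _ ⟨b, hb, rfl⟩
      have h := congrArg (Ideal.Quotient.mkₐ ℚ (relIdeal S)) (ExteriorAux.graded_comm i j a ha b hb)
      simp only [map_mul, map_pow, map_neg, map_one] at h
      exact h }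

end Quotient

/-! ### The Chevalley--Eilenberg complex of a graded dual Lie coalgebra -/

section WeightSpaces

variable {X : Type u} {𝔤 : Type u} [LieRing 𝔤] [LieAlgebra ℚ 𝔤]

/-- The weight spaces of a Lie algebra generated by elements `t x` of weight `1`: in weight
`n ≥ 1` it is the span of the `n`-fold brackets `⁅t x₁, ⁅t x₂, … ⁅t xₙ₋₁, t xₙ⁆ … ⁆⁆`. -/
noncomputable def lieWeight (t : X → 𝔤) : ℕ → Submodule ℚ 𝔤
  | 0 => ⊥
  | 1 => Submodule.span ℚ (Set.range t)
  | n + 2 => ⨆ x : X, (lieWeight t (n + 1)).map (LieAlgebra.ad ℚ 𝔤 (t x))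

theorem lieWeight_gen (t : X → 𝔤) (x : X) : ∀ {n : ℕ} {y : 𝔤}, y ∈ lieWeight t n →
    ⁅t x, y⁆ ∈ lieWeight t (n + 1)
  | 0, y, hy => by
    have : y = 0 := by simpa [lieWeight] using hy
    simp [this]
  | n + 1, y, hy => by
    rw [lieWeight]
    exact Submodule.mem_iSup_of_mem x ⟨y, hy, rfl⟩

theorem lieWeight_lie (t : X → 𝔤) : ∀ {m n : ℕ} {x y : 𝔤}, x ∈ lieWeight t m →
    y ∈ lieWeight t n → ⁅x, y⁆ ∈ lieWeight t (m + n)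
  | 0, n, x, y, hx, _ => by
    have : x = 0 := by simpa [lieWeight] using hx
    simp [this]
  | 1, n, x, y, hx, hy => by
    rw [lieWeight] at hx
    rw [add_comm]
    induction hx using Submodule.span_induction with
    | mem x hx => obtain ⟨a, rfl⟩ := hx; exact lieWeight_gen t a hy
    | zero => simp
    | add x y _ _ hx hy => rw [add_lie]; exact add_mem hx hy
    | smul c x _ hx => rw [smul_lie]; exact Submodule.smul_mem _ _ hx
  | m + 2, n, x, y, hx, hy => by
    rw [lieWeight] at hx
    induction hx using Submodule.iSup_induction' with
    | mem a z hz =>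
      obtain ⟨w, hw, rfl⟩ := hz
      change ⁅⁅t a, w⁆, y⁆ ∈ _
      rw [lie_lie]
      have h1 := lieWeight_gen t a (lieWeight_lie t hw hy)
      have h2 := lieWeight_lie t hw (lieWeight_gen t a hy)
      rw [show m + 1 + n + 1 = m + 2 + n by ring] at h1
      rw [show m + 1 + (n + 1) = m + 2 + n by ring] at h2
      exact sub_mem h1 h2
    | zero => simp
    | add x y _ _ hx hy => rw [add_lie]; exact add_mem hx hy

/-- Lie generation. -/
def LieGenerates (t : X → 𝔤) : Prop := LieSubalgebra.lieSpan ℚ 𝔤 (Set.range t) = ⊤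

theorem iSup_lieWeight {t : X → 𝔤} (ht : LieGenerates t) : ⨆ n, lieWeight t n = ⊤ := by
  let K : LieSubalgebra ℚ 𝔤 :=
    { (⨆ n, lieWeight t n) with
      lie_mem' := by
        intro x y hx hy
        have hx' : x ∈ ⨆ n, lieWeight t n := hx
        have hy' : y ∈ ⨆ n, lieWeight t n := hy
        change ⁅x, y⁆ ∈ ⨆ n, lieWeight t n
        clear hx hy
        induction hx' using Submodule.iSup_induction' with
        | mem m x hx =>
          induction hy' using Submodule.iSup_induction' with
          | mem n y hy => exact Submodule.mem_iSup_of_mem (m + n) (lieWeight_lie t hx hy)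
          | zero => simp
          | add y z _ _ h1 h2 => rw [lie_add]; exact add_mem h1 h2
        | zero => simp
        | add x z _ _ h1 h2 => rw [add_lie]; exact add_mem h1 h2 }
  have h : LieSubalgebra.lieSpan ℚ 𝔤 (Set.range t) ≤ K := by
    rw [LieSubalgebra.lieSpan_le]
    rintro _ ⟨x, rfl⟩
    refine Submodule.mem_iSup_of_mem 1 ?_
    rw [lieWeight]
    exact Submodule.subset_span ⟨x, rfl⟩
  rw [eq_top_iff]
  intro x _
  have hx : x ∈ LieSubalgebra.lieSpan ℚ 𝔤 (Set.range t) := by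
    rw [show LieSubalgebra.lieSpan ℚ 𝔤 (Set.range t) = ⊤ from ht]; trivial
  exact h hx

theorem lieWeight_finite [Finite X] (t : X → 𝔤) : ∀ n, Module.Finite ℚ (lieWeight t n)
  | 0 => by rw [lieWeight]; infer_instance
  | 1 => by rw [lieWeight]; exact Module.Finite.span_of_finite ℚ (Set.finite_range t)
  | n + 2 => by
    have := lieWeight_finite t (n + 1)
    rw [lieWeight]; infer_instance

/-- The graded dual of a Lie algebra generated by elements `t x` of weight `1`, as a subspace of
the dual: the linear forms that vanish on all but finitely many weight spaces. -/
def gradedDualSubmodule (t : X → 𝔤) : Submodule ℚ (Module.Dual ℚ 𝔤) where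
  carrier := {f | ∃ N : ℕ, ∀ n ≥ N, ∀ y ∈ lieWeight t n, f y = 0}
  zero_mem' := ⟨0, fun _ _ _ _ => rfl⟩
  add_mem' := by
    rintro f g ⟨N, hN⟩ ⟨N', hN'⟩
    refine ⟨max N N', fun n hn y hy => ?_⟩
    rw [LinearMap.add_apply, hN n (le_of_max_le_left hn) y hy,
      hN' n (le_of_max_le_right hn) y hy, add_zero]
  smul_mem' := by
    rintro c f ⟨N, hN⟩
    exact ⟨N, fun n hn y hy => by rw [LinearMap.smul_apply, hN n hn y hy, smul_zero]⟩

/-- The graded dual of a Lie algebra generated by elements `t x` of weight `1`. -/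
def GradedDual (t : X → 𝔤) : Type u := gradedDualSubmodule t

instance (t : X → 𝔤) : AddCommGroup (GradedDual t) :=
  inferInstanceAs (AddCommGroup (gradedDualSubmodule t))

instance (t : X → 𝔤) : Module ℚ (GradedDual t) :=
  inferInstanceAs (Module ℚ (gradedDualSubmodule t))

/-- The pairing between the graded dual and the Lie algebra. -/
def GradedDual.pairing (t : X → 𝔤) : GradedDual t →ₗ[ℚ] 𝔤 →ₗ[ℚ] ℚ :=
  (gradedDualSubmodule t).subtype

theorem GradedDual.ext {t : X → 𝔤} {f g : GradedDual t}
    (h : ∀ x, GradedDual.pairing t f x = GradedDual.pairing t g x) : f = g :=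
  Subtype.ext (LinearMap.ext h)

/-- Evaluation at an element of the Lie algebra, as a linear form on the graded dual. -/
def gradedDualEval (t : X → 𝔤) (x : 𝔤) : Module.Dual ℚ (GradedDual t) :=
  (GradedDual.pairing t).flip x

theorem gradedDualEval_apply (t : X → 𝔤) (x : 𝔤) (f : GradedDual t) :
    gradedDualEval t x f = GradedDual.pairing t f x := rfl

theorem comp_ad_vanish {t : X → 𝔤} (ht : LieGenerates t) {f : Module.Dual ℚ 𝔤} {N : ℕ}
    (hN : ∀ n ≥ N, ∀ y ∈ lieWeight t n, f y = 0) (x : 𝔤) {n : ℕ} (hn : N ≤ n) {y : 𝔤}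
    (hy : y ∈ lieWeight t n) : f ⁅x, y⁆ = 0 := by
  have hx : x ∈ ⨆ n, lieWeight t n := by rw [iSup_lieWeight ht]; trivial
  induction hx using Submodule.iSup_induction' with
  | mem m x hx => exact hN (m + n) (by omega) _ (lieWeight_lie t hx hy)
  | zero => simp
  | add x z _ _ h1 h2 => rw [add_lie, map_add, h1, h2, add_zero]

/-- The coadjoint action: `coad f x` is the linear form `y ↦ f ⁅x, y⁆` of the graded dual. -/
def coad {t : X → 𝔤} (ht : LieGenerates t) (f : GradedDual t) : 𝔤 →ₗ[ℚ] GradedDual t where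
  toFun x := ⟨GradedDual.pairing t f ∘ₗ (LieAlgebra.ad ℚ 𝔤 x : 𝔤 →ₗ[ℚ] 𝔤), by
    obtain ⟨f, N, hN⟩ := f
    exact ⟨N, fun n hn y hy => comp_ad_vanish ht hN x hn hy⟩⟩
  map_add' x y := GradedDual.ext fun z => by
    change GradedDual.pairing t f ⁅x + y, z⁆ =
      GradedDual.pairing t f ⁅x, z⁆ + GradedDual.pairing t f ⁅y, z⁆
    rw [add_lie, map_add]
  map_smul' c x := GradedDual.ext fun z => by
    change GradedDual.pairing t f ⁅c • x, z⁆ = c • GradedDual.pairing t f ⁅x, z⁆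
    rw [smul_lie, map_smul]

theorem coad_apply {t : X → 𝔤} (ht : LieGenerates t) (f : GradedDual t) (x y : 𝔤) :
    GradedDual.pairing t (coad ht f x) y = GradedDual.pairing t f ⁅x, y⁆ := rfl

theorem coad_finite_range [Finite X] {t : X → 𝔤} (ht : LieGenerates t) (f : GradedDual t) :
    ∃ N : ℕ, (∀ n ≥ N, ∀ x ∈ lieWeight t n, coad ht f x = 0) ∧
      Module.Finite ℚ (LinearMap.range (coad ht f)) := by
  obtain ⟨N, hN⟩ := f.2
  have h0 : ∀ n ≥ N, ∀ x ∈ lieWeight t n, coad ht f x = 0 := by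
    intro n hn x hx
    refine GradedDual.ext fun y => ?_
    have h := comp_ad_vanish ht hN y hn hx
    rw [coad_apply, ← lie_skew, map_neg, map_zero, LinearMap.zero_apply]
    exact neg_eq_zero.mpr h
  refine ⟨N, h0, ?_⟩
  have h1 : LinearMap.range (coad ht f) ≤
      ⨆ n : Fin N, (lieWeight t n).map (coad ht f) := by
    rw [LinearMap.range_eq_map, ← iSup_lieWeight ht, Submodule.map_iSup]
    refine iSup_le fun n => ?_
    by_cases hn : n < N
    · exact le_iSup (fun n : Fin N => (lieWeight t n).map (coad ht f)) ⟨n, hn⟩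
    · rintro _ ⟨x, hx, rfl⟩
      rw [h0 n (not_lt.mp hn) x hx]
      exact zero_mem _
  have h2 : ∀ n : Fin N, Module.Finite ℚ (lieWeight t n) := fun n => lieWeight_finite t n
  have h3 : FiniteDimensional ℚ
      (⨆ n : Fin N, (lieWeight t n).map (coad ht f) : Submodule ℚ (GradedDual t)) :=
    inferInstance
  exact Submodule.finiteDimensional_of_le h1

end WeightSpaces

section Contraction

open ExteriorAlgebra

variable {M : Type u} [AddCommGroup M] [Module ℚ M]

/-- Contraction of an element of `Λ M` with a linear form on `M`: the antiderivation of
degree `-1` that extends the linear form. -/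
noncomputable def extContract (φ : Module.Dual ℚ M) :
    ExteriorAlgebra ℚ M →ₗ[ℚ] ExteriorAlgebra ℚ M :=
  CliffordAlgebra.contractLeft φ

theorem extContract_ι (φ : Module.Dual ℚ M) (m : M) :
    extContract φ (ι ℚ m) = algebraMap ℚ _ (φ m) :=
  CliffordAlgebra.contractLeft_ι _ _ _

theorem extContract_algebraMap (φ : Module.Dual ℚ M) (r : ℚ) :
    extContract φ (algebraMap ℚ _ r) = 0 :=
  CliffordAlgebra.contractLeft_algebraMap _ _ _

theorem extContract_ι_mul (φ : Module.Dual ℚ M) (m : M) (b : ExteriorAlgebra ℚ M) :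
    extContract φ (ι ℚ m * b) = φ m • b - ι ℚ m * extContract φ b :=
  CliffordAlgebra.contractLeft_ι_mul _ _ _

theorem ext_left_induction {P : ExteriorAlgebra ℚ M → Prop}
    (algebraMap : ∀ r : ℚ, P (algebraMap ℚ _ r))
    (add : ∀ x y, P x → P y → P (x + y)) (ι_mul : ∀ x m, P x → P (ι ℚ m * x)) (x) : P x :=
  CliffordAlgebra.left_induction _ algebraMap add ι_mul x

theorem extContract_mem (φ : Module.Dual ℚ M) {k : ℕ} {ω : ExteriorAlgebra ℚ M}
    (hω : ω ∈ ⋀[ℚ]^k M) : extContract φ ω ∈ ⋀[ℚ]^(k - 1) M := by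
  induction hω using Submodule.pow_induction_on_left' with
  | algebraMap r => rw [extContract_algebraMap]; exact zero_mem _
  | add x y i _ _ hx hy => rw [map_add]; exact add_mem hx hy
  | mem_mul m hm i x hx ih =>
    obtain ⟨w, rfl⟩ := hm
    rw [extContract_ι_mul]
    refine sub_mem (Submodule.smul_mem _ _ hx) ?_
    rcases i with _ | i
    · obtain ⟨r, rfl⟩ := Submodule.mem_one.mp (by simpa using hx)
      rw [extContract_algebraMap, mul_zero]; exact zero_mem _
    · have := SetLike.GradedMul.mul_mem (A := fun i : ℕ => ⋀[ℚ]^i M) (ExteriorAux.ι_mem w) ih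
      rwa [show 1 + (i + 1 - 1) = i.succ - 1 + 1 by omega] at this

end Contraction

section Separation

open ExteriorAlgebra

variable {X : Type u} {𝔤 : Type u} [LieRing 𝔤] [LieAlgebra ℚ 𝔤] (t : X → 𝔤)

theorem gradedDualEval_surjective (F : Submodule ℚ (GradedDual t)) [FiniteDimensional ℚ F]
    (φ : Module.Dual ℚ F) :
    ∃ x : 𝔤, ∀ v : F, gradedDualEval t x (v : GradedDual t) = φ v := by
  let ev : 𝔤 →ₗ[ℚ] Module.Dual ℚ F :=
    { toFun := fun x => (gradedDualEval t x).comp F.subtype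
      map_add' := fun x y => by ext v; simp [gradedDualEval_apply]
      map_smul' := fun c x => by ext v; simp [gradedDualEval_apply] }
  have hev : Function.Surjective ev := by
    rw [← LinearMap.dualMap_injective_iff, injective_iff_map_eq_zero]
    intro z hz
    obtain ⟨v, rfl⟩ := (Module.evalEquiv ℚ F).surjective z
    have : v = 0 := by
      apply Subtype.ext
      refine GradedDual.ext fun x => ?_
      have := LinearMap.congr_fun hz x
      simpa [ev, gradedDualEval_apply] using this
    rw [this, map_zero]
  obtain ⟨x, hx⟩ := hev φ
  exact ⟨x, fun v => LinearMap.congr_fun hx v⟩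

theorem exists_finite_support {M : Type u} [AddCommGroup M] [Module ℚ M] {k : ℕ}
    {ω : ExteriorAlgebra ℚ M} (hω : ω ∈ ⋀[ℚ]^k M) :
    ∃ F : Submodule ℚ M, FiniteDimensional ℚ F ∧ ω ∈ (F.map (ι ℚ)) ^ k := by
  induction hω using Submodule.pow_induction_on_left' with
  | algebraMap r =>
    exact ⟨⊥, inferInstance, by rw [pow_zero]; exact Submodule.algebraMap_mem r⟩
  | add x y i _ _ hx hy =>
    obtain ⟨F, hF, hx⟩ := hx
    obtain ⟨G, hG, hy⟩ := hy
    refine ⟨F ⊔ G, inferInstance, add_mem ?_ ?_⟩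
    · exact pow_le_pow_left' (Submodule.map_mono le_sup_left) i hx
    · exact pow_le_pow_left' (Submodule.map_mono le_sup_right) i hy
  | mem_mul m hm i x hx ih =>
    obtain ⟨w, rfl⟩ := hm
    obtain ⟨F, hF, hx⟩ := ih
    refine ⟨F ⊔ Submodule.span ℚ {w}, inferInstance, ?_⟩
    rw [Nat.succ_eq_add_one, pow_succ']
    refine Submodule.mul_mem_mul ⟨w, ?_, rfl⟩
      (pow_le_pow_left' (Submodule.map_mono le_sup_left) i hx)
    exact Submodule.mem_sup_right (Submodule.mem_span_singleton_self w)

/-- An exterior form of positive degree on which all contractions vanish is zero. -/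
theorem eq_zero_of_contract {k : ℕ} (hk : k ≠ 0) {ω : ExteriorAlgebra ℚ (GradedDual t)}
    (hω : ω ∈ ⋀[ℚ]^k (GradedDual t))
    (h : ∀ x : 𝔤, extContract (gradedDualEval t x) ω = 0) : ω = 0 := by
  obtain ⟨F, hF, hωF⟩ := exists_finite_support hω
  let b := Module.finBasis ℚ F
  choose x hx using fun i => gradedDualEval_surjective t F (b.coord i)
  have hsum : ∀ v : F, ∑ i, gradedDualEval t (x i) (v : GradedDual t) • (b i : GradedDual t) = v := by
    intro v
    simp only [hx, Module.Basis.coord_apply]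
    have := congrArg (F.subtype) (b.sum_repr v)
    simpa only [map_sum, map_smul, Submodule.subtype_apply] using this
  have euler : ∀ (j : ℕ) (η : ExteriorAlgebra ℚ (GradedDual t)), η ∈ (F.map (ι ℚ)) ^ j →
      ∑ i, ι ℚ (b i : GradedDual t) * extContract (gradedDualEval t (x i)) η = (j : ℚ) • η := by
    intro j η hη
    induction hη using Submodule.pow_induction_on_left' with
    | algebraMap r => simp [extContract_algebraMap]
    | add y z i _ _ hy hz => simp only [map_add, mul_add, Finset.sum_add_distrib, hy, hz, smul_add]
    | mem_mul m hm j y hy ih =>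
      obtain ⟨v, hv, rfl⟩ := hm
      have e1 : ∑ i, gradedDualEval t (x i) v • ι ℚ (b i : GradedDual t) = ι ℚ v := by
        have := congrArg (ι ℚ) (hsum ⟨v, hv⟩)
        simpa only [map_sum, map_smul] using this
      have e2 : ∀ i, ι ℚ (b i : GradedDual t) * extContract (gradedDualEval t (x i)) (ι ℚ v * y)
          = (gradedDualEval t (x i) v • ι ℚ (b i : GradedDual t)) * y +
            ι ℚ v * (ι ℚ (b i : GradedDual t) * extContract (gradedDualEval t (x i)) y) := by
        intro i
        rw [extContract_ι_mul, mul_sub, mul_smul_comm, smul_mul_assoc, ← mul_assoc,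
          ExteriorAux.ι_anticomm, ← mul_assoc]
        rw [neg_mul, sub_neg_eq_add]
      rw [Finset.sum_congr rfl fun i _ => e2 i, Finset.sum_add_distrib, ← Finset.sum_mul,
        ← Finset.mul_sum, e1, ih, Nat.cast_succ, add_smul, one_smul, mul_smul_comm, add_comm]
  have := euler k ω hωF
  simp only [h, mul_zero, Finset.sum_const_zero] at this
  exact (smul_eq_zero.mp this.symm).resolve_left (Nat.cast_ne_zero.mpr hk)

end Separation

section Differential

open ExteriorAlgebra

variable {X : Type u} {𝔤 : Type u} [LieRing 𝔤] [LieAlgebra ℚ 𝔤]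

theorem extContract_gradedDualEval_two (t : X → 𝔤) (f g : GradedDual t) (x : 𝔤) :
    extContract (gradedDualEval t x) (ι ℚ f * ι ℚ g) =
      ι ℚ (GradedDual.pairing t f x • g - GradedDual.pairing t g x • f) := by
  rw [extContract_ι_mul, extContract_ι, ← Algebra.commutes, ← Algebra.smul_def, map_sub, map_smul,
    map_smul]
  rfl

/-- For each `f` in the graded dual of `𝔤` there is exactly one element `ω` of `Λ²` of the graded
dual with `ω(x, y) = -f ⁅x, y⁆`. -/
theorem existsUnique_cobracket [Finite X] {t : X → 𝔤} (ht : LieGenerates t) (f : GradedDual t) :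
    ∃! ω : ExteriorAlgebra ℚ (GradedDual t), ω ∈ ⋀[ℚ]^2 (GradedDual t) ∧
      ∀ x : 𝔤, extContract (gradedDualEval t x) ω = -ι ℚ (coad ht f x) := by
  obtain ⟨N, hN, hfin⟩ := coad_finite_range ht f
  let b := Module.finBasis ℚ (LinearMap.range (coad ht f))
  let c : Fin (Module.finrank ℚ (LinearMap.range (coad ht f))) → GradedDual t := fun i =>
    ⟨(b.coord i) ∘ₗ (coad ht f).rangeRestrict, N, fun n hn y hy => by
      have : (coad ht f).rangeRestrict y = 0 := Subtype.ext (hN n hn y hy)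
      rw [LinearMap.comp_apply, this, map_zero]⟩
  have hc : ∀ x, ∑ i, GradedDual.pairing t (c i) x • (b i : GradedDual t) = coad ht f x := by
    intro x
    have := congrArg (Submodule.subtype _) (b.sum_repr ((coad ht f).rangeRestrict x))
    simp only [map_sum, map_smul, Submodule.subtype_apply] at this
    exact this
  have hc' : ∀ x, ∑ i, GradedDual.pairing t (b i : GradedDual t) x • c i = -coad ht f x := by
    intro x
    refine GradedDual.ext fun y => ?_
    have h1 := congrArg (fun g => GradedDual.pairing t g x) (hc y)
    simp only [map_sum, map_smul, LinearMap.sum_apply, LinearMap.smul_apply, smul_eq_mul] at h1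
    simp only [map_sum, map_smul, LinearMap.sum_apply, LinearMap.smul_apply, smul_eq_mul, map_neg,
      LinearMap.neg_apply]
    rw [coad_apply] at h1 ⊢
    rw [← lie_skew, map_neg, neg_neg, ← h1]
    exact Finset.sum_congr rfl fun i _ => mul_comm _ _
  refine ⟨(-(1 / 2) : ℚ) • ∑ i, ι ℚ (c i) * ι ℚ (b i : GradedDual t), ⟨?_, fun x => ?_⟩, ?_⟩
  · refine Submodule.smul_mem _ _ (Submodule.sum_mem _ fun i _ => ?_)
    exact SetLike.GradedMul.mul_mem (A := fun i : ℕ => ⋀[ℚ]^i (GradedDual t))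
      (ExteriorAux.ι_mem _) (ExteriorAux.ι_mem _)
  · rw [map_smul, map_sum]
    simp only [extContract_gradedDualEval_two]
    rw [← map_sum, Finset.sum_sub_distrib, hc, hc', sub_neg_eq_add, ← two_smul ℚ, map_smul,
      smul_smul]
    norm_num
  · rintro ω ⟨hω, h⟩
    rw [← sub_eq_zero]
    refine eq_zero_of_contract t two_ne_zero (sub_mem hω ?_) fun x => ?_
    · refine Submodule.smul_mem _ _ (Submodule.sum_mem _ fun i _ => ?_)
      exact SetLike.GradedMul.mul_mem (A := fun i : ℕ => ⋀[ℚ]^i (GradedDual t))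
        (ExteriorAux.ι_mem _) (ExteriorAux.ι_mem _)
    · rw [map_sub, h, map_smul, map_sum]
      simp only [extContract_gradedDualEval_two]
      rw [← map_sum, Finset.sum_sub_distrib, hc, hc', sub_neg_eq_add, ← two_smul ℚ, map_smul,
        smul_smul]
      norm_num

/-- The cobracket of the graded dual Lie coalgebra, with values in `Λ²`: it sends `f` to the
element `ω` with `ω(x, y) = -f ⁅x, y⁆`. -/
noncomputable def cobracket [Finite X] {t : X → 𝔤} (ht : LieGenerates t) :
    GradedDual t →ₗ[ℚ] ExteriorAlgebra ℚ (GradedDual t) where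
  toFun f := (existsUnique_cobracket ht f).choose
  map_add' f g := by
    refine ((existsUnique_cobracket ht (f + g)).choose_spec.2 _ ⟨?_, fun x => ?_⟩).symm
    · exact add_mem (existsUnique_cobracket ht f).choose_spec.1.1
        (existsUnique_cobracket ht g).choose_spec.1.1
    · rw [map_add, (existsUnique_cobracket ht f).choose_spec.1.2,
        (existsUnique_cobracket ht g).choose_spec.1.2, ← neg_add, ← map_add]
      rfl
  map_smul' c f := by
    refine ((existsUnique_cobracket ht (c • f)).choose_spec.2 _ ⟨?_, fun x => ?_⟩).symm
    · exact Submodule.smul_mem _ _ (existsUnique_cobracket ht f).choose_spec.1.1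
    · rw [RingHom.id_apply, map_smul, (existsUnique_cobracket ht f).choose_spec.1.2, smul_neg,
        ← map_smul]
      rfl

theorem cobracket_mem [Finite X] {t : X → 𝔤} (ht : LieGenerates t) (f : GradedDual t) :
    cobracket ht f ∈ ⋀[ℚ]^2 (GradedDual t) :=
  (existsUnique_cobracket ht f).choose_spec.1.1

theorem contract_cobracket [Finite X] {t : X → 𝔤} (ht : LieGenerates t) (f : GradedDual t)
    (x : 𝔤) : extContract (gradedDualEval t x) (cobracket ht f) = -ι ℚ (coad ht f x) :=
  (existsUnique_cobracket ht f).choose_spec.1.2 x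

/-- Auxiliary algebra map `a ↦ !![(-1)^{deg a} a, d a; 0, a]`, whose upper right entry is the
antiderivation that extends the cobracket. -/
noncomputable def ceAux [Finite X] {t : X → 𝔤} (ht : LieGenerates t) :
    ExteriorAlgebra ℚ (GradedDual t) →ₐ[ℚ]
      Matrix (Fin 2) (Fin 2) (ExteriorAlgebra ℚ (GradedDual t)) :=
  ExteriorAlgebra.lift ℚ
    ⟨{ toFun := fun f => !![-ι ℚ f, cobracket ht f; 0, ι ℚ f]
       map_add' := fun f g => by
        ext i j; fin_cases i <;> fin_cases j <;> simp [add_comm]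
       map_smul' := fun c f => by
        ext i j; fin_cases i <;> fin_cases j <;> simp }, fun f => by
      have h := ExteriorAux.ι_mul_homogeneous f (cobracket_mem ht f)
      ext i j
      fin_cases i <;> fin_cases j <;> simp [Matrix.mul_apply, Fin.sum_univ_two, h]⟩

theorem ceAux_ι [Finite X] {t : X → 𝔤} (ht : LieGenerates t) (f : GradedDual t) :
    ceAux ht (ι ℚ f) = !![-ι ℚ f, cobracket ht f; 0, ι ℚ f] := by
  rw [ceAux, ExteriorAlgebra.lift_ι_apply]
  rfl

/-- The Chevalley--Eilenberg differential: the antiderivation of the exterior algebra of the graded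
dual that extends the cobracket. -/
noncomputable def ceDifferential [Finite X] {t : X → 𝔤} (ht : LieGenerates t) :
    ExteriorAlgebra ℚ (GradedDual t) →ₗ[ℚ] ExteriorAlgebra ℚ (GradedDual t) where
  toFun a := ceAux ht a 0 1
  map_add' a b := by rw [map_add, Matrix.add_apply]
  map_smul' c a := by rw [map_smul, Matrix.smul_apply, RingHom.id_apply]

theorem ceAux_lower [Finite X] {t : X → 𝔤} (ht : LieGenerates t)
    (a : ExteriorAlgebra ℚ (GradedDual t)) : ceAux ht a 1 1 = a := by
  induction a using ext_left_induction with
  | algebraMap r => rw [AlgHom.commutes, Matrix.algebraMap_matrix_apply, if_pos rfl]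
  | add x y hx hy => rw [map_add, Matrix.add_apply, hx, hy]
  | ι_mul x m hx => rw [map_mul, ceAux_ι, Matrix.mul_apply, Fin.sum_univ_two, hx]; simp

theorem ceDifferential_algebraMap [Finite X] {t : X → 𝔤} (ht : LieGenerates t) (r : ℚ) :
    ceDifferential ht (algebraMap ℚ _ r) = 0 := by
  change ceAux ht (algebraMap ℚ _ r) 0 1 = 0
  rw [AlgHom.commutes, Matrix.algebraMap_matrix_apply, if_neg (by decide)]

theorem ceDifferential_ι [Finite X] {t : X → 𝔤} (ht : LieGenerates t) (f : GradedDual t) :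
    ceDifferential ht (ι ℚ f) = cobracket ht f := by
  change ceAux ht (ι ℚ f) 0 1 = _
  rw [ceAux_ι]; rfl

theorem ceDifferential_ι_mul [Finite X] {t : X → 𝔤} (ht : LieGenerates t) (f : GradedDual t)
    (b : ExteriorAlgebra ℚ (GradedDual t)) :
    ceDifferential ht (ι ℚ f * b) = cobracket ht f * b - ι ℚ f * ceDifferential ht b := by
  change ceAux ht (ι ℚ f * b) 0 1 = _ - ι ℚ f * ceAux ht b 0 1
  rw [map_mul, ceAux_ι, Matrix.mul_apply, Fin.sum_univ_two, ceAux_lower]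
  simp only [Matrix.of_apply, Matrix.cons_val_zero, Matrix.cons_val_one, Matrix.cons_val',
    Matrix.cons_val_fin_one]
  rw [neg_mul, add_comm, sub_eq_add_neg]

theorem ceDifferential_leibniz [Finite X] {t : X → 𝔤} (ht : LieGenerates t) (i : ℕ)
    (a : ExteriorAlgebra ℚ (GradedDual t)) (ha : a ∈ ⋀[ℚ]^i (GradedDual t))
    (b : ExteriorAlgebra ℚ (GradedDual t)) :
    ceDifferential ht (a * b) =
      ceDifferential ht a * b + (-1) ^ i * (a * ceDifferential ht b) := by
  induction ha using Submodule.pow_induction_on_left' with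
  | algebraMap r =>
    rw [ceDifferential_algebraMap, ← Algebra.smul_def, map_smul, Algebra.smul_def]; simp
  | add x y i _ _ hx hy => rw [add_mul, map_add, hx, hy, map_add]; noncomm_ring
  | mem_mul m hm i x _ hx =>
    obtain ⟨f, rfl⟩ := hm
    have hc : ((-1) ^ i : ExteriorAlgebra ℚ (GradedDual t)) * ι ℚ f = ι ℚ f * (-1) ^ i :=
      (Commute.neg_one_left _).pow_left i
    rw [mul_assoc, ceDifferential_ι_mul, hx, ceDifferential_ι_mul, pow_succ', mul_add,
      ← mul_assoc (ι ℚ f) ((-1) ^ i), ← hc]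
    noncomm_ring

theorem ceDifferential_mem [Finite X] {t : X → 𝔤} (ht : LieGenerates t) (i : ℕ)
    (a : ExteriorAlgebra ℚ (GradedDual t)) (ha : a ∈ ⋀[ℚ]^i (GradedDual t)) :
    ceDifferential ht a ∈ ⋀[ℚ]^(i + 1) (GradedDual t) := by
  induction ha using Submodule.pow_induction_on_left' with
  | algebraMap r => rw [ceDifferential_algebraMap]; exact zero_mem _
  | add x y i _ _ hx hy => rw [map_add]; exact add_mem hx hy
  | mem_mul m hm i x hx ih =>
    obtain ⟨f, rfl⟩ := hm
    rw [ceDifferential_ι_mul]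
    have h1 := SetLike.GradedMul.mul_mem (A := fun i : ℕ => ⋀[ℚ]^i (GradedDual t))
      (cobracket_mem ht f) hx
    have h2 := SetLike.GradedMul.mul_mem (A := fun i : ℕ => ⋀[ℚ]^i (GradedDual t))
      (ExteriorAux.ι_mem f) ih
    rw [show 2 + i = i.succ + 1 by omega] at h1
    rw [show 1 + (i + 1) = i.succ + 1 by omega] at h2
    exact sub_mem h1 h2

theorem extContract_mul [Finite X] {t : X → 𝔤} (φ : Module.Dual ℚ (GradedDual t))
    (i : ℕ) (a : ExteriorAlgebra ℚ (GradedDual t)) (ha : a ∈ ⋀[ℚ]^i (GradedDual t))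
    (b : ExteriorAlgebra ℚ (GradedDual t)) :
    extContract φ (a * b) = extContract φ a * b + (-1) ^ i * (a * extContract φ b) := by
  induction ha using Submodule.pow_induction_on_left' with
  | algebraMap r =>
    rw [extContract_algebraMap, ← Algebra.smul_def, map_smul, Algebra.smul_def]; simp
  | add x y i _ _ hx hy => rw [add_mul, map_add, hx, hy, map_add]; noncomm_ring
  | mem_mul m hm i x _ hx =>
    obtain ⟨f, rfl⟩ := hm
    have hc : ((-1) ^ i : ExteriorAlgebra ℚ (GradedDual t)) * ι ℚ f = ι ℚ f * (-1) ^ i :=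
      (Commute.neg_one_left _).pow_left i
    rw [mul_assoc, extContract_ι_mul, hx, extContract_ι_mul, pow_succ', mul_add,
      ← mul_assoc (ι ℚ f) ((-1) ^ i), ← hc, sub_mul, smul_mul_assoc]
    noncomm_ring

/-- Auxiliary: the Lie derivative `d ι_x + ι_x d`. -/
noncomputable def ceLie [Finite X] {t : X → 𝔤} (ht : LieGenerates t) (x : 𝔤)
    (a : ExteriorAlgebra ℚ (GradedDual t)) : ExteriorAlgebra ℚ (GradedDual t) :=
  ceDifferential ht (extContract (gradedDualEval t x) a) +
    extContract (gradedDualEval t x) (ceDifferential ht a)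

theorem ceLie_ι_mul [Finite X] {t : X → 𝔤} (ht : LieGenerates t) (x : 𝔤) (f : GradedDual t)
    (b : ExteriorAlgebra ℚ (GradedDual t)) :
    ceLie ht x (ι ℚ f * b) = -ι ℚ (coad ht f x) * b + ι ℚ f * ceLie ht x b := by
  simp only [ceLie]
  rw [ceDifferential_ι_mul, extContract_ι_mul, map_sub, map_smul, ceDifferential_ι_mul, map_sub,
    extContract_mul _ 2 _ (cobracket_mem ht f), extContract_ι_mul, contract_cobracket]
  noncomm_ring

theorem contract_ceLie [Finite X] {t : X → 𝔤} (ht : LieGenerates t) (x y : 𝔤)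
    (a : ExteriorAlgebra ℚ (GradedDual t)) :
    extContract (gradedDualEval t y) (ceLie ht x a) =
      ceLie ht x (extContract (gradedDualEval t y) a) -
        extContract (gradedDualEval t ⁅x, y⁆) a := by
  induction a using ext_left_induction with
  | algebraMap r => simp [ceLie, extContract_algebraMap, ceDifferential_algebraMap]
  | add a b ha hb =>
    have h : ∀ a b, ceLie ht x (a + b) = ceLie ht x a + ceLie ht x b := by
      intro a b; simp only [ceLie, map_add]; abel
    simp only [map_add, h, ha, hb]; abel
  | ι_mul b f hb =>
    have h : ∀ a b, ceLie ht x (a - b) = ceLie ht x a - ceLie ht x b := by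
      intro a b; simp only [ceLie, map_sub]; abel
    have h' : ∀ (c : ℚ) a, ceLie ht x (c • a) = c • ceLie ht x a := by
      intro c a; simp only [ceLie, map_smul, smul_add]
    rw [ceLie_ι_mul, map_add, neg_mul, map_neg]
    simp only [extContract_ι_mul]
    rw [hb, h, h', ceLie_ι_mul]
    have e : gradedDualEval t y (coad ht f x) = gradedDualEval t ⁅x, y⁆ f := rfl
    rw [e]
    noncomm_ring

theorem ceDifferential_cobracket [Finite X] {t : X → 𝔤} (ht : LieGenerates t)
    (f : GradedDual t) : ceDifferential ht (cobracket ht f) = 0 := by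
  have hmem : ceDifferential ht (cobracket ht f) ∈ ⋀[ℚ]^3 (GradedDual t) :=
    ceDifferential_mem ht 2 _ (cobracket_mem ht f)
  refine eq_zero_of_contract t three_ne_zero hmem fun x => ?_
  refine eq_zero_of_contract t two_ne_zero (extContract_mem _ hmem) fun y => ?_
  have h1 : extContract (gradedDualEval t x) (ceDifferential ht (cobracket ht f)) =
      ceLie ht x (cobracket ht f) + cobracket ht (coad ht f x) := by
    rw [ceLie, contract_cobracket, map_neg, ceDifferential_ι]; abel
  have h2 : ∀ g : GradedDual t, ceLie ht x (-ι ℚ g) = ι ℚ (coad ht g x) := by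
    intro g
    rw [ceLie, map_neg, map_neg, extContract_ι, ← map_neg, ← map_neg, ceDifferential_algebraMap,
      map_neg, ceDifferential_ι, map_neg, contract_cobracket]
    simp
  rw [h1, map_add, contract_ceLie, contract_cobracket, contract_cobracket, contract_cobracket, h2,
    sub_neg_eq_add, ← map_add, ← sub_eq_add_neg, ← map_sub]
  have h3 : coad ht (coad ht f y) x + coad ht f ⁅x, y⁆ - coad ht (coad ht f x) y = 0 := by
    refine GradedDual.ext fun z => ?_
    rw [map_sub, map_add, LinearMap.sub_apply, LinearMap.add_apply]
    simp only [coad_apply]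
    rw [lie_lie x y z, map_sub]
    simp
  rw [h3, map_zero]

theorem ceDifferential_ceDifferential [Finite X] {t : X → 𝔤} (ht : LieGenerates t)
    (a : ExteriorAlgebra ℚ (GradedDual t)) :
    ceDifferential ht (ceDifferential ht a) = 0 := by
  induction a using ext_left_induction with
  | algebraMap r => rw [ceDifferential_algebraMap, map_zero]
  | add a b ha hb => rw [map_add, map_add, ha, hb, add_zero]
  | ι_mul b f hb =>
    rw [ceDifferential_ι_mul, map_sub, ceDifferential_ι_mul, hb,
      ceDifferential_leibniz ht 2 _ (cobracket_mem ht f), ceDifferential_cobracket]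
    simp

/-- The Chevalley--Eilenberg complex of the graded dual Lie coalgebra of a Lie algebra that is
generated by finitely many elements `t x` of weight `1`: the free graded commutative algebra on the
graded dual (placed in degree `1`), whose differential is the antiderivation `d` with
`(d f)(x, y) = -f ⁅x, y⁆` for `f` in the graded dual. -/
noncomputable def chevalleyEilenberg [Finite X] {t : X → 𝔤} (ht : LieGenerates t) :
    Cdga.{u} where
  toGradedCommAlg := exteriorGradedCommAlg (GradedDual t)
  d := ceDifferential ht
  d_mem := ceDifferential_mem ht
  d_d := ceDifferential_ceDifferential ht
  leibniz := ceDifferential_leibniz ht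

end Differential

/-! ### Lie Koszul duals and Koszul algebras -/

section Koszul

open ExteriorAlgebra

variable {X : Type u}

/-- The coefficient of `e_x e_y` in a quadratic element of the exterior algebra on generators
`e_x`; equivalently its pairing with `t_x ∧ t_y`, where the `t_x` are dual to the `e_x`. -/
noncomputable def quadCoeff (x y : X) : ExteriorAlgebra ℚ (X →₀ ℚ) →ₗ[ℚ] ℚ :=
  ExteriorAlgebra.algebraMapInv.toLinearMap ∘ₗ
    extContract (Finsupp.lapply y) ∘ₗ extContract (Finsupp.lapply x)

/-- The Lie ideal of the free Lie algebra on the dual generators `t_x` that is generated by the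
annihilator `R^⊥` of a set `R` of quadratic elements: `t_x ∧ t_y` is identified with the bracket
`⁅t_x, t_y⁆`. -/
noncomputable def lieKoszulRelations (R : Set (ExteriorAlgebra ℚ (X →₀ ℚ))) :
    LieIdeal ℚ (FreeLieAlgebra ℚ X) :=
  LieSubmodule.lieSpan ℚ (FreeLieAlgebra ℚ X)
    {z | ∃ c : X × X →₀ ℚ, (∀ r ∈ R, (c.sum fun p a => a * quadCoeff p.1 p.2 r) = 0) ∧
      z = c.sum fun p a => a • ⁅FreeLieAlgebra.of ℚ p.1, FreeLieAlgebra.of ℚ p.2⁆}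

/-- The Lie Koszul dual `Lie(V^*) / (R^⊥)` of the quadratic graded commutative algebra
`Λ V / (R)`, where `V` has basis `e_x`. -/
abbrev LieKoszulDual (R : Set (ExteriorAlgebra ℚ (X →₀ ℚ))) : Type u :=
  FreeLieAlgebra ℚ X ⧸ lieKoszulRelations R

/-- The generators of the Lie Koszul dual. -/
noncomputable def lieKoszulGen (R : Set (ExteriorAlgebra ℚ (X →₀ ℚ))) (x : X) :
    LieKoszulDual R :=
  LieSubmodule.Quotient.mk' (lieKoszulRelations R) (FreeLieAlgebra.of ℚ x)

theorem lieKoszulGen_generates (R : Set (ExteriorAlgebra ℚ (X →₀ ℚ))) :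
    LieGenerates (lieKoszulGen R) := by
  let q : FreeLieAlgebra ℚ X →ₗ⁅ℚ⁆ LieKoszulDual R :=
    { (LieSubmodule.Quotient.mk' (lieKoszulRelations R) :
        FreeLieAlgebra ℚ X →ₗ[ℚ] FreeLieAlgebra ℚ X ⧸ lieKoszulRelations R) with
      map_lie' := rfl }
  let K : LieSubalgebra ℚ (LieKoszulDual R) :=
    LieSubalgebra.lieSpan ℚ (LieKoszulDual R) (Set.range (lieKoszulGen R))
  let g : FreeLieAlgebra ℚ X →ₗ⁅ℚ⁆ K :=
    FreeLieAlgebra.lift ℚ fun x => ⟨lieKoszulGen R x, LieSubalgebra.subset_lieSpan ⟨x, rfl⟩⟩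
  have h : K.incl.comp g = q := FreeLieAlgebra.hom_ext fun x => by
    rw [LieHom.comp_apply, FreeLieAlgebra.lift_of_apply]
    rfl
  change K = ⊤
  rw [eq_top_iff]
  intro z _
  obtain ⟨w, rfl⟩ := LieSubmodule.Quotient.surjective_mk' (lieKoszulRelations R) z
  have hw : (g w : LieKoszulDual R) = q w := LieHom.congr_fun h w
  change q w ∈ K
  rw [← hw]
  exact (g w).2

/-- The Chevalley--Eilenberg complex of the Lie coalgebra dual to the Lie Koszul dual of
`Λ V / (R)`. -/
noncomputable def koszulCE [Finite X] (R : Set (ExteriorAlgebra ℚ (X →₀ ℚ))) : Cdga.{u} :=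
  chevalleyEilenberg (lieKoszulGen_generates R)

/-- A graded commutative algebra `A` is Koszul if it is quadratic, i.e. of the form `Λ V / (R)` with
`V` finite-dimensional of degree `1` and `R ⊆ Λ² V`, and if it is joined by a zig-zag of
quasi-isomorphisms of cdgas to the Chevalley--Eilenberg complex of the dual of its Lie Koszul
dual. -/
def GradedCommAlg.IsKoszul (A : GradedCommAlg.{u}) : Prop :=
  ∃ (X : Type u) (_ : Finite X) (π : ExteriorAlgebra ℚ (X →₀ ℚ) →ₐ[ℚ] A.carrier)
    (R : Set (ExteriorAlgebra ℚ (X →₀ ℚ))),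
    (∀ (i : ℕ) (a), a ∈ ⋀[ℚ]^i (X →₀ ℚ) → π a ∈ A.deg i) ∧
    Function.Surjective π ∧
    (∀ r ∈ R, r ∈ ⋀[ℚ]^2 (X →₀ ℚ)) ∧
    TwoSidedIdeal.ker π = TwoSidedIdeal.span R ∧
    Cdga.QuasiIsomorphic A.toCdga (koszulCE R)

end Koszul

/-! ### Orlik--Solomon algebras -/

section OrlikSolomon

open ExteriorAlgebra

variable (L : Type u) [Lattice L] [BoundedOrder L]

/-- The generator `e_H` of the exterior algebra on the atoms of a lattice. -/
noncomputable def osGen (H : LatticeAtom L) : ExteriorAlgebra ℚ (LatticeAtom L →₀ ℚ) :=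
  ι ℚ (Finsupp.single H 1)

/-- The antiderivation `δ` with `δ e_H = 1` for all atoms `H`. -/
noncomputable def osDelta : ExteriorAlgebra ℚ (LatticeAtom L →₀ ℚ) →ₗ[ℚ]
    ExteriorAlgebra ℚ (LatticeAtom L →₀ ℚ) :=
  extContract (Finsupp.linearCombination ℚ fun _ => (1 : ℚ))

open Classical in
/-- The relations `δ e_C` of the Orlik--Solomon algebra, where `C` is a circuit and `e_C` is the
product of the `e_H` with `H` in `C`, in any order. -/
def osRelations : Set (ExteriorAlgebra ℚ (LatticeAtom L →₀ ℚ)) :=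
  {r | ∃ l : List (LatticeAtom L), l.Nodup ∧ IsLatticeCircuit l.toFinset ∧
    r = osDelta L (l.map (osGen L)).prod}

theorem osRelations_homogeneous :
    ∀ r ∈ osRelations L, ∃ k : ℕ, r ∈ ⋀[ℚ]^k (LatticeAtom L →₀ ℚ) := by
  rintro _ ⟨l, h1, h2, rfl⟩
  clear h1 h2
  refine ⟨l.length - 1, extContract_mem _ ?_⟩
  induction l with
  | nil => exact SetLike.GradedOne.one_mem (A := fun i : ℕ => ⋀[ℚ]^i (LatticeAtom L →₀ ℚ))
  | cons H l ih =>
    have h := SetLike.GradedMul.mul_mem (A := fun i : ℕ => ⋀[ℚ]^i (LatticeAtom L →₀ ℚ))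
      (ExteriorAux.ι_mem (Finsupp.single H 1)) ih
    rw [add_comm] at h
    rw [List.map_cons, List.prod_cons, List.length_cons]
    exact h

/-- The Orlik--Solomon algebra of a lattice, over `ℚ`. -/
noncomputable def orlikSolomon : GradedCommAlg.{u} :=
  exteriorQuotient (osRelations L) (osRelations_homogeneous L)

end OrlikSolomon

/-!
Let `x ↦ t x` be the generators of the Lie Koszul dual `𝔤` of a quadratic algebra `A = Λ V / (R)`.
Restricting linear forms on `𝔤` to the generators gives a morphism from the Chevalley--Eilenberg
complex of the graded dual of `𝔤` to `A` with zero differential. It maps onto `A`, and in degree one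
the closed forms are dual to the generators. Every relation in `R` is the differential of a form on
`𝔤`, since it defines a central extension of the abelianization of `𝔤` that is generated by the
lifts of the `t x`. Therefore the morphism is a quasi-isomorphism as soon as the cohomology of the
complex is generated in degree one (`quasiIsomorphic_koszulCE`).

For a supersolvable lattice this generation is proved by induction along a maximal chain of modular
elements. If a modular element `F'` is covered by `F`, the atoms below `F'` form a modular
hyperplane in the geometry of the atoms below `F`: every line through an atom outside `F'` meets
`F'`. Sending the atoms outside `F'` to zero is a split surjection of Lie Koszul duals. Its kernel is
the free Lie algebra on the atoms outside `F'`: an atom `H ≤ F'` acts on this free Lie algebra as the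
derivation `K ↦ ⁅K, ∑ K'⁆`, where `K'` runs over the atoms outside `F'` on the line through `H` and
`K`, and these derivations satisfy the relations of the Lie Koszul dual
(`LineGeometry.IsModularHyperplane.lift_injective`). As the action is trivial on the abelianization
of the free Lie algebra, a filtration argument transports generation in degree one from `F'` to `F`
(`ExteriorDifferential.IsExtension.generatedInDegreeOne`). It uses that the cohomology of a free Lie
algebra vanishes in degrees `≥ 2` (`FreeLieAlgebra.exactAt`); degree two holds because extensions of
free Lie algebras split, and the higher degrees follow by a contracting homotopy built from the
weight derivation (`ExteriorDifferential.exactAt_of_exactAt_one`).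

The same induction shows that the Orlik--Solomon algebra is quadratic (`span_osRelations`): a product
of two generators `K`, `K'` outside `F'` may be replaced, modulo quadratic relations, by products
that contain the generator of the point of `F'` on the line through `K` and `K'`.
-/

open ExteriorAlgebra TensorProduct

/-! ### Linear algebra over a field -/

theorem LinearMap.exists_pseudoinverse {A B : Type*} [AddCommGroup A] [Module ℚ A]
    [AddCommGroup B] [Module ℚ B] (φ : A →ₗ[ℚ] B) :
    ∃ g : B →ₗ[ℚ] A, ∀ a, φ (g (φ a)) = φ a := by
  obtain ⟨g₀, hg₀⟩ := φ.rangeRestrict.exists_rightInverse_of_surjective φ.range_rangeRestrict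
  obtain ⟨g, hg⟩ := LinearMap.exists_extend g₀
  refine ⟨g, fun a => ?_⟩
  have h1 := LinearMap.congr_fun hg (φ.rangeRestrict a)
  have h2 := LinearMap.congr_fun hg₀ (φ.rangeRestrict a)
  have h3 : g (φ a) = g₀ (φ.rangeRestrict a) := h1
  rw [h3]
  exact congrArg Subtype.val h2

/-- A contracting homotopy in one degree: if `d` is exact on `P`, with primitives in `P'`, then
the identity of `P` is `d s + r d` for linear maps `s` and `r`. -/
theorem LinearMap.exists_splitting {V : Type*} [AddCommGroup V] [Module ℚ V] (d : V →ₗ[ℚ] V)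
    (P P' : Submodule ℚ V) (h : ∀ x ∈ P, d x = 0 → ∃ y ∈ P', d y = x) :
    ∃ s r : V →ₗ[ℚ] V, (∀ x, s x ∈ P') ∧ (∀ x, r x ∈ P) ∧ ∀ x ∈ P, x = d (s x) + r (d x) := by
  obtain ⟨g, hg⟩ := (d.domRestrict P).exists_pseudoinverse
  obtain ⟨g', hg'⟩ := (d.domRestrict P').exists_pseudoinverse
  refine ⟨P'.subtype ∘ₗ g' ∘ₗ (LinearMap.id - P.subtype ∘ₗ g ∘ₗ d), P.subtype ∘ₗ g,
    fun x => (g' _).2, fun x => (g _).2, fun x hx => ?_⟩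
  have h1 : d (g (d x)) = d x := hg ⟨x, hx⟩
  obtain ⟨y, hy, hyx⟩ := h (x - g (d x)) (sub_mem hx (g (d x)).2) (by rw [map_sub, h1, sub_self])
  have h2 : d (g' (d y)) = d y := hg' ⟨y, hy⟩
  change x = d (g' (x - g (d x))) + g (d x)
  rw [← hyx, h2, hyx, sub_add_cancel]

/-- The subspace of a tensor product spanned by the `a ⊗ b` with `a` in `P` and `b` in `Q`. -/
abbrev tensorSub {A B : Type*} [AddCommGroup A] [Module ℚ A] [AddCommGroup B] [Module ℚ B]
    (P : Submodule ℚ A) (Q : Submodule ℚ B) : Submodule ℚ (A ⊗[ℚ] B) :=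
  Submodule.map₂ (TensorProduct.mk ℚ A B) P Q

section TensorSub

variable {A B A' B' : Type*} [AddCommGroup A] [Module ℚ A] [AddCommGroup B] [Module ℚ B]
  [AddCommGroup A'] [Module ℚ A'] [AddCommGroup B'] [Module ℚ B']

theorem tmul_mem_tensorSub {P : Submodule ℚ A} {Q : Submodule ℚ B} {a : A} {b : B} (ha : a ∈ P)
    (hb : b ∈ Q) : a ⊗ₜ[ℚ] b ∈ tensorSub P Q :=
  Submodule.apply_mem_map₂ _ ha hb

theorem map_mem_of_tensorSub {P : Submodule ℚ A} {Q : Submodule ℚ B} {M : Type*} [AddCommGroup M]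
    [Module ℚ M] (f : A ⊗[ℚ] B →ₗ[ℚ] M) (S : Submodule ℚ M)
    (h : ∀ a ∈ P, ∀ b ∈ Q, f (a ⊗ₜ b) ∈ S) {z : A ⊗[ℚ] B} (hz : z ∈ tensorSub P Q) : f z ∈ S :=
  have hle : tensorSub P Q ≤ S.comap f := Submodule.map₂_le.mpr h
  hle hz

theorem eqOn_tensorSub {P : Submodule ℚ A} {Q : Submodule ℚ B} {M : Type*} [AddCommGroup M]
    [Module ℚ M] (f g : A ⊗[ℚ] B →ₗ[ℚ] M)
    (h : ∀ a ∈ P, ∀ b ∈ Q, f (a ⊗ₜ b) = g (a ⊗ₜ b)) {z : A ⊗[ℚ] B} (hz : z ∈ tensorSub P Q) :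
    f z = g z :=
  have hle : tensorSub P Q ≤ LinearMap.eqLocus f g := Submodule.map₂_le.mpr h
  hle hz

theorem tensorSub_top_top : tensorSub (⊤ : Submodule ℚ A) (⊤ : Submodule ℚ B) = ⊤ := by
  rw [eq_top_iff]
  intro z _
  induction z using TensorProduct.induction_on with
  | zero => exact zero_mem _
  | tmul a b => exact tmul_mem_tensorSub trivial trivial
  | add x y hx hy => exact add_mem (hx trivial) (hy trivial)

end TensorSub

/-! ### Differentials on exterior algebras -/

section ExteriorDifferential

variable {W : Type u} [AddCommGroup W] [Module ℚ W]

local notation "Λ" => ExteriorAlgebra ℚ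

/-- The sign automorphism of an exterior algebra. -/
noncomputable abbrev extSign : Λ W →ₐ[ℚ] Λ W := CliffordAlgebra.involute

theorem extSign_ι (w : W) : extSign (ι ℚ w) = -ι ℚ w := CliffordAlgebra.involute_ι w

theorem extSign_extSign (a : Λ W) : extSign (extSign a) = a := CliffordAlgebra.involute_involute a

theorem extSign_mem {k : ℕ} {a : Λ W} (ha : a ∈ ⋀[ℚ]^k W) : extSign a = (-1 : ℚ) ^ k • a := by
  induction ha using Submodule.pow_induction_on_left' with
  | algebraMap r => simp
  | add x y i _ _ hx hy => rw [map_add, hx, hy, smul_add]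
  | mem_mul m hm i x _ hx =>
    obtain ⟨w, rfl⟩ := hm
    rw [map_mul, extSign_ι, hx, pow_succ]
    simp

theorem ι_mul_eq (w : W) (b : Λ W) : ι ℚ w * b = extSign b * ι ℚ w := by
  induction b using ext_left_induction with
  | algebraMap r => rw [AlgHom.commutes, Algebra.commutes]
  | add x y hx hy => rw [map_add, mul_add, add_mul, hx, hy]
  | ι_mul x m hx =>
    rw [map_mul, extSign_ι, ← mul_assoc, ExteriorAux.ι_anticomm, neg_mul, mul_assoc, hx, neg_mul,
      neg_mul, mul_assoc]

theorem ι_mul_ι_mem (v w : W) : ι ℚ v * ι ℚ w ∈ ⋀[ℚ]^2 W :=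
  SetLike.GradedMul.mul_mem (A := fun i : ℕ => ⋀[ℚ]^i W) (ExteriorAux.ι_mem v) (ExteriorAux.ι_mem w)

theorem mem_exteriorPower_one {a : Λ W} (ha : a ∈ ⋀[ℚ]^1 W) : ∃ w, a = ι ℚ w := by
  have ha' : a ∈ LinearMap.range (ι ℚ : W →ₗ[ℚ] Λ W) ^ 1 := ha
  rw [pow_one] at ha'
  obtain ⟨w, rfl⟩ := ha'
  exact ⟨w, rfl⟩

theorem mem_exteriorPower_zero {a : Λ W} (ha : a ∈ ⋀[ℚ]^0 W) : ∃ r, a = algebraMap ℚ _ r := by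
  have ha' : a ∈ LinearMap.range (ι ℚ : W →ₗ[ℚ] Λ W) ^ 0 := ha
  rw [pow_zero] at ha'
  obtain ⟨r, rfl⟩ := Submodule.mem_one.mp ha'
  exact ⟨r, rfl⟩

theorem exteriorPower_succ_induction {k : ℕ} {p : Λ W → Prop}
    (ι_mul : ∀ w, ∀ b ∈ ⋀[ℚ]^k W, p (ι ℚ w * b)) (add : ∀ x y, p x → p y → p (x + y))
    {a : Λ W} (ha : a ∈ ⋀[ℚ]^(k + 1) W) : p a := by
  have ha' : a ∈ LinearMap.range (ι ℚ : W →ₗ[ℚ] Λ W) ^ (k + 1) := ha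
  rw [pow_succ'] at ha'
  refine Submodule.mul_induction_on ha' ?_ add
  rintro _ ⟨w, rfl⟩ b hb
  exact ι_mul w b hb

theorem exteriorPower_two_induction {p : Λ W → Prop}
    (ι_mul_ι : ∀ v w, p (ι ℚ v * ι ℚ w)) (add : ∀ x y, p x → p y → p (x + y))
    {a : Λ W} (ha : a ∈ ⋀[ℚ]^2 W) : p a := by
  refine exteriorPower_succ_induction (fun w b hb => ?_) add ha
  obtain ⟨v, rfl⟩ := mem_exteriorPower_one hb
  exact ι_mul_ι w v

theorem iSup_exteriorPower : ⨆ k, ⋀[ℚ]^k W = ⊤ :=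
  (DirectSum.Decomposition.isInternal (fun i : ℕ => ⋀[ℚ]^i W)).submodule_iSup_eq_top

variable (W) in
/-- A differential on the exterior algebra of `W`: an antiderivation `d` of degree `1` and of
square zero. It amounts to the structure of a Lie coalgebra on `W`, and makes the exterior algebra
its Chevalley--Eilenberg complex. -/
structure ExteriorDifferential where
  /-- the antiderivation -/
  d : Λ W →ₗ[ℚ] Λ W
  d_algebraMap : ∀ r : ℚ, d (algebraMap ℚ _ r) = 0
  d_ι_mem : ∀ w, d (ι ℚ w) ∈ ⋀[ℚ]^2 W
  d_ι_mul : ∀ w b, d (ι ℚ w * b) = d (ι ℚ w) * b - ι ℚ w * d b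
  d_d : ∀ a, d (d a) = 0

namespace ExteriorDifferential

variable (D : ExteriorDifferential W)

theorem d_mul (a b : Λ W) : D.d (a * b) = D.d a * b + extSign a * D.d b := by
  induction a using ext_left_induction with
  | algebraMap r =>
    rw [D.d_algebraMap, AlgHom.commutes, ← Algebra.smul_def, map_smul, Algebra.smul_def]; simp
  | add x y hx hy => rw [add_mul, map_add, hx, hy, map_add, map_add]; noncomm_ring
  | ι_mul x w hx =>
    rw [mul_assoc, D.d_ι_mul, hx, D.d_ι_mul, map_mul, extSign_ι]; noncomm_ring

theorem d_mem {k : ℕ} {a : Λ W} (ha : a ∈ ⋀[ℚ]^k W) : D.d a ∈ ⋀[ℚ]^(k + 1) W := by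
  induction ha using Submodule.pow_induction_on_left' with
  | algebraMap r => rw [D.d_algebraMap]; exact zero_mem _
  | add x y i _ _ hx hy => rw [map_add]; exact add_mem hx hy
  | mem_mul m hm i x hx ih =>
    obtain ⟨f, rfl⟩ := hm
    rw [D.d_ι_mul]
    have h1 := SetLike.GradedMul.mul_mem (A := fun i : ℕ => ⋀[ℚ]^i W) (D.d_ι_mem f) hx
    have h2 := SetLike.GradedMul.mul_mem (A := fun i : ℕ => ⋀[ℚ]^i W) (ExteriorAux.ι_mem f) ih
    rw [show 2 + i = i.succ + 1 by omega] at h1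
    rw [show 1 + (i + 1) = i.succ + 1 by omega] at h2
    exact sub_mem h1 h2

/-- The cohomology of the exterior algebra vanishes in degree `k + 1`. -/
def ExactAt (k : ℕ) : Prop :=
  ∀ c ∈ ⋀[ℚ]^(k + 1) W, D.d c = 0 → ∃ b ∈ ⋀[ℚ]^k W, D.d b = c

/-- The cohomology of the exterior algebra is generated, as an algebra, by classes of degree `1`. -/
def GeneratedInDegreeOne : Prop :=
  ∀ c, D.d c = 0 → ∃ c' ∈ Algebra.adjoin ℚ (ι ℚ '' {w | D.d (ι ℚ w) = 0}), ∃ b, c = c' + D.d b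

end ExteriorDifferential

end ExteriorDifferential

/-! ### The polarisation of an exterior algebra -/

section Polarisation

variable {W : Type u} [AddCommGroup W] [Module ℚ W]

local notation "Λ" => ExteriorAlgebra ℚ

/-- Left multiplication on the second factor of `W ⊗ Λ W`. -/
noncomputable def tensorMulLeft : Λ W →ₗ[ℚ] W ⊗[ℚ] Λ W →ₗ[ℚ] W ⊗[ℚ] Λ W :=
  LinearMap.lTensorHom W ∘ₗ LinearMap.mul ℚ (Λ W)

/-- Right multiplication on the second factor of `W ⊗ Λ W`. -/
noncomputable def tensorMulRight : Λ W →ₗ[ℚ] W ⊗[ℚ] Λ W →ₗ[ℚ] W ⊗[ℚ] Λ W :=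
  LinearMap.lTensorHom W ∘ₗ (LinearMap.mul ℚ (Λ W)).flip

theorem tensorMulLeft_tmul (a : Λ W) (w : W) (b : Λ W) :
    tensorMulLeft a (w ⊗ₜ b) = w ⊗ₜ (a * b) := rfl

theorem tensorMulRight_tmul (a : Λ W) (w : W) (b : Λ W) :
    tensorMulRight a (w ⊗ₜ b) = w ⊗ₜ (b * a) := rfl

theorem tensorMulLeft_mul (a b : Λ W) (z : W ⊗[ℚ] Λ W) :
    tensorMulLeft (a * b) z = tensorMulLeft a (tensorMulLeft b z) := by
  induction z using TensorProduct.induction_on with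
  | zero => simp
  | tmul w c => simp only [tensorMulLeft_tmul, mul_assoc]
  | add x y hx hy => simp only [map_add, hx, hy]

theorem tensorMulRight_mul (a b : Λ W) (z : W ⊗[ℚ] Λ W) :
    tensorMulRight (a * b) z = tensorMulRight b (tensorMulRight a z) := by
  induction z using TensorProduct.induction_on with
  | zero => simp
  | tmul w c => simp only [tensorMulRight_tmul, mul_assoc]
  | add x y hx hy => simp only [map_add, hx, hy]

theorem tensorMulLeft_right (a b : Λ W) (z : W ⊗[ℚ] Λ W) :
    tensorMulLeft a (tensorMulRight b z) = tensorMulRight b (tensorMulLeft a z) := by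
  induction z using TensorProduct.induction_on with
  | zero => simp
  | tmul w c => simp only [tensorMulLeft_tmul, tensorMulRight_tmul, mul_assoc]
  | add x y hx hy => simp only [map_add, hx, hy]

theorem tensorMulLeft_algebraMap (r : ℚ) (z : W ⊗[ℚ] Λ W) :
    tensorMulLeft (algebraMap ℚ _ r) z = r • z := by
  induction z using TensorProduct.induction_on with
  | zero => simp
  | tmul w c => rw [tensorMulLeft_tmul, ← Algebra.smul_def, TensorProduct.tmul_smul]
  | add x y hx hy => simp only [map_add, hx, hy, smul_add]

variable (W) in
/-- The polarisation `Λ W → W ⊗ Λ W`, i.e. `w₁ ⋯ wₖ ↦ ∑ ± wᵢ ⊗ w₁ ⋯ ŵᵢ ⋯ wₖ`. -/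
noncomputable def polarize : Λ W →ₗ[ℚ] W ⊗[ℚ] Λ W :=
  CliffordAlgebra.foldr' (0 : QuadraticForm ℚ W)
    (LinearMap.mk₂ ℚ (fun m (p : Λ W × W ⊗[ℚ] Λ W) => m ⊗ₜ p.1 - tensorMulLeft (ι ℚ m) p.2)
      (fun m n p => by
        rw [TensorProduct.add_tmul, map_add, map_add, LinearMap.add_apply]; abel)
      (fun r m p => by
        rw [← TensorProduct.smul_tmul', map_smul, map_smul, smul_sub, LinearMap.smul_apply])
      (fun m p q => by rw [Prod.fst_add, Prod.snd_add, TensorProduct.tmul_add, map_add]; abel)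
      (fun r m p => by
        rw [Prod.smul_fst, Prod.smul_snd, TensorProduct.tmul_smul, map_smul, smul_sub]))
    (fun m x z => by
      simp only [LinearMap.mk₂_apply]
      rw [map_sub, tensorMulLeft_tmul, ← tensorMulLeft_mul, ι_sq_zero, map_zero]
      simp) 0

theorem polarize_algebraMap (r : ℚ) : polarize W (algebraMap ℚ _ r) = 0 := by
  rw [polarize, CliffordAlgebra.foldr'_algebraMap, smul_zero]

theorem polarize_ι_mul (w : W) (b : Λ W) :
    polarize W (ι ℚ w * b) = w ⊗ₜ b - tensorMulLeft (ι ℚ w) (polarize W b) := by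
  rw [polarize, CliffordAlgebra.foldr'_ι_mul]; rfl

theorem polarize_ι (w : W) : polarize W (ι ℚ w) = w ⊗ₜ 1 := by
  have h := polarize_ι_mul w (1 : Λ W)
  rwa [← map_one (algebraMap ℚ (Λ W)), polarize_algebraMap, map_zero, sub_zero, map_one,
    mul_one] at h

theorem polarize_ι_mul_ι (v w : W) :
    polarize W (ι ℚ v * ι ℚ w) = v ⊗ₜ ι ℚ w - w ⊗ₜ ι ℚ v := by
  rw [polarize_ι_mul, polarize_ι, tensorMulLeft_tmul, mul_one]

theorem polarize_mul (a b : Λ W) :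
    polarize W (a * b) =
      tensorMulRight b (polarize W a) + tensorMulLeft (extSign a) (polarize W b) := by
  induction a using ext_left_induction with
  | algebraMap r =>
    rw [polarize_algebraMap, map_zero, zero_add, AlgHom.commutes, ← Algebra.smul_def, map_smul,
      tensorMulLeft_algebraMap]
  | add x y hx hy =>
    simp only [add_mul, map_add, hx, hy, LinearMap.add_apply]; abel
  | ι_mul x w hx =>
    rw [mul_assoc, polarize_ι_mul, hx, polarize_ι_mul, map_mul, extSign_ι, tensorMulLeft_mul,
      map_sub, map_add, tensorMulRight_tmul, tensorMulLeft_right, map_neg, LinearMap.neg_apply]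
    abel

theorem polarize_mem {k : ℕ} {a : Λ W} (ha : a ∈ ⋀[ℚ]^(k + 1) W) :
    polarize W a ∈ tensorSub (⊤ : Submodule ℚ W) (⋀[ℚ]^k W) := by
  induction k generalizing a with
  | zero =>
    obtain ⟨w, rfl⟩ := mem_exteriorPower_one ha
    rw [polarize_ι]
    exact tmul_mem_tensorSub trivial (SetLike.GradedOne.one_mem (A := fun i : ℕ => ⋀[ℚ]^i W))
  | succ k ih =>
    refine exteriorPower_succ_induction (p := fun a => polarize W a ∈ _) (fun w b hb => ?_)
      (fun x y hx hy => by rw [map_add]; exact add_mem hx hy) ha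
    rw [polarize_ι_mul]
    refine sub_mem (tmul_mem_tensorSub trivial hb) ?_
    refine map_mem_of_tensorSub _ _ (fun v _ c hc => ?_) (ih hb)
    rw [tensorMulLeft_tmul]
    refine tmul_mem_tensorSub trivial ?_
    have := SetLike.GradedMul.mul_mem (A := fun i : ℕ => ⋀[ℚ]^i W) (ExteriorAux.ι_mem w) hc
    rwa [add_comm] at this

end Polarisation

/-! ### Cohomology with coefficients in the coadjoint comodule -/

namespace ExteriorDifferential

variable {W : Type u} [AddCommGroup W] [Module ℚ W] (D : ExteriorDifferential W)

local notation "Λ" => ExteriorAlgebra ℚ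

/-- The coaction part `w ⊗ b ↦ polarize (d w) b` of the differential with coadjoint
coefficients. -/
noncomputable def coaction : W ⊗[ℚ] Λ W →ₗ[ℚ] W ⊗[ℚ] Λ W :=
  TensorProduct.lift
    ((tensorMulRight (W := W)).flip ∘ₗ polarize W ∘ₗ D.d ∘ₗ (ι ℚ : W →ₗ[ℚ] Λ W))

theorem coaction_tmul (w : W) (b : Λ W) :
    D.coaction (w ⊗ₜ b) = tensorMulRight b (polarize W (D.d (ι ℚ w))) := rfl

/-- The differential of the Chevalley--Eilenberg complex `W ⊗ Λ W` with coefficients in the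
coadjoint comodule `W`. -/
noncomputable def dCoadj : W ⊗[ℚ] Λ W →ₗ[ℚ] W ⊗[ℚ] Λ W := D.d.lTensor W - D.coaction

theorem dCoadj_tmul (w : W) (b : Λ W) :
    D.dCoadj (w ⊗ₜ b) = w ⊗ₜ D.d b - tensorMulRight b (polarize W (D.d (ι ℚ w))) := rfl

theorem polarize_mul_ι_of_mem_two (v : W) {ω : Λ W} (hω : ω ∈ ⋀[ℚ]^2 W) :
    tensorMulRight (ι ℚ v) (polarize W ω) = -tensorMulLeft (ι ℚ v) (polarize W ω) := by
  refine exteriorPower_two_induction (p := fun ω => tensorMulRight (ι ℚ v) (polarize W ω) =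
    -tensorMulLeft (ι ℚ v) (polarize W ω)) (fun x y => ?_) (fun x y hx hy => ?_) hω
  · rw [polarize_ι_mul_ι, map_sub, map_sub]
    simp only [tensorMulRight_tmul, tensorMulLeft_tmul]
    rw [ExteriorAux.ι_anticomm v y, ExteriorAux.ι_anticomm v x, TensorProduct.tmul_neg,
      TensorProduct.tmul_neg]
    abel
  · simp only [map_add, hx, hy]; abel

theorem dCoadj_tensorMulLeft_ι (v : W) (z : W ⊗[ℚ] Λ W) :
    D.dCoadj (tensorMulLeft (ι ℚ v) z) =
      tensorMulLeft (D.d (ι ℚ v)) z - tensorMulLeft (ι ℚ v) (D.dCoadj z) := by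
  induction z using TensorProduct.induction_on with
  | zero => simp
  | tmul w b =>
    rw [tensorMulLeft_tmul, dCoadj_tmul, dCoadj_tmul, D.d_ι_mul, tensorMulRight_mul,
      polarize_mul_ι_of_mem_two v (D.d_ι_mem w), map_neg, map_sub, tensorMulLeft_right,
      tensorMulLeft_tmul, tensorMulLeft_tmul, TensorProduct.tmul_sub]
    abel
  | add x y hx hy => simp only [map_add, hx, hy]; abel

theorem polarize_mul_of_mem_two {ω : Λ W} (hω : ω ∈ ⋀[ℚ]^2 W) (b : Λ W) :
    polarize W (ω * b) = tensorMulRight b (polarize W ω) + tensorMulLeft ω (polarize W b) := by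
  rw [polarize_mul, extSign_mem hω]; norm_num

theorem dCoadj_polarize (a : Λ W) : D.dCoadj (polarize W a) = -polarize W (D.d a) := by
  induction a using ext_left_induction with
  | algebraMap r => simp [polarize_algebraMap, D.d_algebraMap]
  | add x y hx hy => simp only [map_add, hx, hy]; abel
  | ι_mul b w hb =>
    rw [polarize_ι_mul, map_sub, dCoadj_tmul, dCoadj_tensorMulLeft_ι, hb, D.d_ι_mul, map_sub,
      polarize_mul_of_mem_two (D.d_ι_mem w), polarize_ι_mul, map_neg]
    abel

theorem dCoadj_tensorMulRight {ω : Λ W} (hω : ω ∈ ⋀[ℚ]^2 W) (b : Λ W) :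
    D.dCoadj (tensorMulRight b (polarize W ω)) =
      tensorMulRight b (D.dCoadj (polarize W ω)) - tensorMulRight (D.d b) (polarize W ω) := by
  have key : ∀ v w : W, D.dCoadj (tensorMulRight b (v ⊗ₜ ι ℚ w)) =
      tensorMulRight b (D.dCoadj (v ⊗ₜ ι ℚ w)) - tensorMulRight (D.d b) (v ⊗ₜ ι ℚ w) := by
    intro v w
    rw [tensorMulRight_tmul, tensorMulRight_tmul, dCoadj_tmul, dCoadj_tmul, D.d_ι_mul, map_sub,
      tensorMulRight_tmul, tensorMulRight_mul, TensorProduct.tmul_sub]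
    abel
  refine exteriorPower_two_induction (p := fun ω => D.dCoadj (tensorMulRight b (polarize W ω)) =
      tensorMulRight b (D.dCoadj (polarize W ω)) - tensorMulRight (D.d b) (polarize W ω))
    (fun x y => ?_) (fun x y hx hy => ?_) hω
  · rw [polarize_ι_mul_ι]
    simp only [map_sub, key]
    abel
  · simp only [map_add, hx, hy]; abel

theorem dCoadj_dCoadj (z : W ⊗[ℚ] Λ W) : D.dCoadj (D.dCoadj z) = 0 := by
  induction z using TensorProduct.induction_on with
  | zero => simp
  | tmul w b =>
    rw [dCoadj_tmul, map_sub, dCoadj_tmul, D.d_d, dCoadj_tensorMulRight _ (D.d_ι_mem w),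
      dCoadj_polarize, D.d_d, TensorProduct.tmul_zero, map_zero, neg_zero, map_zero]
    abel
  | add x y hx hy => rw [map_add, map_add, hx, hy, add_zero]

/-! ### Weight gradings -/

section Weights

variable (N : W →ₗ[ℚ] W)

/-- The product `w ⊗ b ↦ (N w) b`. -/
noncomputable def mulTwisted : W ⊗[ℚ] Λ W →ₗ[ℚ] Λ W :=
  TensorProduct.lift (LinearMap.mul ℚ (Λ W) ∘ₗ (ι ℚ : W →ₗ[ℚ] Λ W) ∘ₗ N)

theorem mulTwisted_tmul (w : W) (b : Λ W) : mulTwisted N (w ⊗ₜ b) = ι ℚ (N w) * b := rfl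

/-- The extension of an endomorphism `N` of `W` to a derivation of the exterior algebra. -/
noncomputable def extDerivation : Λ W →ₗ[ℚ] Λ W := mulTwisted N ∘ₗ polarize W

theorem extDerivation_algebraMap (r : ℚ) : extDerivation N (algebraMap ℚ _ r) = 0 := by
  rw [extDerivation, LinearMap.comp_apply, polarize_algebraMap, map_zero]

theorem mulTwisted_tensorMulLeft_ι (v : W) (z : W ⊗[ℚ] Λ W) :
    mulTwisted N (tensorMulLeft (ι ℚ v) z) = -(ι ℚ v * mulTwisted N z) := by
  induction z using TensorProduct.induction_on with
  | zero => simp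
  | tmul w b =>
    rw [tensorMulLeft_tmul, mulTwisted_tmul, mulTwisted_tmul, ← mul_assoc, ← mul_assoc,
      ExteriorAux.ι_anticomm, neg_mul]
  | add x y hx hy => rw [map_add, map_add, hx, hy, map_add]; noncomm_ring

theorem mulTwisted_tensorMulRight (b : Λ W) (z : W ⊗[ℚ] Λ W) :
    mulTwisted N (tensorMulRight b z) = mulTwisted N z * b := by
  induction z using TensorProduct.induction_on with
  | zero => simp
  | tmul w c => rw [tensorMulRight_tmul, mulTwisted_tmul, mulTwisted_tmul, mul_assoc]
  | add x y hx hy => rw [map_add, map_add, hx, hy, map_add, add_mul]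

theorem extDerivation_ι_mul (w : W) (b : Λ W) :
    extDerivation N (ι ℚ w * b) = ι ℚ (N w) * b + ι ℚ w * extDerivation N b := by
  rw [extDerivation, LinearMap.comp_apply, LinearMap.comp_apply, polarize_ι_mul, map_sub,
    mulTwisted_tmul, mulTwisted_tensorMulLeft_ι, sub_neg_eq_add]

variable {N}

/-- If the derivation `N` commutes with the differential, then the product `w ⊗ b ↦ (N w) b` is,
up to sign, a morphism of complexes. -/
theorem d_mulTwisted (hd : ∀ w, D.d (ι ℚ (N w)) = extDerivation N (D.d (ι ℚ w)))
    (z : W ⊗[ℚ] Λ W) : D.d (mulTwisted N z) = -mulTwisted N (D.dCoadj z) := by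
  induction z using TensorProduct.induction_on with
  | zero => simp
  | tmul w b =>
    rw [mulTwisted_tmul, D.d_ι_mul, hd, dCoadj_tmul, map_sub, mulTwisted_tensorMulRight,
      mulTwisted_tmul]
    simp [extDerivation]
  | add x y hx hy => simp only [map_add, hx, hy]; abel

theorem d_extDerivation (hd : ∀ w, D.d (ι ℚ (N w)) = extDerivation N (D.d (ι ℚ w)))
    (a : Λ W) : D.d (extDerivation N a) = extDerivation N (D.d a) := by
  rw [extDerivation, LinearMap.comp_apply, D.d_mulTwisted hd, dCoadj_polarize, map_neg, neg_neg]
  rfl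

end Weights

end ExteriorDifferential

/-! ### Eigenspaces for natural numbers -/

section NatEigenspaces

variable {V : Type*} [AddCommGroup V] [Module ℚ V]

/-- The eigenspace of an endomorphism for a natural number. -/
abbrev natEigenspace (T : V →ₗ[ℚ] V) (n : ℕ) : Submodule ℚ V := Module.End.eigenspace T (n : ℚ)

theorem mem_natEigenspace {T : V →ₗ[ℚ] V} {n : ℕ} {x : V} :
    x ∈ natEigenspace T n ↔ T x = (n : ℚ) • x := Module.End.mem_eigenspace_iff

theorem natEigenspace_iSupIndep (T : V →ₗ[ℚ] V) : iSupIndep (natEigenspace T) :=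
  (Module.End.eigenspaces_iSupIndep T).comp (Nat.cast_injective (R := ℚ))

theorem eigencomponents_eq_zero {T : V →ₗ[ℚ] V} {f : ℕ →₀ V}
    (hf : ∀ n, f n ∈ natEigenspace T n) (h : (f.sum fun _ x => x) = 0) (n : ℕ) : f n = 0 := by
  by_cases hn : n ∈ f.support
  · exact (iSupIndep_iff_finsetSum_eq_zero_imp_eq_zero _).mp (natEigenspace_iSupIndep T) f.support f
      (fun i _ => hf i) h n hn
  · exact Finsupp.notMem_support_iff.mp hn

/-- An eigenvector in a sum of subspaces of the eigenspaces lies in the corresponding subspace. -/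
theorem mem_of_mem_iSup_of_mem_natEigenspace {T : V →ₗ[ℚ] V} {Q : ℕ → Submodule ℚ V}
    (hQ : ∀ m, Q m ≤ natEigenspace T m) {x : V} (hx : x ∈ ⨆ m, Q m) {n : ℕ}
    (hn : x ∈ natEigenspace T n) : x ∈ Q n := by
  obtain ⟨f, hf, rfl⟩ := (Submodule.mem_iSup_iff_exists_finsupp Q x).mp hx
  set x := f.sum fun _ y => y with hxdef
  have h : (f - Finsupp.single n x).sum (fun _ y => y) = 0 := by
    rw [Finsupp.sum_sub_index (fun _ _ _ => rfl), Finsupp.sum_single_index rfl, ← hxdef, sub_self]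
  have h0 := eigencomponents_eq_zero (T := T) (f := f - Finsupp.single n x) (fun m => by
    rw [Finsupp.sub_apply]
    refine sub_mem (hQ m (hf m)) ?_
    by_cases hm : n = m
    · subst hm; rwa [Finsupp.single_eq_same]
    · rw [Finsupp.single_eq_of_ne (Ne.symm hm)]; exact zero_mem _) h n
  rw [Finsupp.sub_apply, Finsupp.single_eq_same, sub_eq_zero] at h0
  rw [← h0]; exact hf n

/-- The components of an element of the kernel of an operator that commutes with `T` are in the
kernel. -/
theorem exists_eigencomponents_ker {T D : V →ₗ[ℚ] V} (hTD : ∀ x, D (T x) = T (D x))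
    {Q : ℕ → Submodule ℚ V} (hQ : ∀ m, Q m ≤ natEigenspace T m) {x : V} (hx : x ∈ ⨆ m, Q m)
    (hDx : D x = 0) :
    ∃ f : ℕ →₀ V, (∀ m, f m ∈ Q m ∧ D (f m) = 0) ∧ (f.sum fun _ y => y) = x := by
  obtain ⟨f, hf, rfl⟩ := (Submodule.mem_iSup_iff_exists_finsupp Q x).mp hx
  refine ⟨f, fun m => ⟨hf m, ?_⟩, rfl⟩
  refine eigencomponents_eq_zero (T := T) (f := f.mapRange D (map_zero D)) (fun n => ?_) ?_ m
  · rw [Finsupp.mapRange_apply, mem_natEigenspace, ← hTD, mem_natEigenspace.mp (hQ n (hf n)),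
      map_smul]
  · rw [Finsupp.sum_mapRange_index (fun _ => rfl), ← hDx, Finsupp.sum, Finsupp.sum, map_sum]

end NatEigenspaces

/-! ### Weight-graded Lie coalgebras without second cohomology -/

namespace ExteriorDifferential

variable {W : Type u} [AddCommGroup W] [Module ℚ W] (D : ExteriorDifferential W)
  {N : W →ₗ[ℚ] W}

local notation "Λ" => ExteriorAlgebra ℚ

/-- The part of weights `1, …, n`. -/
def weightLE (N : W →ₗ[ℚ] W) (n : ℕ) : Submodule ℚ W :=
  ⨆ (i : ℕ) (_ : i < n), natEigenspace N (i + 1)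

theorem weightLE_mono : Monotone (weightLE N) := fun _ _ h =>
  iSup_mono fun _ => iSup_mono' fun hi => ⟨lt_of_lt_of_le hi h, le_rfl⟩

theorem natEigenspace_le_weightLE {i n : ℕ} (h : i < n) :
    natEigenspace N (i + 1) ≤ weightLE N n :=
  le_iSup₂_of_le i h le_rfl

theorem ι_mul_mem_natEigenspace {m n : ℕ} {w : W} (hw : w ∈ natEigenspace N m) {b : Λ W}
    (hb : b ∈ natEigenspace (extDerivation N) n) :
    ι ℚ w * b ∈ natEigenspace (extDerivation N) (m + n) := by
  rw [mem_natEigenspace] at *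
  rw [extDerivation_ι_mul, hw, hb, map_smul, smul_mul_assoc, mul_smul_comm, ← add_smul,
    Nat.cast_add]

theorem ι_mem_natEigenspace {m : ℕ} {w : W} (hw : w ∈ natEigenspace N m) :
    ι ℚ w ∈ natEigenspace (extDerivation N) m := by
  have h : (1 : Λ W) ∈ natEigenspace (extDerivation N) 0 := by
    rw [mem_natEigenspace, ← map_one (algebraMap ℚ (Λ W)), extDerivation_algebraMap]; simp
  simpa using ι_mul_mem_natEigenspace hw h

theorem exteriorPower_le_iSup_weight (hN : ⨆ n, natEigenspace N (n + 1) = ⊤) (k : ℕ) {a : Λ W}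
    (ha : a ∈ ⋀[ℚ]^k W) :
    a ∈ ⨆ n, (⋀[ℚ]^k W ⊓ natEigenspace (extDerivation N) (n + k)) := by
  induction k generalizing a with
  | zero =>
    refine Submodule.mem_iSup_of_mem 0 ⟨ha, ?_⟩
    obtain ⟨r, rfl⟩ := mem_exteriorPower_zero ha
    refine mem_natEigenspace.mpr ?_
    rw [extDerivation_algebraMap]; simp
  | succ k ih =>
    refine exteriorPower_succ_induction (p := fun a => a ∈ ⨆ n, (⋀[ℚ]^(k + 1) W ⊓ natEigenspace
      (extDerivation N) (n + (k + 1)))) (fun w b hb => ?_) (fun x y hx hy => add_mem hx hy) ha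
    have hb' := ih hb
    have hw : w ∈ ⨆ n, natEigenspace N (n + 1) := by rw [hN]; trivial
    clear hb
    induction hw using Submodule.iSup_induction' with
    | mem i w hw =>
      induction hb' using Submodule.iSup_induction' with
      | mem n b hb =>
        refine Submodule.mem_iSup_of_mem (i + n) ⟨?_, ?_⟩
        · have := SetLike.GradedMul.mul_mem (A := fun i : ℕ => ⋀[ℚ]^i W) (ExteriorAux.ι_mem w) hb.1
          rwa [add_comm] at this
        · have := ι_mul_mem_natEigenspace hw hb.2
          rwa [show i + 1 + (n + k) = i + n + (k + 1) by omega] at this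
      | zero => rw [mul_zero]; exact zero_mem _
      | add x y _ _ hx hy => rw [mul_add]; exact add_mem hx hy
    | zero => rw [map_zero, zero_mul]; exact zero_mem _
    | add x y _ _ hx hy => rw [map_add, add_mul]; exact add_mem hx hy

/-- The polarisation of a two-form of weight `n + 1` has its coefficients in weights `≤ n`, because
all weights are positive. -/
theorem polarize_mem_weightLE (hN : ⨆ n, natEigenspace N (n + 1) = ⊤) {n : ℕ} {ω : Λ W}
    (hω : ω ∈ ⋀[ℚ]^2 W) (hn : ω ∈ natEigenspace (extDerivation N) (n + 1)) :
    polarize W ω ∈ tensorSub (weightLE N n) (⋀[ℚ]^1 W) := by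
  let Q : ℕ → Submodule ℚ (Λ W) := fun m =>
    natEigenspace (extDerivation N) m ⊓ (tensorSub (weightLE N (m - 1)) (⋀[ℚ]^1 W)).comap (polarize W)
  have hmem : ω ∈ ⨆ m, Q m := by
    refine exteriorPower_two_induction (p := fun ω => ω ∈ ⨆ m, Q m) (fun v w => ?_)
      (fun x y hx hy => add_mem hx hy) hω
    have hv : v ∈ ⨆ n, natEigenspace N (n + 1) := by rw [hN]; trivial
    have hw : w ∈ ⨆ n, natEigenspace N (n + 1) := by rw [hN]; trivial
    induction hv using Submodule.iSup_induction' with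
    | mem i v hv =>
      induction hw using Submodule.iSup_induction' with
      | mem j w hw =>
        refine Submodule.mem_iSup_of_mem ((i + 1) + (j + 1))
          ⟨ι_mul_mem_natEigenspace hv (ι_mem_natEigenspace hw), ?_⟩
        refine Submodule.mem_comap.mpr ?_
        rw [polarize_ι_mul_ι]
        exact sub_mem
          (tmul_mem_tensorSub (natEigenspace_le_weightLE (by omega) hv) (ExteriorAux.ι_mem w))
          (tmul_mem_tensorSub (natEigenspace_le_weightLE (by omega) hw) (ExteriorAux.ι_mem v))
      | zero => rw [map_zero, mul_zero]; exact zero_mem _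
      | add x y _ _ hx hy => rw [map_add, mul_add]; exact add_mem hx hy
    | zero => rw [map_zero, zero_mul]; exact zero_mem _
    | add x y _ _ hx hy => rw [map_add, add_mul]; exact add_mem hx hy
  exact (mem_of_mem_iSup_of_mem_natEigenspace (fun m => inf_le_left) hmem hn).2

theorem coaction_mem_weightLE (hN : ⨆ n, natEigenspace N (n + 1) = ⊤)
    (hd : ∀ w, D.d (ι ℚ (N w)) = extDerivation N (D.d (ι ℚ w))) {n k : ℕ} {z : W ⊗[ℚ] Λ W}
    (hz : z ∈ tensorSub (weightLE N (n + 1)) (⋀[ℚ]^k W)) :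
    D.coaction z ∈ tensorSub (weightLE N n) (⋀[ℚ]^(k + 1) W) := by
  have h : weightLE N (n + 1) ≤ (tensorSub (weightLE N n) (⋀[ℚ]^1 W)).comap
      (polarize W ∘ₗ D.d ∘ₗ (ι ℚ : W →ₗ[ℚ] Λ W)) := by
    refine iSup₂_le fun i hi w hw => ?_
    refine Submodule.map₂_le_map₂_left (weightLE_mono (Nat.lt_succ_iff.mp hi)) ?_
    refine polarize_mem_weightLE hN (D.d_ι_mem w) ?_
    rw [mem_natEigenspace] at hw ⊢
    change extDerivation N (D.d (ι ℚ w)) = _ • D.d (ι ℚ w)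
    rw [← hd, hw, map_smul, map_smul]
  refine map_mem_of_tensorSub _ _ (fun w hw b hb => ?_) hz
  rw [coaction_tmul]
  refine map_mem_of_tensorSub (tensorMulRight b) _ (fun v hv c hc => ?_) (h hw)
  have := SetLike.GradedMul.mul_mem (A := fun i : ℕ => ⋀[ℚ]^i W) hc hb
  rw [add_comm] at this
  exact tmul_mem_tensorSub hv this

theorem exists_mem_tensorSub_weightLE (hN : ⨆ n, natEigenspace N (n + 1) = ⊤)
    {P : Submodule ℚ (Λ W)} {z : W ⊗[ℚ] Λ W} (hz : z ∈ tensorSub ⊤ P) :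
    ∃ n, z ∈ tensorSub (weightLE N n) P := by
  have h : (⨆ n, weightLE N n) = ⊤ := by
    rw [eq_top_iff, ← hN]
    exact iSup_le fun n => le_iSup_of_le (n + 1) (natEigenspace_le_weightLE (Nat.lt_succ_self n))
  rw [← h, tensorSub, Submodule.map₂_iSup_left] at hz
  exact (Submodule.mem_iSup_of_directed _ (Monotone.directed_le fun _ _ hmn =>
    Submodule.map₂_le_map₂_left (weightLE_mono hmn))).mp hz

/-- If the cohomology vanishes in degree `k + 1` then so does the cohomology with coadjoint
coefficients: filter the coefficients by weight. -/
theorem exists_dCoadj_eq (hN : ⨆ n, natEigenspace N (n + 1) = ⊤)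
    (hd : ∀ w, D.d (ι ℚ (N w)) = extDerivation N (D.d (ι ℚ w))) {k : ℕ} (hk : D.ExactAt k)
    (n : ℕ) {z : W ⊗[ℚ] Λ W} (hz : z ∈ tensorSub (weightLE N n) (⋀[ℚ]^(k + 1) W))
    (hdz : D.dCoadj z = 0) :
    ∃ b ∈ tensorSub (⊤ : Submodule ℚ W) (⋀[ℚ]^k W), D.dCoadj b = z := by
  obtain ⟨s, r, hs, hr, hsr⟩ := D.d.exists_splitting (⋀[ℚ]^(k + 1) W) (⋀[ℚ]^k W) hk
  induction n generalizing z with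
  | zero =>
    have : weightLE N 0 = ⊥ := by simp [weightLE]
    rw [this, tensorSub, Submodule.map₂_bot_left, Submodule.mem_bot] at hz
    exact ⟨0, zero_mem _, by rw [map_zero, hz]⟩
  | succ n ih =>
    set b := s.lTensor W z with hb
    have hbmem : b ∈ tensorSub (weightLE N (n + 1)) (⋀[ℚ]^k W) :=
      map_mem_of_tensorSub _ _ (fun w hw c _ => tmul_mem_tensorSub hw (hs c)) hz
    have h1 : D.d.lTensor W z = D.coaction z := sub_eq_zero.mp hdz
    have h2 : z = D.d.lTensor W b + r.lTensor W (D.coaction z) := by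
      rw [← h1, hb]
      refine eqOn_tensorSub LinearMap.id
        (D.d.lTensor W ∘ₗ s.lTensor W + r.lTensor W ∘ₗ D.d.lTensor W) (fun w _ c hc => ?_) hz
      change w ⊗ₜ c = w ⊗ₜ D.d (s c) + w ⊗ₜ r (D.d c)
      rw [← TensorProduct.tmul_add, ← hsr c hc]
    have h3 : z - D.dCoadj b = r.lTensor W (D.coaction z) + D.coaction b := by
      nth_rw 1 [h2]
      rw [dCoadj, LinearMap.sub_apply]; abel
    have h4 : z - D.dCoadj b ∈ tensorSub (weightLE N n) (⋀[ℚ]^(k + 1) W) := by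
      rw [h3]
      exact add_mem (map_mem_of_tensorSub _ _ (fun w hw c _ => tmul_mem_tensorSub hw (hr c))
        (D.coaction_mem_weightLE hN hd hz)) (D.coaction_mem_weightLE hN hd hbmem)
    obtain ⟨b', hb', hdb'⟩ := ih h4 (by rw [map_sub, hdz, D.dCoadj_dCoadj, sub_zero])
    refine ⟨b + b', add_mem (Submodule.map₂_le_map₂_left le_top hbmem) hb', ?_⟩
    rw [map_add, hdb']; abel

/-- Vanishing of cohomology propagates to the next degree: on forms of weight `m ≠ 0`, the identity
is `m⁻¹` times the polarisation followed by the product `w ⊗ b ↦ (N w) b`, and thus factors through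
the complex with coadjoint coefficients. -/
theorem exactAt_succ (hN : ⨆ n, natEigenspace N (n + 1) = ⊤)
    (hd : ∀ w, D.d (ι ℚ (N w)) = extDerivation N (D.d (ι ℚ w))) {k : ℕ} (hk : D.ExactAt k) :
    D.ExactAt (k + 1) := by
  intro c hc hdc
  let Q : ℕ → Submodule ℚ (Λ W) := fun m =>
    ⨆ _ : m ≠ 0, ⋀[ℚ]^(k + 1 + 1) W ⊓ natEigenspace (extDerivation N) m
  have hQ : ∀ m, Q m ≤ ⋀[ℚ]^(k + 1 + 1) W ⊓ natEigenspace (extDerivation N) m :=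
    fun m => iSup_le fun _ => le_rfl
  have hcQ : c ∈ ⨆ m, Q m := by
    have h : (⨆ n, (⋀[ℚ]^(k + 1 + 1) W ⊓ natEigenspace (extDerivation N) (n + (k + 1 + 1)))) ≤
        ⨆ m, Q m := iSup_le fun n => le_iSup_of_le (n + (k + 1 + 1)) <|
      le_iSup_of_le (by omega) le_rfl
    exact h (exteriorPower_le_iSup_weight hN _ hc)
  obtain ⟨f, hf, rfl⟩ := exists_eigencomponents_ker (D.d_extDerivation hd)
    (fun m => (hQ m).trans inf_le_right) hcQ hdc
  have hmem : ∀ m, f m ∈ (⋀[ℚ]^(k + 1) W).map D.d := by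
    intro m
    obtain ⟨hfm, hdfm⟩ := hf m
    by_cases hm : m = 0
    · have : f m = 0 := by simpa [Q, hm] using hfm
      rw [this]; exact zero_mem _
    obtain ⟨h1, h2⟩ := hQ m hfm
    obtain ⟨n, hn⟩ := exists_mem_tensorSub_weightLE hN (polarize_mem h1)
    obtain ⟨b, hb, hdb⟩ := D.exists_dCoadj_eq hN hd hk n hn (by
      rw [dCoadj_polarize, hdfm, map_zero, neg_zero])
    refine ⟨-(m : ℚ)⁻¹ • mulTwisted N b, Submodule.smul_mem _ _ ?_, ?_⟩
    · refine map_mem_of_tensorSub _ _ (fun w _ a ha => ?_) hb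
      have := SetLike.GradedMul.mul_mem (A := fun i : ℕ => ⋀[ℚ]^i W) (ExteriorAux.ι_mem (N w)) ha
      rwa [add_comm] at this
    · have h3 : mulTwisted N (polarize W (f m)) = (m : ℚ) • f m := mem_natEigenspace.mp h2
      rw [map_smul, D.d_mulTwisted hd, hdb, h3, neg_smul, smul_neg, neg_neg, smul_smul,
        inv_mul_cancel₀ (Nat.cast_ne_zero.mpr hm), one_smul]
  exact sum_mem fun m _ => hmem m

/-- A weight-graded Lie coalgebra, with positive weights, whose cohomology vanishes in degree two
has no cohomology in degrees `≥ 2`. For a class `c` of weight `n`, the polarisation of `c` is a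
class with coadjoint coefficients of one degree less, hence a coboundary, and the product with the
derivation `N` maps it back to `n c`. -/
theorem exactAt_of_exactAt_one (hN : ⨆ n, natEigenspace N (n + 1) = ⊤)
    (hd : ∀ w, D.d (ι ℚ (N w)) = extDerivation N (D.d (ι ℚ w))) (h : D.ExactAt 1) (k : ℕ) :
    D.ExactAt (k + 1) := by
  induction k with
  | zero => exact h
  | succ k ih => exact D.exactAt_succ hN hd ih

end ExteriorDifferential

/-! ### The exterior algebra of a direct sum -/

section DirectSum

variable {W W₁ W₂ : Type u} [AddCommGroup W] [Module ℚ W] [AddCommGroup W₁] [Module ℚ W₁]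
  [AddCommGroup W₂] [Module ℚ W₂] (i : W₁ →ₗ[ℚ] W) (β : W₂ →ₗ[ℚ] W)

local notation "Λ" => ExteriorAlgebra ℚ

/-- The product map `Λ W₁ ⊗ Λ W₂ → Λ W` given by linear maps `W₁ → W` and `W₂ → W`. -/
noncomputable def extProd : Λ W₁ ⊗[ℚ] Λ W₂ →ₗ[ℚ] Λ W :=
  TensorProduct.lift ((LinearMap.mul ℚ (Λ W)).compl₁₂ (ExteriorAlgebra.map i).toLinearMap
    (ExteriorAlgebra.map β).toLinearMap)

theorem extProd_tmul (a : Λ W₁) (b : Λ W₂) :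
    extProd i β (a ⊗ₜ b) = ExteriorAlgebra.map i a * ExteriorAlgebra.map β b := rfl

/-- The exterior algebra of a direct sum is the graded tensor product of the exterior algebras. -/
theorem extProd_bijective (h : Function.Bijective (i.coprod β)) :
    Function.Bijective (extProd i β) := by
  let e : (W₁ × W₂) ≃ₗ[ℚ] W := LinearEquiv.ofBijective _ h
  let E : ((0 : QuadraticForm ℚ W₁).prod (0 : QuadraticForm ℚ W₂)).IsometryEquiv
      (0 : QuadraticForm ℚ W) := { toLinearEquiv := e, map_app' := fun m => by simp }
  let T := GradedTensorProduct.of ℚ (CliffordAlgebra.evenOdd (0 : QuadraticForm ℚ W₁))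
    (CliffordAlgebra.evenOdd (0 : QuadraticForm ℚ W₂))
  have key : ∀ z, extProd i β z = CliffordAlgebra.equivOfIsometry E
      ((CliffordAlgebra.prodEquiv (0 : QuadraticForm ℚ W₁) (0 : QuadraticForm ℚ W₂)).symm
        (T z)) := by
    intro z
    induction z using TensorProduct.induction_on with
    | zero => simp
    | tmul a b =>
      rw [extProd_tmul]
      have h1 : (CliffordAlgebra.prodEquiv (0 : QuadraticForm ℚ W₁) (0 : QuadraticForm ℚ W₂)).symm
          (T (a ⊗ₜ b)) = CliffordAlgebra.map (QuadraticMap.Isometry.inl _ _) a *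
            CliffordAlgebra.map (QuadraticMap.Isometry.inr _ _) b := by
        change CliffordAlgebra.toProd _ _ (T (a ⊗ₜ b)) = _
        rw [CliffordAlgebra.toProd]
        exact GradedTensorProduct.lift_tmul ..
      rw [h1, map_mul]
      congr 1
      · have : (CliffordAlgebra.equivOfIsometry E).toAlgHom.comp
            (CliffordAlgebra.map (QuadraticMap.Isometry.inl _ _)) = ExteriorAlgebra.map i := by
          refine ExteriorAlgebra.hom_ext (LinearMap.ext fun w => ?_)
          have h2 : CliffordAlgebra.map (QuadraticMap.Isometry.inl (0 : QuadraticForm ℚ W₁)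
              (0 : QuadraticForm ℚ W₂)) (ι ℚ w) = CliffordAlgebra.ι _ (w, 0) :=
            CliffordAlgebra.map_apply_ι _ _
          change CliffordAlgebra.map E.toIsometry (CliffordAlgebra.map _ (ι ℚ w)) =
            ExteriorAlgebra.map i (ι ℚ w)
          rw [h2, CliffordAlgebra.map_apply_ι, ExteriorAlgebra.map_apply_ι]
          change ι ℚ (i w + β 0) = _
          rw [map_zero, add_zero]
        exact (AlgHom.congr_fun this a).symm
      · have : (CliffordAlgebra.equivOfIsometry E).toAlgHom.comp
            (CliffordAlgebra.map (QuadraticMap.Isometry.inr _ _)) = ExteriorAlgebra.map β := by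
          refine ExteriorAlgebra.hom_ext (LinearMap.ext fun w => ?_)
          have h2 : CliffordAlgebra.map (QuadraticMap.Isometry.inr (0 : QuadraticForm ℚ W₁)
              (0 : QuadraticForm ℚ W₂)) (ι ℚ w) = CliffordAlgebra.ι _ (0, w) :=
            CliffordAlgebra.map_apply_ι _ _
          change CliffordAlgebra.map E.toIsometry (CliffordAlgebra.map _ (ι ℚ w)) =
            ExteriorAlgebra.map β (ι ℚ w)
          rw [h2, CliffordAlgebra.map_apply_ι, ExteriorAlgebra.map_apply_ι]
          change ι ℚ (i 0 + β w) = _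
          rw [map_zero, zero_add]
        exact (AlgHom.congr_fun this b).symm
    | add x y hx hy => simp only [map_add, hx, hy]
  have : (extProd i β : Λ W₁ ⊗[ℚ] Λ W₂ → Λ W) = _ := funext key
  rw [this]
  exact (CliffordAlgebra.equivOfIsometry E).bijective.comp
    ((CliffordAlgebra.prodEquiv _ _).symm.bijective.comp T.bijective)

theorem extSign_map (a : Λ W₁) :
    extSign (ExteriorAlgebra.map i a) = ExteriorAlgebra.map i (extSign a) := by
  induction a using ext_left_induction with
  | algebraMap r => simp
  | add x y hx hy => simp only [map_add, hx, hy]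
  | ι_mul x w hx =>
    simp only [map_mul, ExteriorAlgebra.map_apply_ι, extSign_ι, hx, map_neg]

theorem map_mem_exteriorPower {k : ℕ} {a : Λ W₁} (ha : a ∈ ⋀[ℚ]^k W₁) :
    ExteriorAlgebra.map i a ∈ ⋀[ℚ]^k W := by
  induction ha using Submodule.pow_induction_on_left' with
  | algebraMap r => rw [AlgHom.commutes]; exact Submodule.algebraMap_mem r
  | add x y i _ _ hx hy => rw [map_add]; exact add_mem hx hy
  | mem_mul m hm n x _ hx =>
    obtain ⟨w, rfl⟩ := hm
    rw [map_mul, ExteriorAlgebra.map_apply_ι]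
    have := SetLike.GradedMul.mul_mem (A := fun i : ℕ => ⋀[ℚ]^i W) (ExteriorAux.ι_mem (i w)) hx
    rwa [add_comm] at this

end DirectSum

/-! ### Extensions of Lie coalgebras -/

namespace ExteriorDifferential

variable {W W₁ W₂ : Type u} [AddCommGroup W] [Module ℚ W] [AddCommGroup W₁] [Module ℚ W₁]
  [AddCommGroup W₂] [Module ℚ W₂]

local notation "Λ" => ExteriorAlgebra ℚ

/-- The forms of degree at most `q`. -/
def degreeLE (W : Type u) [AddCommGroup W] [Module ℚ W] (q : ℕ) : Submodule ℚ (Λ W) :=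
  ⨆ (k : ℕ) (_ : k ≤ q), ⋀[ℚ]^k W

theorem degreeLE_mono : Monotone (degreeLE W) := fun _ _ h =>
  iSup_mono fun _ => iSup_mono' fun hi => ⟨le_trans hi h, le_rfl⟩

theorem exteriorPower_le_degreeLE {k q : ℕ} (h : k ≤ q) : ⋀[ℚ]^k W ≤ degreeLE W q :=
  le_iSup₂_of_le k h le_rfl

theorem degreeLE_succ (q : ℕ) : degreeLE W (q + 1) = ⋀[ℚ]^(q + 1) W ⊔ degreeLE W q := by
  apply le_antisymm
  · refine iSup₂_le fun k hk => ?_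
    rcases Nat.lt_or_eq_of_le hk with h | rfl
    · exact (exteriorPower_le_degreeLE (Nat.lt_succ_iff.mp h)).trans le_sup_right
    · exact le_sup_left
  · exact sup_le (exteriorPower_le_degreeLE le_rfl) (degreeLE_mono q.le_succ)

theorem ι_mul_mem_degreeLE {q : ℕ} (w : W) {a : Λ W} (ha : a ∈ degreeLE W q) :
    ι ℚ w * a ∈ degreeLE W (q + 1) := by
  have h : degreeLE W q ≤ (degreeLE W (q + 1)).comap (LinearMap.mulLeft ℚ (ι ℚ w)) := by
    refine iSup₂_le fun k hk b hb => ?_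
    have := SetLike.GradedMul.mul_mem (A := fun i : ℕ => ⋀[ℚ]^i W) (ExteriorAux.ι_mem w) hb
    rw [add_comm] at this
    exact exteriorPower_le_degreeLE (Nat.succ_le_succ hk) this
  exact h ha

/-- The projection of the exterior algebra to forms of degree `k`. -/
noncomputable def degreeProj (W : Type u) [AddCommGroup W] [Module ℚ W] (k : ℕ) :
    Λ W →ₗ[ℚ] Λ W := GradedAlgebra.proj (fun i : ℕ => ⋀[ℚ]^i W) k

theorem degreeProj_same {k : ℕ} {a : Λ W} (ha : a ∈ ⋀[ℚ]^k W) : degreeProj W k a = a :=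
  DirectSum.decompose_of_mem_same (fun i : ℕ => ⋀[ℚ]^i W) ha

theorem degreeProj_of_mem_degreeLE {k q : ℕ} (h : q < k) {a : Λ W} (ha : a ∈ degreeLE W q) :
    degreeProj W k a = 0 := by
  have h : degreeLE W q ≤ LinearMap.ker (degreeProj W k) := by
    refine iSup₂_le fun j hj b hb => ?_
    exact DirectSum.decompose_of_mem_ne (fun i : ℕ => ⋀[ℚ]^i W) hb (by omega)
  exact h ha

/-- An extension of Lie coalgebras `0 → W₁ → W → W₂ → 0`, with a linear section `β`. -/
structure IsExtension (D₁ : ExteriorDifferential W₁) (D : ExteriorDifferential W)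
    (D₂ : ExteriorDifferential W₂) (i : W₁ →ₗ[ℚ] W) (p : W →ₗ[ℚ] W₂) (β : W₂ →ₗ[ℚ] W) : Prop where
  bijective : Function.Bijective (i.coprod β)
  p_i : ∀ w, p (i w) = 0
  p_β : ∀ w, p (β w) = w
  d_i : ∀ w, D.d (ι ℚ (i w)) = ExteriorAlgebra.map i (D₁.d (ι ℚ w))
  d_p : ∀ w, D₂.d (ι ℚ (p w)) = ExteriorAlgebra.map p (D.d (ι ℚ w))
  /-- the section preserves closed elements -/
  d_β : ∀ w, D₂.d (ι ℚ w) = 0 → D.d (ι ℚ (β w)) = 0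

theorem d_map {D₁ : ExteriorDifferential W₁} {D : ExteriorDifferential W} {i : W₁ →ₗ[ℚ] W}
    (h : ∀ w, D.d (ι ℚ (i w)) = ExteriorAlgebra.map i (D₁.d (ι ℚ w))) (a : Λ W₁) :
    D.d (ExteriorAlgebra.map i a) = ExteriorAlgebra.map i (D₁.d a) := by
  induction a using ext_left_induction with
  | algebraMap r => rw [AlgHom.commutes, d_algebraMap, d_algebraMap, map_zero]
  | add x y hx hy => simp only [map_add, hx, hy]
  | ι_mul x w hx =>
    rw [map_mul, ExteriorAlgebra.map_apply_ι, d_ι_mul, h, hx, d_ι_mul, map_sub, map_mul, map_mul,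
      ExteriorAlgebra.map_apply_ι]

namespace IsExtension

variable {D₁ : ExteriorDifferential W₁} {D : ExteriorDifferential W}
  {D₂ : ExteriorDifferential W₂} {i : W₁ →ₗ[ℚ] W} {p : W →ₗ[ℚ] W₂} {β : W₂ →ₗ[ℚ] W}
  (h : IsExtension D₁ D D₂ i p β)

/-- The products of forms on `W₁` and forms of degree `≤ q` on `W₂`. -/
noncomputable def filtration (i : W₁ →ₗ[ℚ] W) (β : W₂ →ₗ[ℚ] W) (q : ℕ) : Submodule ℚ (Λ W) :=
  (tensorSub ⊤ (degreeLE W₂ q)).map (extProd i β)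

theorem mul_mem_filtration {q : ℕ} (a : Λ W₁) {b : Λ W₂} (hb : b ∈ degreeLE W₂ q) :
    ExteriorAlgebra.map i a * ExteriorAlgebra.map β b ∈ filtration i β q :=
  ⟨a ⊗ₜ b, tmul_mem_tensorSub trivial hb, rfl⟩

theorem filtration_le {q : ℕ} {S : Submodule ℚ (Λ W)}
    (hS : ∀ a, ∀ b ∈ degreeLE W₂ q, ExteriorAlgebra.map i a * ExteriorAlgebra.map β b ∈ S) :
    filtration i β q ≤ S := by
  rintro _ ⟨z, hz, rfl⟩
  exact map_mem_of_tensorSub _ _ (fun a _ b hb => hS a b hb) hz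

theorem filtration_mono : Monotone (filtration i β) := fun _ _ hpq =>
  Submodule.map_mono (Submodule.map₂_le_map₂_right (degreeLE_mono hpq))

theorem map_mul_mem_filtration {q : ℕ} (a : Λ W₁) {c : Λ W} (hc : c ∈ filtration i β q) :
    ExteriorAlgebra.map i a * c ∈ filtration i β q := by
  have : filtration i β q ≤
      (filtration i β q).comap (LinearMap.mulLeft ℚ (ExteriorAlgebra.map i a)) :=
    filtration_le fun a' b hb => by
      change ExteriorAlgebra.map i a * (ExteriorAlgebra.map i a' * ExteriorAlgebra.map β b) ∈
        filtration i β q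
      rw [← mul_assoc, ← map_mul]
      exact mul_mem_filtration _ hb
  exact this hc

theorem ι_β_mul_mem_filtration {q : ℕ} (w : W₂) {c : Λ W} (hc : c ∈ filtration i β q) :
    ι ℚ (β w) * c ∈ filtration i β (q + 1) := by
  have : filtration i β q ≤ (filtration i β (q + 1)).comap (LinearMap.mulLeft ℚ (ι ℚ (β w))) :=
    filtration_le fun a b hb => by
      change ι ℚ (β w) * (ExteriorAlgebra.map i a * ExteriorAlgebra.map β b) ∈
        filtration i β (q + 1)
      rw [← mul_assoc, ι_mul_eq, extSign_map, mul_assoc, ← ExteriorAlgebra.map_apply_ι, ← map_mul]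
      exact mul_mem_filtration _ (ι_mul_mem_degreeLE w hb)
  exact this hc

include h

theorem exists_eq (w : W) : ∃ w₁ w₂, w = i w₁ + β w₂ := by
  obtain ⟨⟨w₁, w₂⟩, rfl⟩ := h.bijective.2 w
  exact ⟨w₁, w₂, rfl⟩

/-- The section `β` is compatible with the differentials up to terms divisible by `W₁`. -/
theorem d_ι_β_sub_mem (w : W₂) : D.d (ι ℚ (β w)) - ExteriorAlgebra.map β (D₂.d (ι ℚ w)) ∈
    Submodule.span ℚ {x | ∃ v v', x = ι ℚ (i v) * ι ℚ v'} := by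
  set S := Submodule.span ℚ {x | ∃ v v', x = ι ℚ (i v) * ι ℚ v'} with hS
  have h1 : ∀ ω ∈ ⋀[ℚ]^2 W, ω - ExteriorAlgebra.map β (ExteriorAlgebra.map p ω) ∈ S := by
    intro ω hω
    refine exteriorPower_two_induction
      (p := fun ω => ω - ExteriorAlgebra.map β (ExteriorAlgebra.map p ω) ∈ S) (fun v w => ?_)
      (fun x y hx hy => ?_) hω
    · obtain ⟨v₁, v₂, rfl⟩ := h.exists_eq v
      obtain ⟨w₁, w₂, rfl⟩ := h.exists_eq w
      simp only [map_mul, ExteriorAlgebra.map_apply_ι]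
      rw [map_add p, map_add p, h.p_i, h.p_β, h.p_i, h.p_β, zero_add, zero_add]
      have : ι ℚ (i v₁ + β v₂) * ι ℚ (i w₁ + β w₂) - ι ℚ (β v₂) * ι ℚ (β w₂) =
          ι ℚ (i v₁) * ι ℚ (i w₁ + β w₂) - ι ℚ (i w₁) * ι ℚ (β v₂) := by
        rw [ExteriorAux.ι_anticomm (i w₁)]
        simp only [map_add]; noncomm_ring
      rw [this]
      exact sub_mem (Submodule.subset_span ⟨_, _, rfl⟩) (Submodule.subset_span ⟨_, _, rfl⟩)
    · simp only [map_add]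
      rw [add_sub_add_comm]
      exact add_mem hx hy
  have h2 := h1 _ (D.d_ι_mem (β w))
  rwa [← h.d_p, h.p_β] at h2

theorem d_map_β_sub_mem {q : ℕ} {b : Λ W₂} (hb : b ∈ ⋀[ℚ]^q W₂) :
    D.d (ExteriorAlgebra.map β b) - ExteriorAlgebra.map β (D₂.d b) ∈ filtration i β q := by
  induction q generalizing b with
  | zero =>
    obtain ⟨r, rfl⟩ := mem_exteriorPower_zero hb
    rw [AlgHom.commutes, d_algebraMap, d_algebraMap, map_zero, sub_zero]
    exact zero_mem _
  | succ q ih =>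
    refine exteriorPower_succ_induction (p := fun b => D.d (ExteriorAlgebra.map β b) -
      ExteriorAlgebra.map β (D₂.d b) ∈ filtration i β (q + 1)) (fun w b hb => ?_)
      (fun x y hx hy => ?_) hb
    · have e : D.d (ExteriorAlgebra.map β (ι ℚ w * b)) -
          ExteriorAlgebra.map β (D₂.d (ι ℚ w * b)) =
          (D.d (ι ℚ (β w)) - ExteriorAlgebra.map β (D₂.d (ι ℚ w))) * ExteriorAlgebra.map β b -
          ι ℚ (β w) * (D.d (ExteriorAlgebra.map β b) - ExteriorAlgebra.map β (D₂.d b)) := by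
        rw [map_mul, ExteriorAlgebra.map_apply_ι, d_ι_mul, d_ι_mul, map_sub, map_mul, map_mul,
          ExteriorAlgebra.map_apply_ι]
        noncomm_ring
      rw [e]
      refine sub_mem ?_ (ι_β_mul_mem_filtration w (ih hb))
      have hle : Submodule.span ℚ {x | ∃ v v', x = ι ℚ (i v) * ι ℚ v'} ≤
          (filtration i β (q + 1)).comap
            (LinearMap.mulRight ℚ (ExteriorAlgebra.map β b)) := by
        rw [Submodule.span_le]
        rintro _ ⟨v, v', rfl⟩
        obtain ⟨w₁, w₂, rfl⟩ := h.exists_eq v'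
        change ι ℚ (i v) * ι ℚ (i w₁ + β w₂) * ExteriorAlgebra.map β b ∈ filtration i β (q + 1)
        rw [map_add, mul_add, add_mul, mul_assoc, mul_assoc]
        simp only [← ExteriorAlgebra.map_apply_ι]
        rw [← map_mul (ExteriorAlgebra.map β)]
        exact add_mem (map_mul_mem_filtration _
            (mul_mem_filtration _ (exteriorPower_le_degreeLE q.le_succ hb)))
          (mul_mem_filtration _ (ι_mul_mem_degreeLE _ (exteriorPower_le_degreeLE le_rfl hb)))
      exact hle (h.d_ι_β_sub_mem w)
    · simp only [map_add]
      rw [add_sub_add_comm]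
      exact add_mem hx hy

/-- On the associated graded of the filtration by degree in `W₂`, the differential is that of
`W₂`. -/
theorem d_extProd_sub_mem {q : ℕ} {z : Λ W₁ ⊗[ℚ] Λ W₂} (hz : z ∈ tensorSub ⊤ (⋀[ℚ]^q W₂)) :
    D.d (extProd i β z) - extProd i β (TensorProduct.map extSign.toLinearMap D₂.d z) ∈
      filtration i β q := by
  refine map_mem_of_tensorSub (D.d ∘ₗ extProd i β -
    extProd i β ∘ₗ TensorProduct.map extSign.toLinearMap D₂.d) _ (fun a _ b hb => ?_) hz
  change D.d (extProd i β (a ⊗ₜ b)) - extProd i β (extSign a ⊗ₜ D₂.d b) ∈ _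
  rw [extProd_tmul, extProd_tmul, d_mul, d_map h.d_i, extSign_map, add_sub_assoc, ← mul_sub]
  exact add_mem (mul_mem_filtration _ (exteriorPower_le_degreeLE le_rfl hb))
    (map_mul_mem_filtration _ (h.d_map_β_sub_mem hb))

theorem d_mul_mem {q : ℕ} (a : Λ W₁) {b : Λ W₂} (hb : b ∈ ⋀[ℚ]^q W₂) :
    D.d (ExteriorAlgebra.map i a * ExteriorAlgebra.map β b) ∈ filtration i β (q + 1) := by
  have e : D.d (ExteriorAlgebra.map β b) =
      (D.d (ExteriorAlgebra.map β b) - ExteriorAlgebra.map β (D₂.d b)) +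
        1 * ExteriorAlgebra.map β (D₂.d b) := by
    rw [one_mul, sub_add_cancel]
  rw [d_mul, d_map h.d_i, extSign_map, e, ← map_one (ExteriorAlgebra.map i)]
  exact add_mem (mul_mem_filtration _ (exteriorPower_le_degreeLE q.le_succ hb))
    (map_mul_mem_filtration _ (add_mem (filtration_mono q.le_succ (h.d_map_β_sub_mem hb))
      (mul_mem_filtration _ (exteriorPower_le_degreeLE le_rfl (D₂.d_mem hb)))))

theorem d_mem_filtration {q : ℕ} {c : Λ W} (hc : c ∈ filtration i β q) :
    D.d c ∈ filtration i β (q + 1) := by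
  have : filtration i β q ≤ (filtration i β (q + 1)).comap D.d := by
    refine filtration_le fun a b hb => ?_
    have hle : degreeLE W₂ q ≤ (filtration i β (q + 1)).comap
        (D.d ∘ₗ LinearMap.mulLeft ℚ (ExteriorAlgebra.map i a) ∘ₗ
          (ExteriorAlgebra.map β).toLinearMap) := by
      refine iSup₂_le fun k hk b hb => Submodule.mem_comap.mpr ?_
      have h1 := h.d_mul_mem a hb
      have h2 : filtration i β (k + 1) ≤ filtration i β (q + 1) :=
        filtration_mono (Nat.succ_le_succ hk)
      exact h2 h1
    exact hle hb
  exact this hc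

/-- The leading term of a cocycle is a cocycle for the differential of `W₂`. -/
theorem lTensor_d_eq_zero {q : ℕ} {z z' : Λ W₁ ⊗[ℚ] Λ W₂} (hz : z ∈ tensorSub ⊤ (⋀[ℚ]^(q + 1) W₂))
    (hz' : extProd i β z' ∈ filtration i β q) (hd : D.d (extProd i β (z + z')) = 0) :
    D₂.d.lTensor (Λ W₁) z = 0 := by
  set x := TensorProduct.map extSign.toLinearMap D₂.d z with hx
  have h1 : extProd i β x ∈ filtration i β (q + 1) := by
    have e : extProd i β x = -(D.d (extProd i β z) - extProd i β x) - D.d (extProd i β z') := by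
      rw [map_add, map_add] at hd
      rw [eq_neg_of_add_eq_zero_left hd]; abel
    rw [e]
    exact sub_mem (neg_mem (h.d_extProd_sub_mem hz)) (h.d_mem_filtration hz')
  obtain ⟨y, hy, hyx⟩ := h1
  rw [SetLike.mem_coe] at hy
  have hxy : y = x := (extProd_bijective i β h.bijective).1 hyx
  rw [hxy] at hy
  -- `x` has degree `≤ q + 1` and degree `q + 2` in `W₂`
  have h2 : (degreeProj W₂ (q + 2)).lTensor (Λ W₁) x = 0 :=
    eqOn_tensorSub ((degreeProj W₂ (q + 2)).lTensor (Λ W₁)) 0 (fun a _ b hb => by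
      rw [LinearMap.lTensor_tmul, degreeProj_of_mem_degreeLE (Nat.lt_succ_self _) hb,
        TensorProduct.tmul_zero, LinearMap.zero_apply]) hy
  have h3 : (degreeProj W₂ (q + 2)).lTensor (Λ W₁) x = x :=
    eqOn_tensorSub ((degreeProj W₂ (q + 2)).lTensor (Λ W₁) ∘ₗ
      TensorProduct.map extSign.toLinearMap D₂.d) (TensorProduct.map extSign.toLinearMap D₂.d)
      (fun a _ b hb => by
        change extSign a ⊗ₜ degreeProj W₂ (q + 2) (D₂.d b) = extSign a ⊗ₜ D₂.d b
        rw [degreeProj_same (D₂.d_mem hb)]) hz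
  have h4 : x = 0 := h3.symm.trans h2
  have h5 : D₂.d.lTensor (Λ W₁) z = extSign.toLinearMap.rTensor (Λ W₂) x := by
    refine eqOn_tensorSub (D₂.d.lTensor (Λ W₁)) (extSign.toLinearMap.rTensor (Λ W₂) ∘ₗ
      TensorProduct.map extSign.toLinearMap D₂.d) (fun a _ b _ => ?_) hz
    change a ⊗ₜ D₂.d b = extSign (extSign a) ⊗ₜ D₂.d b
    rw [extSign_extSign]
  rw [h5, h4, map_zero]

/-- If the cohomology of `W₂` vanishes in degrees `≥ 2`, every cocycle of `W` is cohomologous to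
one of degree `≤ 1` in `W₂`. -/
theorem exists_mem_filtration_one (h₂ : ∀ k, D₂.ExactAt (k + 1)) (q : ℕ) {c : Λ W}
    (hc : c ∈ filtration i β q) (hdc : D.d c = 0) :
    ∃ b, c - D.d b ∈ filtration i β 1 := by
  induction q generalizing c with
  | zero => exact ⟨0, by rw [map_zero, sub_zero]; exact filtration_mono zero_le_one hc⟩
  | succ q ih =>
    rcases q with _ | q
    · exact ⟨0, by rw [map_zero, sub_zero]; exact hc⟩
    obtain ⟨z, hz, rfl⟩ := hc
    rw [degreeLE_succ, tensorSub, Submodule.map₂_sup_right] at hz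
    obtain ⟨z₁, hz₁, z₂, hz₂, rfl⟩ := Submodule.mem_sup.mp hz
    have hz₂' : extProd i β z₂ ∈ filtration i β (q + 1) := ⟨z₂, hz₂, rfl⟩
    have h0 := h.lTensor_d_eq_zero hz₁ hz₂' hdc
    -- a contracting homotopy of `W₂` gives a linear primitive of the leading term `z₁`
    obtain ⟨s, r, hs, hr, hsr⟩ := D₂.d.exists_splitting _ _ (h₂ q)
    have h1 : z₁ = TensorProduct.map extSign.toLinearMap D₂.d
        (TensorProduct.map extSign.toLinearMap s z₁) := by
      have e : z₁ = TensorProduct.map extSign.toLinearMap D₂.d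
          (TensorProduct.map extSign.toLinearMap s z₁) +
          r.lTensor (Λ W₁) (D₂.d.lTensor (Λ W₁) z₁) := by
        refine eqOn_tensorSub LinearMap.id (TensorProduct.map extSign.toLinearMap D₂.d ∘ₗ
          TensorProduct.map extSign.toLinearMap s + r.lTensor (Λ W₁) ∘ₗ D₂.d.lTensor (Λ W₁))
          (fun a _ b hb => ?_) hz₁
        change a ⊗ₜ b = extSign (extSign a) ⊗ₜ D₂.d (s b) + a ⊗ₜ r (D₂.d b)
        rw [extSign_extSign, ← TensorProduct.tmul_add, ← hsr b hb]
      rwa [h0, map_zero, add_zero] at e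
    set y := TensorProduct.map extSign.toLinearMap s z₁ with hy
    have hymem : y ∈ tensorSub (⊤ : Submodule ℚ (Λ W₁)) (⋀[ℚ]^(q + 1) W₂) :=
      map_mem_of_tensorSub (TensorProduct.map extSign.toLinearMap s)
        (tensorSub (⊤ : Submodule ℚ (Λ W₁)) (⋀[ℚ]^(q + 1) W₂))
        (fun a _ b _ => tmul_mem_tensorSub Submodule.mem_top (hs b)) hz₁
    have h2 := h.d_extProd_sub_mem hymem
    rw [← h1] at h2
    obtain ⟨b, hb⟩ := ih (c := extProd i β (z₁ + z₂) - D.d (extProd i β y)) (by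
      have e : extProd i β (z₁ + z₂) - D.d (extProd i β y) =
          extProd i β z₂ - (D.d (extProd i β y) - extProd i β z₁) := by rw [map_add]; abel
      rw [e]
      exact sub_mem hz₂' h2) (by rw [map_sub, hdc, D.d_d, sub_zero])
    exact ⟨extProd i β y + b, by rwa [map_add D.d, ← sub_sub]⟩

theorem exists_mem_filtration (c : Λ W) : ∃ q, c ∈ filtration i β q := by
  obtain ⟨z, rfl⟩ := (extProd_bijective i β h.bijective).2 c
  have h1 : (⨆ q, degreeLE W₂ q) = ⊤ := by
    rw [eq_top_iff, ← iSup_exteriorPower]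
    exact iSup_mono fun k => exteriorPower_le_degreeLE le_rfl
  have hz : z ∈ tensorSub (⊤ : Submodule ℚ (Λ W₁)) (⨆ q, degreeLE W₂ q) := by
    rw [h1, tensorSub_top_top]; trivial
  rw [tensorSub, Submodule.map₂_iSup_right] at hz
  obtain ⟨q, hq⟩ := (Submodule.mem_iSup_of_directed _ (Monotone.directed_le fun _ _ hmn =>
    Submodule.map₂_le_map₂_right (degreeLE_mono hmn))).mp hz
  exact ⟨q, z, hq, rfl⟩

/-- If the cohomology of the quotient Lie coalgebra `W₂` vanishes in degrees `≥ 2`, and its closed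
elements lift to closed elements, then generation of the cohomology in degree one passes from `W₁`
to `W`. -/
theorem generatedInDegreeOne (h₂ : ∀ k, D₂.ExactAt (k + 1)) (h₁ : D₁.GeneratedInDegreeOne) :
    D.GeneratedInDegreeOne := by
  intro c hc
  obtain ⟨q, hq⟩ := h.exists_mem_filtration c
  obtain ⟨b, hb⟩ := h.exists_mem_filtration_one h₂ q hq hc
  have hd : D.d (c - D.d b) = 0 := by rw [map_sub, hc, D.d_d, sub_zero]
  obtain ⟨z, hz, hzc⟩ := hb
  rw [← hzc] at hd
  rw [degreeLE_succ, tensorSub, Submodule.map₂_sup_right] at hz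
  obtain ⟨z₁, hz₁, z₂, hz₂, rfl⟩ := Submodule.mem_sup.mp hz
  -- the forms of degree at most one on `W₂` that are closed
  set T : Submodule ℚ (Λ W₂) := (Submodule.span ℚ {w | D₂.d (ι ℚ w) = 0}).map (ι ℚ) ⊔
    ⋀[ℚ]^0 W₂ with hT
  set A := Algebra.adjoin ℚ (ι ℚ '' {w | D.d (ι ℚ w) = 0}) with hA
  have hTd : ∀ b ∈ T, D.d (ExteriorAlgebra.map β b) = 0 := by
    have : T ≤ LinearMap.ker (D.d ∘ₗ (ExteriorAlgebra.map β).toLinearMap) := by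
      refine sup_le ?_ fun b hb => ?_
      · rw [Submodule.map_span, Submodule.span_le]
        rintro _ ⟨w, hw, rfl⟩
        change D.d (ExteriorAlgebra.map β (ι ℚ w)) = 0
        rw [ExteriorAlgebra.map_apply_ι]
        exact h.d_β w hw
      · obtain ⟨r, rfl⟩ := mem_exteriorPower_zero hb
        change D.d (ExteriorAlgebra.map β (algebraMap ℚ _ r)) = 0
        rw [AlgHom.commutes, d_algebraMap]
    exact fun b hb => this hb
  have hTA : ∀ b ∈ T, ExteriorAlgebra.map β b ∈ A := by
    have : T ≤ (Subalgebra.toSubmodule A).comap (ExteriorAlgebra.map β).toLinearMap := by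
      refine sup_le ?_ fun b hb => ?_
      · rw [Submodule.map_span, Submodule.span_le]
        rintro _ ⟨w, hw, rfl⟩
        change ExteriorAlgebra.map β (ι ℚ w) ∈ A
        rw [ExteriorAlgebra.map_apply_ι]
        exact Algebra.subset_adjoin ⟨_, h.d_β w hw, rfl⟩
      · obtain ⟨r, rfl⟩ := mem_exteriorPower_zero hb
        change ExteriorAlgebra.map β (algebraMap ℚ _ r) ∈ A
        rw [AlgHom.commutes]
        exact Subalgebra.algebraMap_mem A r
    exact fun b hb => this hb
  have hz₂' : extProd i β z₂ ∈ filtration i β 0 := ⟨z₂, hz₂, rfl⟩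
  have h0 := h.lTensor_d_eq_zero hz₁ hz₂' hd
  -- the linear part in `W₂` of a cocycle has closed coefficients, so `D` acts on `z` through `D₁`
  have hz₁T : z₁ ∈ tensorSub (⊤ : Submodule ℚ (Λ W₁)) T := by
    obtain ⟨g, hg⟩ := (D₂.d.domRestrict (⋀[ℚ]^1 W₂)).exists_pseudoinverse
    set r : Λ W₂ →ₗ[ℚ] Λ W₂ := (⋀[ℚ]^1 W₂).subtype ∘ₗ g with hr
    have e : (LinearMap.id - r ∘ₗ D₂.d).lTensor (Λ W₁) z₁ = z₁ := by
      rw [LinearMap.lTensor_sub, LinearMap.lTensor_comp, LinearMap.sub_apply,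
        LinearMap.comp_apply, h0, map_zero, sub_zero, LinearMap.lTensor_id, LinearMap.id_apply]
    rw [← e]
    refine map_mem_of_tensorSub ((LinearMap.id - r ∘ₗ D₂.d).lTensor (Λ W₁)) _
      (fun a _ b hb => ?_) hz₁
    refine tmul_mem_tensorSub Submodule.mem_top ?_
    have h1 : D₂.d (b - r (D₂.d b)) = 0 := by
      rw [map_sub]
      have : D₂.d (g (D₂.d b)) = D₂.d b := hg ⟨b, hb⟩
      exact sub_eq_zero.mpr this.symm
    obtain ⟨w, hw⟩ := mem_exteriorPower_one (sub_mem hb (g (D₂.d b)).2)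
    change b - r (D₂.d b) ∈ T
    rw [hr] at h1 ⊢
    change D₂.d (b - g (D₂.d b)) = 0 at h1
    change b - g (D₂.d b) ∈ T
    rw [hw] at h1 ⊢
    exact Submodule.mem_sup_left ⟨w, Submodule.subset_span h1, rfl⟩
  have hz₂T : z₂ ∈ tensorSub (⊤ : Submodule ℚ (Λ W₁)) T := by
    refine Submodule.map₂_le_map₂_right ?_ hz₂
    refine iSup₂_le fun k hk => ?_
    rw [Nat.le_zero.mp hk]
    exact le_sup_right
  have hzT := add_mem hz₁T hz₂T
  set z := z₁ + z₂
  have h3 : D₁.d.rTensor (Λ W₂) z = 0 := by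
    apply (extProd_bijective i β h.bijective).1
    rw [map_zero, ← hd]
    refine eqOn_tensorSub (extProd i β ∘ₗ D₁.d.rTensor (Λ W₂)) (D.d ∘ₗ extProd i β)
      (fun a _ b hb => ?_) hzT
    change extProd i β (D₁.d a ⊗ₜ b) = D.d (extProd i β (a ⊗ₜ b))
    rw [extProd_tmul, extProd_tmul, d_mul, hTd b hb, mul_zero, add_zero, d_map h.d_i]
  -- hence `z` is a combination of products of cocycles of `W₁` and closed forms on `W₂`
  have hzK : z ∈ tensorSub (LinearMap.ker D₁.d) T := by
    obtain ⟨g, hg⟩ := D₁.d.exists_pseudoinverse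
    have e : (LinearMap.id - g ∘ₗ D₁.d).rTensor (Λ W₂) z = z := by
      rw [LinearMap.rTensor_sub, LinearMap.rTensor_comp, LinearMap.sub_apply,
        LinearMap.comp_apply, h3, map_zero, sub_zero, LinearMap.rTensor_id, LinearMap.id_apply]
    rw [← e]
    refine map_mem_of_tensorSub ((LinearMap.id - g ∘ₗ D₁.d).rTensor (Λ W₂)) _
      (fun a _ b hb => ?_) hzT
    refine tmul_mem_tensorSub ?_ hb
    change D₁.d (a - g (D₁.d a)) = 0
    rw [map_sub, hg, sub_self]
  have hmem : extProd i β z ∈ Subalgebra.toSubmodule A ⊔ LinearMap.range D.d := by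
    refine map_mem_of_tensorSub (extProd i β) _ (fun a ha b hb => ?_) hzK
    obtain ⟨a', ha', y, rfl⟩ := h₁ a ha
    rw [extProd_tmul, map_add, add_mul]
    refine add_mem (Submodule.mem_sup_left ?_) (Submodule.mem_sup_right ?_)
    · refine Subalgebra.mul_mem A ?_ (hTA b hb)
      have hle : Algebra.adjoin ℚ (ι ℚ '' {w | D₁.d (ι ℚ w) = 0}) ≤
          A.comap (ExteriorAlgebra.map i) := by
        rw [Algebra.adjoin_le_iff]
        rintro _ ⟨w, hw, rfl⟩
        change ExteriorAlgebra.map i (ι ℚ w) ∈ A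
        rw [ExteriorAlgebra.map_apply_ι]
        refine Algebra.subset_adjoin ⟨_, ?_, rfl⟩
        rw [Set.mem_ofPred_eq, h.d_i, hw, map_zero]
      exact hle ha'
    · exact ⟨ExteriorAlgebra.map i y * ExteriorAlgebra.map β b, by
        rw [d_mul, hTd b hb, mul_zero, add_zero, d_map h.d_i]⟩
  obtain ⟨c', hc', _, ⟨y, rfl⟩, hsum⟩ := Submodule.mem_sup.mp hmem
  refine ⟨c', hc', y + b, ?_⟩
  rw [map_add, ← add_assoc, hsum, hzc, sub_add_cancel]

end IsExtension

end ExteriorDifferential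

/-! ### Values of two-forms -/

section TwoForms

variable {M M' : Type u} [AddCommGroup M] [Module ℚ M] [AddCommGroup M'] [Module ℚ M']

/-- The value of a two-form on a pair of linear forms. -/
noncomputable def formValue (φ ψ : Module.Dual ℚ M) : ExteriorAlgebra ℚ M →ₗ[ℚ] ℚ :=
  ExteriorAlgebra.algebraMapInv.toLinearMap ∘ₗ extContract ψ ∘ₗ extContract φ

theorem formValue_ι_mul_ι (φ ψ : Module.Dual ℚ M) (v w : M) :
    formValue φ ψ (ι ℚ v * ι ℚ w) = φ v * ψ w - φ w * ψ v := by
  have h : extContract ψ (extContract φ (ι ℚ v * ι ℚ w)) =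
      algebraMap ℚ _ (φ v * ψ w - φ w * ψ v) := by
    rw [extContract_ι_mul, extContract_ι, map_sub, map_smul, extContract_ι, extContract_ι_mul,
      extContract_algebraMap, mul_zero, sub_zero, Algebra.smul_def, Algebra.smul_def, ← map_mul,
      ← map_mul, ← map_sub, mul_comm (ψ v)]
  change ExteriorAlgebra.algebraMapInv (extContract ψ (extContract φ _)) = _
  rw [h]
  exact ExteriorAlgebra.algebraMap_leftInverse M _

theorem formValue_map (f : M →ₗ[ℚ] M') (φ ψ : Module.Dual ℚ M') {c : ExteriorAlgebra ℚ M}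
    (hc : c ∈ ⋀[ℚ]^2 M) :
    formValue φ ψ (ExteriorAlgebra.map f c) = formValue (φ ∘ₗ f) (ψ ∘ₗ f) c := by
  refine exteriorPower_two_induction (p := fun c => formValue φ ψ (ExteriorAlgebra.map f c) =
    formValue (φ ∘ₗ f) (ψ ∘ₗ f) c) (fun v w => ?_) (fun x y hx hy => ?_) hc
  · rw [map_mul, ExteriorAlgebra.map_apply_ι, ExteriorAlgebra.map_apply_ι, formValue_ι_mul_ι,
      formValue_ι_mul_ι]
    rfl
  · rw [map_add, map_add, map_add, hx, hy]

theorem formValue_swap (φ ψ : Module.Dual ℚ M) {c : ExteriorAlgebra ℚ M}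
    (hc : c ∈ ⋀[ℚ]^2 M) : formValue ψ φ c = -formValue φ ψ c := by
  refine exteriorPower_two_induction (p := fun c => formValue ψ φ c = -formValue φ ψ c)
    (fun v w => ?_) (fun x y hx hy => ?_) hc
  · rw [formValue_ι_mul_ι, formValue_ι_mul_ι]; ring
  · rw [map_add, map_add, hx, hy]; ring

/-- The value of a two-form is bilinear in the pair of linear forms. -/
theorem formValue_add_left (φ φ' ψ : Module.Dual ℚ M) (c : ExteriorAlgebra ℚ M) :
    formValue (φ + φ') ψ c = formValue φ ψ c + formValue φ' ψ c := by
  have h : extContract (φ + φ') c = extContract φ c + extContract φ' c := by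
    rw [extContract, map_add]; rfl
  simp only [formValue, LinearMap.comp_apply, h, map_add]

theorem formValue_smul_left (a : ℚ) (φ ψ : Module.Dual ℚ M) (c : ExteriorAlgebra ℚ M) :
    formValue (a • φ) ψ c = a * formValue φ ψ c := by
  have h : extContract (a • φ) c = a • extContract φ c := by
    rw [extContract, map_smul]; rfl
  simp only [formValue, LinearMap.comp_apply, h, map_smul, smul_eq_mul]

theorem formValue_add_right (φ ψ ψ' : Module.Dual ℚ M) (c : ExteriorAlgebra ℚ M) :
    formValue φ (ψ + ψ') c = formValue φ ψ c + formValue φ ψ' c := by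
  have h : ∀ c : ExteriorAlgebra ℚ M,
      extContract (ψ + ψ') c = extContract ψ c + extContract ψ' c := fun c => by
    rw [extContract, map_add]; rfl
  simp only [formValue, LinearMap.comp_apply, h, map_add]

theorem formValue_smul_right (a : ℚ) (φ ψ : Module.Dual ℚ M) (c : ExteriorAlgebra ℚ M) :
    formValue φ (a • ψ) c = a * formValue φ ψ c := by
  have h : ∀ c : ExteriorAlgebra ℚ M, extContract (a • ψ) c = a • extContract ψ c := fun c => by
    rw [extContract, map_smul]; rfl
  simp only [formValue, LinearMap.comp_apply, h, map_smul, smul_eq_mul]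

theorem formValue_self (φ : Module.Dual ℚ M) {c : ExteriorAlgebra ℚ M} (hc : c ∈ ⋀[ℚ]^2 M) :
    formValue φ φ c = 0 := by
  have := formValue_swap φ φ hc
  linarith

end TwoForms

/-! ### Chevalley--Eilenberg differentials and pull-backs -/

section Pullback

variable {X Y Z : Type u} {𝔤 𝔥 𝔣 : Type u} [LieRing 𝔤] [LieAlgebra ℚ 𝔤] [LieRing 𝔥]
  [LieAlgebra ℚ 𝔥] [LieRing 𝔣] [LieAlgebra ℚ 𝔣] {t : X → 𝔤} {s : Y → 𝔥} {u : Z → 𝔣}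

/-- A two-form on the graded dual of a Lie algebra is determined by its values. -/
theorem eq_of_formValue_eq {c c' : ExteriorAlgebra ℚ (GradedDual t)}
    (hc : c ∈ ⋀[ℚ]^2 (GradedDual t)) (hc' : c' ∈ ⋀[ℚ]^2 (GradedDual t))
    (h : ∀ x y, formValue (gradedDualEval t x) (gradedDualEval t y) c =
      formValue (gradedDualEval t x) (gradedDualEval t y) c') : c = c' := by
  rw [← sub_eq_zero]
  refine eq_zero_of_contract t two_ne_zero (sub_mem hc hc') fun x => ?_
  obtain ⟨w, hw⟩ := mem_exteriorPower_one (extContract_mem (gradedDualEval t x) (sub_mem hc hc'))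
  rw [hw]
  have hw0 : w = 0 := by
    refine GradedDual.ext fun y => ?_
    have h1 := sub_eq_zero.mpr (h x y)
    rw [← map_sub] at h1
    change ExteriorAlgebra.algebraMapInv (extContract _ (extContract _ (c - c'))) = 0 at h1
    rw [hw, extContract_ι] at h1
    rw [map_zero, LinearMap.zero_apply, ← gradedDualEval_apply, ← h1]
    exact (ExteriorAlgebra.algebraMap_leftInverse (GradedDual t) _).symm
  rw [hw0, map_zero]

theorem lieWeight_one_eq (t : X → 𝔤) : lieWeight t 1 = Submodule.span ℚ (Set.range t) := by
  rw [lieWeight]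

theorem gen_mem_lieWeight (t : X → 𝔤) (x : X) : t x ∈ lieWeight t 1 := by
  rw [lieWeight_one_eq]
  exact Submodule.subset_span ⟨x, rfl⟩

theorem eq_zero_of_mem_lieWeight_zero {x : 𝔤} (hx : x ∈ lieWeight t 0) : x = 0 := by
  simpa [lieWeight] using hx

/-- Induction on the weight: `lieWeight t (n + 2)` is spanned by brackets with generators. -/
theorem lieWeight_succ_induction {n : ℕ} {S : Submodule ℚ 𝔤}
    (h : ∀ x, ∀ y ∈ lieWeight t (n + 1), ⁅t x, y⁆ ∈ S) : lieWeight t (n + 2) ≤ S := by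
  rw [lieWeight]
  refine iSup_le fun x => ?_
  rintro _ ⟨y, hy, rfl⟩
  exact h x y hy

theorem LieHom.map_lieWeight (φ : 𝔤 →ₗ⁅ℚ⁆ 𝔥) (h : ∀ x, φ (t x) ∈ lieWeight s 1) :
    ∀ n, ∀ y ∈ lieWeight t n, φ y ∈ lieWeight s n
  | 0, y, hy => by rw [eq_zero_of_mem_lieWeight_zero hy, map_zero]; exact zero_mem _
  | 1, y, hy => by
    rw [lieWeight_one_eq] at hy
    have : Submodule.span ℚ (Set.range t) ≤ (lieWeight s 1).comap (φ : 𝔤 →ₗ[ℚ] 𝔥) := by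
      rw [Submodule.span_le]
      rintro _ ⟨x, rfl⟩
      exact h x
    exact this hy
  | n + 2, y, hy => by
    have : lieWeight t (n + 2) ≤ (lieWeight s (n + 2)).comap (φ : 𝔤 →ₗ[ℚ] 𝔥) := by
      refine lieWeight_succ_induction fun x y hy => ?_
      change φ ⁅t x, y⁆ ∈ lieWeight s (n + 2)
      rw [LieHom.map_lie]
      have := lieWeight_lie s (h x) (LieHom.map_lieWeight φ h (n + 1) y hy)
      rwa [show 1 + (n + 1) = n + 2 by omega] at this
    exact this hy

/-- Pull-back of linear forms along a linear map that respects the weights. -/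
def GradedDual.comap (φ : 𝔤 →ₗ[ℚ] 𝔥) (hφ : ∀ n, ∀ y ∈ lieWeight t n, φ y ∈ lieWeight s n) :
    GradedDual s →ₗ[ℚ] GradedDual t where
  toFun f := ⟨GradedDual.pairing s f ∘ₗ φ, by
    obtain ⟨N, hN⟩ := f.2
    exact ⟨N, fun n hn y hy => hN n hn _ (hφ n y hy)⟩⟩
  map_add' _ _ := GradedDual.ext fun _ => rfl
  map_smul' _ _ := GradedDual.ext fun _ => rfl

theorem GradedDual.comap_apply (φ : 𝔤 →ₗ[ℚ] 𝔥)
    (hφ : ∀ n, ∀ y ∈ lieWeight t n, φ y ∈ lieWeight s n) (f : GradedDual s) (x : 𝔤) :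
    GradedDual.pairing t (GradedDual.comap φ hφ f) x = GradedDual.pairing s f (φ x) := rfl

variable [Finite X] [Finite Y] [Finite Z]

/-- The Chevalley--Eilenberg differential on the exterior algebra of the graded dual. -/
noncomputable def ceExterior (ht : LieGenerates t) : ExteriorDifferential (GradedDual t) where
  d := ceDifferential ht
  d_algebraMap := ceDifferential_algebraMap ht
  d_ι_mem w := by rw [ceDifferential_ι]; exact cobracket_mem ht w
  d_ι_mul w b := by rw [ceDifferential_ι_mul, ceDifferential_ι]
  d_d := ceDifferential_ceDifferential ht

theorem formValue_d_ι (ht : LieGenerates t) (f : GradedDual t) (x y : 𝔤) :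
    formValue (gradedDualEval t x) (gradedDualEval t y) ((ceExterior ht).d (ι ℚ f)) =
      -GradedDual.pairing t f ⁅x, y⁆ := by
  change ExteriorAlgebra.algebraMapInv (extContract _ (extContract _ (ceDifferential ht _))) = _
  rw [ceDifferential_ι, contract_cobracket, map_neg, extContract_ι, map_neg]
  exact congrArg Neg.neg (ExteriorAlgebra.algebraMap_leftInverse (GradedDual t) _)

theorem d_ι_eq_iff (ht : LieGenerates t) (f : GradedDual t) {c : ExteriorAlgebra ℚ (GradedDual t)}
    (hc : c ∈ ⋀[ℚ]^2 (GradedDual t)) :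
    (ceExterior ht).d (ι ℚ f) = c ↔ ∀ x y : 𝔤, GradedDual.pairing t f ⁅x, y⁆ =
      -formValue (gradedDualEval t x) (gradedDualEval t y) c := by
  constructor
  · rintro rfl x y
    rw [formValue_d_ι, neg_neg]
  · intro h
    refine eq_of_formValue_eq ((ceExterior ht).d_ι_mem f) hc fun x y => ?_
    rw [formValue_d_ι, h, neg_neg]

theorem d_ι_eq_zero_iff (ht : LieGenerates t) (f : GradedDual t) :
    (ceExterior ht).d (ι ℚ f) = 0 ↔ ∀ x y : 𝔤, GradedDual.pairing t f ⁅x, y⁆ = 0 := by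
  rw [d_ι_eq_iff ht f (zero_mem _)]
  simp

theorem d_ι_comap (ht : LieGenerates t) (hs : LieGenerates s) (φ : 𝔤 →ₗ⁅ℚ⁆ 𝔥)
    (hφ : ∀ n, ∀ y ∈ lieWeight t n, (φ : 𝔤 →ₗ[ℚ] 𝔥) y ∈ lieWeight s n) (f : GradedDual s) :
    (ceExterior ht).d (ι ℚ (GradedDual.comap (φ : 𝔤 →ₗ[ℚ] 𝔥) hφ f)) =
      ExteriorAlgebra.map (GradedDual.comap (φ : 𝔤 →ₗ[ℚ] 𝔥) hφ) ((ceExterior hs).d (ι ℚ f)) := by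
  rw [d_ι_eq_iff ht _ (map_mem_exteriorPower _ ((ceExterior hs).d_ι_mem f))]
  intro x y
  rw [formValue_map _ _ _ ((ceExterior hs).d_ι_mem f)]
  have h := formValue_d_ι hs f (φ x) (φ y)
  rw [GradedDual.comap_apply]
  change GradedDual.pairing s f (φ ⁅x, y⁆) = -formValue (gradedDualEval s (φ x))
    (gradedDualEval s (φ y)) _
  rw [h, neg_neg, LieHom.map_lie]

/-- A split extension `0 → 𝔣 → 𝔤 → 𝔥 → 0` of Lie algebras that is compatible with the generators,
such that `𝔥` acts trivially on the abelianization of `𝔣`, gives an extension of the graded dual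
Lie coalgebras. -/
theorem exists_isExtension (ht : LieGenerates t) (hs : LieGenerates s) (hu : LieGenerates u)
    (p : 𝔤 →ₗ⁅ℚ⁆ 𝔥) (σ : 𝔥 →ₗ⁅ℚ⁆ 𝔤) (j : 𝔣 →ₗ⁅ℚ⁆ 𝔤) (hpσ : ∀ y, p (σ y) = y)
    (hpj : ∀ z, p (j z) = 0) (hj : Function.Injective j)
    (hσs : ∀ y, σ (s y) ∈ lieWeight t 1) (hju : ∀ z, j (u z) ∈ lieWeight t 1)
    (hcov : ∀ x, (∃ y, t x = σ (s y)) ∨ ∃ z, t x = j (u z))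
    (hlie : ∀ y z, ⁅σ (s y), j (u z)⁆ ∈ (lieWeight u 2).map (j : 𝔣 →ₗ[ℚ] 𝔤)) :
    ∃ i p β, (ceExterior hs).IsExtension (ceExterior ht) (ceExterior hu) i p β := by
  have hp1 : ∀ x, p (t x) ∈ lieWeight s 1 := by
    intro x
    rcases hcov x with ⟨y, hy⟩ | ⟨z, hz⟩
    · rw [hy, hpσ]; exact gen_mem_lieWeight s y
    · rw [hz, hpj]; exact zero_mem _
  have hpw := LieHom.map_lieWeight p hp1
  have hσw := LieHom.map_lieWeight σ hσs
  have hjw := LieHom.map_lieWeight j hju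
  -- the generators of `𝔥` raise the weight on `𝔣`
  have hact1 : ∀ y n, ∀ b ∈ lieWeight u n,
      ⁅σ (s y), j b⁆ ∈ (lieWeight u (n + 1)).map (j : 𝔣 →ₗ[ℚ] 𝔤) := by
    intro y n
    induction n with
    | zero =>
      intro b hb
      rw [eq_zero_of_mem_lieWeight_zero hb, map_zero, lie_zero]
      exact zero_mem _
    | succ n ih =>
      rcases n with _ | n
      · have : lieWeight u 1 ≤ ((lieWeight u 2).map (j : 𝔣 →ₗ[ℚ] 𝔤)).comap
            ((LieAlgebra.ad ℚ 𝔤 (σ (s y)) : 𝔤 →ₗ[ℚ] 𝔤) ∘ₗ (j : 𝔣 →ₗ[ℚ] 𝔤)) := by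
          rw [lieWeight_one_eq, Submodule.span_le]
          rintro _ ⟨z, rfl⟩
          exact hlie y z
        exact fun b hb => this hb
      · have : lieWeight u (n + 2) ≤ ((lieWeight u (n + 2 + 1)).map (j : 𝔣 →ₗ[ℚ] 𝔤)).comap
            ((LieAlgebra.ad ℚ 𝔤 (σ (s y)) : 𝔤 →ₗ[ℚ] 𝔤) ∘ₗ (j : 𝔣 →ₗ[ℚ] 𝔤)) := by
          refine lieWeight_succ_induction fun z b hb => ?_
          change ⁅σ (s y), j ⁅u z, b⁆⁆ ∈ (lieWeight u (n + 2 + 1)).map (j : 𝔣 →ₗ[ℚ] 𝔤)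
          rw [LieHom.map_lie, leibniz_lie]
          obtain ⟨b', hb', hbe⟩ := ih b hb
          obtain ⟨c, hc, hce⟩ := hlie y z
          change j b' = _ at hbe
          change j c = _ at hce
          rw [← hbe, ← hce, ← LieHom.map_lie, ← LieHom.map_lie]
          have h1 := lieWeight_lie u hc hb
          have h2 := lieWeight_lie u (gen_mem_lieWeight u z) hb'
          rw [show 2 + (n + 1) = n + 2 + 1 by omega] at h1
          rw [show 1 + (n + 1 + 1) = n + 2 + 1 by omega] at h2
          exact add_mem ⟨_, h1, rfl⟩ ⟨_, h2, rfl⟩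
        exact fun b hb => this hb
  have hact : ∀ m n, ∀ a ∈ lieWeight s m, ∀ b ∈ lieWeight u n,
      ⁅σ a, j b⁆ ∈ (lieWeight u (m + n)).map (j : 𝔣 →ₗ[ℚ] 𝔤) := by
    intro m
    induction m with
    | zero =>
      intro n a ha b _
      rw [eq_zero_of_mem_lieWeight_zero ha, map_zero, zero_lie]
      exact zero_mem _
    | succ m ih =>
      intro n a ha b hb
      rcases m with _ | m
      · have : lieWeight s 1 ≤ ((lieWeight u (0 + 1 + n)).map (j : 𝔣 →ₗ[ℚ] 𝔤)).comap
            ((LieAlgebra.ad ℚ 𝔤 (j b) : 𝔤 →ₗ[ℚ] 𝔤) ∘ₗ (σ : 𝔥 →ₗ[ℚ] 𝔤)) := by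
          rw [lieWeight_one_eq, Submodule.span_le]
          rintro _ ⟨y, rfl⟩
          have := hact1 y n b hb
          rw [show n + 1 = 0 + 1 + n by omega] at this
          rw [← lie_skew, neg_mem_iff] at this
          exact this
        rw [← lie_skew, neg_mem_iff]
        exact this ha
      · have : lieWeight s (m + 2) ≤ ((lieWeight u (m + 1 + 1 + n)).map (j : 𝔣 →ₗ[ℚ] 𝔤)).comap
            ((LieAlgebra.ad ℚ 𝔤 (j b) : 𝔤 →ₗ[ℚ] 𝔤) ∘ₗ (σ : 𝔥 →ₗ[ℚ] 𝔤)) := by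
          refine lieWeight_succ_induction fun y a ha => ?_
          change ⁅j b, σ ⁅s y, a⁆⁆ ∈ (lieWeight u (m + 1 + 1 + n)).map (j : 𝔣 →ₗ[ℚ] 𝔤)
          rw [← lie_skew, neg_mem_iff, LieHom.map_lie, lie_lie]
          obtain ⟨b₁, hb₁, he₁⟩ := ih n a ha b hb
          obtain ⟨b₂, hb₂, he₂⟩ := hact1 y n b hb
          change j b₁ = _ at he₁
          change j b₂ = _ at he₂
          rw [← he₁, ← he₂]
          have h1 := hact1 y _ b₁ hb₁
          have h2 := ih _ a ha b₂ hb₂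
          rw [show m + 1 + n + 1 = m + 1 + 1 + n by omega] at h1
          rw [show m + 1 + (n + 1) = m + 1 + 1 + n by omega] at h2
          exact sub_mem h1 h2
        rw [← lie_skew, neg_mem_iff]
        exact this ha
  -- the decomposition `𝔤 = σ 𝔥 ⊕ j 𝔣`
  have hdec : ∀ n, lieWeight t n ≤ (lieWeight s n).map (σ : 𝔥 →ₗ[ℚ] 𝔤) ⊔
      (lieWeight u n).map (j : 𝔣 →ₗ[ℚ] 𝔤) := by
    intro n
    induction n with
    | zero => intro x hx; rw [eq_zero_of_mem_lieWeight_zero hx]; exact zero_mem _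
    | succ n ih =>
      rcases n with _ | n
      · rw [lieWeight_one_eq t, Submodule.span_le]
        rintro _ ⟨x, rfl⟩
        rcases hcov x with ⟨y, hy⟩ | ⟨z, hz⟩
        · rw [hy]; exact Submodule.mem_sup_left ⟨_, gen_mem_lieWeight s y, rfl⟩
        · rw [hz]; exact Submodule.mem_sup_right ⟨_, gen_mem_lieWeight u z, rfl⟩
      · refine lieWeight_succ_induction fun x y hy => ?_
        obtain ⟨_, ⟨a, ha, rfl⟩, _, ⟨b, hb, rfl⟩, rfl⟩ := Submodule.mem_sup.mp (ih hy)
        change ⁅t x, σ a + j b⁆ ∈ _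
        rw [lie_add]
        rcases hcov x with ⟨y, hy⟩ | ⟨z, hz⟩
        · rw [hy, ← LieHom.map_lie]
          have h1 := lieWeight_lie s (gen_mem_lieWeight s y) ha
          rw [show 1 + (n + 1) = n + 1 + 1 by omega] at h1
          exact add_mem (Submodule.mem_sup_left ⟨_, h1, rfl⟩)
            (Submodule.mem_sup_right (hact1 y _ b hb))
        · rw [hz, ← LieHom.map_lie, ← lie_skew]
          have h1 := lieWeight_lie u (gen_mem_lieWeight u z) hb
          rw [show 1 + (n + 1) = n + 1 + 1 by omega] at h1
          exact add_mem (Submodule.mem_sup_right (neg_mem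
            (hact _ 1 a ha _ (gen_mem_lieWeight u z)))) (Submodule.mem_sup_right ⟨_, h1, rfl⟩)
  have hrange : ∀ x, x - σ (p x) ∈ LinearMap.range (j : 𝔣 →ₗ[ℚ] 𝔤) := by
    intro x
    have hx : x ∈ ⨆ n, lieWeight t n := by rw [iSup_lieWeight ht]; trivial
    have hle : ⨆ n, lieWeight t n ≤ (LinearMap.range (j : 𝔣 →ₗ[ℚ] 𝔤)).comap
        (LinearMap.id - (σ : 𝔥 →ₗ[ℚ] 𝔤) ∘ₗ (p : 𝔤 →ₗ[ℚ] 𝔥)) := by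
      refine iSup_le fun n y hy => ?_
      obtain ⟨_, ⟨a, ha, rfl⟩, _, ⟨b, hb, rfl⟩, rfl⟩ := Submodule.mem_sup.mp (hdec n hy)
      change σ a + j b - σ (p (σ a + j b)) ∈ LinearMap.range (j : 𝔣 →ₗ[ℚ] 𝔤)
      rw [map_add p, hpσ, hpj, add_zero, add_sub_cancel_left]
      exact ⟨b, rfl⟩
    exact hle hx
  -- the linear projection onto the kernel of `p`; it need not respect brackets
  let q : 𝔤 →ₗ[ℚ] 𝔣 := (LinearEquiv.ofInjective (j : 𝔣 →ₗ[ℚ] 𝔤) hj).symm.toLinearMap ∘ₗ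
    (LinearMap.id - (σ : 𝔥 →ₗ[ℚ] 𝔤) ∘ₗ (p : 𝔤 →ₗ[ℚ] 𝔥)).codRestrict _ hrange
  have hq : ∀ x, j (q x) = x - σ (p x) := fun x =>
    LinearEquiv.ofInjective_symm_apply (j : 𝔣 →ₗ[ℚ] 𝔤) (h := hj) ⟨x - σ (p x), hrange x⟩
  have hqσ : ∀ a, q (σ a) = 0 := fun a => hj (by rw [hq, hpσ, sub_self, map_zero])
  have hqj : ∀ b, q (j b) = b := fun b => hj (by rw [hq, hpj, map_zero, sub_zero])
  have hqw : ∀ n, ∀ x ∈ lieWeight t n, q x ∈ lieWeight u n := by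
    intro n x hx
    obtain ⟨_, ⟨a, ha, rfl⟩, _, ⟨b, hb, rfl⟩, rfl⟩ := Submodule.mem_sup.mp (hdec n hx)
    rw [map_add]
    change q (σ a) + q (j b) ∈ _
    rwa [hqσ, hqj, zero_add]
  refine ⟨GradedDual.comap (p : 𝔤 →ₗ[ℚ] 𝔥) hpw, GradedDual.comap (j : 𝔣 →ₗ[ℚ] 𝔤) hjw,
    GradedDual.comap q hqw, ⟨?_, ?_⟩, ?_, ?_, ?_, ?_, ?_⟩
  · rw [injective_iff_map_eq_zero]
    rintro ⟨f, g⟩ h0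
    have h1 : ∀ x, GradedDual.pairing s f (p x) + GradedDual.pairing u g (q x) = 0 := fun x =>
      congrArg (fun f => GradedDual.pairing t f x) h0
    refine Prod.ext (GradedDual.ext fun y => ?_) (GradedDual.ext fun z => ?_)
    · have := h1 (σ y)
      rwa [hpσ, hqσ, map_zero, add_zero] at this
    · have := h1 (j z)
      rwa [hpj, hqj, map_zero, zero_add] at this
  · intro f
    refine ⟨(GradedDual.comap (σ : 𝔥 →ₗ[ℚ] 𝔤) hσw f, GradedDual.comap (j : 𝔣 →ₗ[ℚ] 𝔤) hjw f),
      GradedDual.ext fun x => ?_⟩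
    change GradedDual.pairing t f (σ (p x)) + GradedDual.pairing t f (j (q x)) = _
    rw [hq, ← map_add, add_sub_cancel]
  · intro f
    refine GradedDual.ext fun z => ?_
    change GradedDual.pairing s f (p (j z)) = _
    rw [hpj, map_zero, map_zero, LinearMap.zero_apply]
  · intro f
    refine GradedDual.ext fun z => ?_
    change GradedDual.pairing u f (q (j z)) = _
    rw [hqj]
  · exact d_ι_comap ht hs p hpw
  · exact fun f => d_ι_comap hu ht j hjw f
  · intro f hf
    rw [d_ι_eq_zero_iff] at hf ⊢
    intro x y
    change GradedDual.pairing u f (q ⁅x, y⁆) = 0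
    -- a closed form vanishes on all weights `≥ 2`
    have hf2 : ∀ n, 2 ≤ n → ∀ z ∈ lieWeight u n, GradedDual.pairing u f z = 0 := by
      intro n hn z hz
      obtain ⟨n, rfl⟩ := Nat.exists_eq_add_of_le' hn
      have : lieWeight u (n + 2) ≤ LinearMap.ker (GradedDual.pairing u f) :=
        lieWeight_succ_induction fun _ _ _ => hf _ _
      exact this hz
    have hx : x ∈ ⨆ n, lieWeight t n := by rw [iSup_lieWeight ht]; trivial
    have hy : y ∈ ⨆ n, lieWeight t n := by rw [iSup_lieWeight ht]; trivial
    induction hx using Submodule.iSup_induction' with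
    | zero => simp
    | add x x' _ _ h1 h2 => rw [add_lie, map_add, map_add, h1, h2, add_zero]
    | mem m x hx =>
      induction hy using Submodule.iSup_induction' with
      | zero => simp
      | add y y' _ _ h1 h2 => rw [lie_add, map_add, map_add, h1, h2, add_zero]
      | mem n y hy =>
        rcases m with _ | m
        · rw [eq_zero_of_mem_lieWeight_zero hx, zero_lie, map_zero, map_zero]
        rcases n with _ | n
        · rw [eq_zero_of_mem_lieWeight_zero hy, lie_zero, map_zero, map_zero]
        exact hf2 (m + 1 + (n + 1)) (by omega) _ (hqw _ _ (lieWeight_lie t hx hy))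

end Pullback

/-! ### Free Lie algebras have cohomological dimension one -/

section FreeLie

variable {B : Type u}

local notation "𝔉" => FreeLieAlgebra ℚ

theorem FreeLieAlgebra.lieGenerates_of :
    LieGenerates (FreeLieAlgebra.of ℚ : B → 𝔉 B) := by
  let K : LieSubalgebra ℚ (𝔉 B) := LieSubalgebra.lieSpan ℚ (𝔉 B) (Set.range (FreeLieAlgebra.of ℚ))
  let g : 𝔉 B →ₗ⁅ℚ⁆ K :=
    FreeLieAlgebra.lift ℚ fun x => ⟨FreeLieAlgebra.of ℚ x, LieSubalgebra.subset_lieSpan ⟨x, rfl⟩⟩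
  have h : K.incl.comp g = LieHom.id := FreeLieAlgebra.hom_ext fun x => by
    rw [LieHom.comp_apply, FreeLieAlgebra.lift_of_apply]
    rfl
  change K = ⊤
  rw [eq_top_iff]
  intro z _
  have hz : (g z : 𝔉 B) = z := LieHom.congr_fun h z
  rw [← hz]
  exact (g z).2

open LieModule.Cohomology in
/-- Two-cocycles of a free Lie algebra are coboundaries, and the primitive can be prescribed on
the generators: the extension defined by a two-cocycle splits by the universal property. -/
theorem FreeLieAlgebra.exists_primitive {M : Type*} [AddCommGroup M] [Module ℚ M]
    [LieRingModule (𝔉 B) M] [LieModule ℚ (𝔉 B) M] (c : twoCocycle ℚ (𝔉 B) M) (v : B → M) :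
    ∃ α : 𝔉 B →ₗ[ℚ] M, (∀ b, α (FreeLieAlgebra.of ℚ b) = v b) ∧
      ∀ x y, α ⁅x, y⁆ = c.1 x y + ⁅x, α y⁆ - ⁅y, α x⁆ := by
  let E := LieAlgebra.ofTwoCocycle c
  let π : E →ₗ⁅ℚ⁆ 𝔉 B :=
    { toFun := fun x => ((LieAlgebra.ofProd c).symm x).1
      map_add' := fun _ _ => rfl
      map_smul' := fun _ _ => rfl
      map_lie' := rfl }
  let ρ : E →ₗ[ℚ] M :=
    { toFun := fun x => ((LieAlgebra.ofProd c).symm x).2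
      map_add' := fun _ _ => rfl
      map_smul' := fun _ _ => rfl }
  let g : 𝔉 B →ₗ⁅ℚ⁆ E :=
    FreeLieAlgebra.lift ℚ fun b => LieAlgebra.ofProd c (FreeLieAlgebra.of ℚ b, v b)
  have hg : ∀ x, π (g x) = x := by
    have : π.comp g = LieHom.id := FreeLieAlgebra.hom_ext fun b => by
      rw [LieHom.comp_apply, FreeLieAlgebra.lift_of_apply]
      rfl
    exact fun x => LieHom.congr_fun this x
  refine ⟨ρ ∘ₗ (g : 𝔉 B →ₗ[ℚ] E), fun b => ?_, fun x y => ?_⟩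
  · change ρ (g _) = _
    rw [FreeLieAlgebra.lift_of_apply]
    rfl
  · change ρ (g ⁅x, y⁆) = _
    rw [LieHom.map_lie]
    change c.1 (π (g x)) (π (g y)) + ⁅π (g x), ρ (g y)⁆ - ⁅π (g y), ρ (g x)⁆ = _
    rw [hg, hg]
    rfl

/-- Derivations of a free Lie algebra can be prescribed on the generators. -/
theorem FreeLieAlgebra.exists_derivation (v : B → 𝔉 B) :
    ∃ D : LieDerivation ℚ (𝔉 B) (𝔉 B), ∀ b, D (FreeLieAlgebra.of ℚ b) = v b := by
  obtain ⟨α, hα, hlie⟩ := FreeLieAlgebra.exists_primitive (B := B) (M := 𝔉 B) 0 v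
  exact ⟨⟨α, fun x y => by
    rw [hlie x y, sub_left_inj, add_eq_right]
    rfl⟩, hα⟩

open LieModule.Cohomology in
theorem FreeLieAlgebra.exists_primitive_of_trivial (c : 𝔉 B →ₗ[ℚ] 𝔉 B →ₗ[ℚ] ℚ)
    (hc : ∀ x, c x x = 0) (hcoc : ∀ x y z, c x ⁅y, z⁆ = c ⁅x, y⁆ z + c y ⁅x, z⁆) (v : B → ℚ) :
    ∃ α : 𝔉 B →ₗ[ℚ] ℚ, (∀ b, α (FreeLieAlgebra.of ℚ b) = v b) ∧ ∀ x y, α ⁅x, y⁆ = c x y := by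
  let c' : twoCochain ℚ (𝔉 B) (TrivialLieModule ℚ (𝔉 B) ℚ) := ⟨c, hc⟩
  have hc' : c' ∈ twoCocycle ℚ (𝔉 B) (TrivialLieModule ℚ (𝔉 B) ℚ) := by
    exact (mem_twoCocycle_iff_of_trivial ℚ (𝔉 B) _ c').mpr hcoc
  obtain ⟨α, hα, hlie⟩ := FreeLieAlgebra.exists_primitive
    (M := TrivialLieModule ℚ (𝔉 B) ℚ) ⟨c', hc'⟩ v
  refine ⟨α, hα, fun x y => ?_⟩
  have h := hlie x y
  rw [trivial_lie_zero (𝔉 B) (TrivialLieModule ℚ (𝔉 B) ℚ),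
    trivial_lie_zero (𝔉 B) (TrivialLieModule ℚ (𝔉 B) ℚ), add_zero, sub_zero] at h
  exact h

end FreeLie

section WeightOperator

variable {X : Type u} {𝔤 : Type u} [LieRing 𝔤] [LieAlgebra ℚ 𝔤] {t : X → 𝔤}

theorem LieDerivation.apply_of_mem_lieWeight (N : LieDerivation ℚ 𝔤 𝔤) (hN : ∀ x, N (t x) = t x) :
    ∀ n, ∀ y ∈ lieWeight t n, N y = (n : ℚ) • y
  | 0, y, hy => by rw [eq_zero_of_mem_lieWeight_zero hy, map_zero, smul_zero]
  | 1, y, hy => by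
    rw [lieWeight_one_eq] at hy
    have : Submodule.span ℚ (Set.range t) ≤ natEigenspace (N : 𝔤 →ₗ[ℚ] 𝔤) 1 := by
      rw [Submodule.span_le]
      rintro _ ⟨x, rfl⟩
      rw [SetLike.mem_coe, mem_natEigenspace]
      simpa using hN x
    exact mem_natEigenspace.mp (this hy)
  | n + 2, y, hy => by
    have : lieWeight t (n + 2) ≤ natEigenspace (N : 𝔤 →ₗ[ℚ] 𝔤) (n + 2) := by
      refine lieWeight_succ_induction fun x y hy => ?_
      rw [mem_natEigenspace]
      change N ⁅t x, y⁆ = _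
      rw [LieDerivation.apply_lie_eq_add, hN, LieDerivation.apply_of_mem_lieWeight N hN (n + 1) y hy,
        lie_smul]
      push_cast
      module
    exact mem_natEigenspace.mp (this hy)

/-- The graded dual is spanned by the forms of weight `n`, for `n ≥ 1`. -/
theorem iSup_natEigenspace_comap (ht : LieGenerates t) (N : 𝔤 →ₗ[ℚ] 𝔤)
    (hN : ∀ n, ∀ y ∈ lieWeight t n, N y = (n : ℚ) • y)
    (hN' : ∀ n, ∀ y ∈ lieWeight t n, N y ∈ lieWeight t n) :
    ⨆ n, natEigenspace (GradedDual.comap N hN') (n + 1) = ⊤ := by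
  set T := GradedDual.comap N hN' with hT
  have key : ∀ m, ∀ f : GradedDual t,
      (∀ n, m < n → ∀ y ∈ lieWeight t n, GradedDual.pairing t f y = 0) →
      f ∈ ⨆ (n : ℕ) (_ : n < m), natEigenspace T (n + 1) := by
    intro m
    induction m with
    | zero =>
      intro f hf
      have hle : ⨆ n, lieWeight t n ≤ LinearMap.ker (GradedDual.pairing t f) := by
        refine iSup_le fun n y hy => ?_
        rcases n with _ | n
        · rw [eq_zero_of_mem_lieWeight_zero hy]; exact zero_mem _
        · exact hf _ n.succ_pos y hy
      have hf0 : f = 0 := GradedDual.ext fun y => by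
        have hy : y ∈ ⨆ n, lieWeight t n := by rw [iSup_lieWeight ht]; trivial
        rw [map_zero, LinearMap.zero_apply]
        exact hle hy
      rw [hf0]
      exact zero_mem _
    | succ m ih =>
      intro f hf
      -- `(N - (m + 1)) f` has lower weights, and `N - (m + 1)` is invertible on these
      have h1 := ih (T f - ((m + 1 : ℕ) : ℚ) • f) fun n hn y hy => by
        change GradedDual.pairing t f (N y) - ((m + 1 : ℕ) : ℚ) * GradedDual.pairing t f y = 0
        rw [hN n y hy, map_smul, smul_eq_mul, ← sub_mul]
        rcases Nat.lt_or_eq_of_le (Nat.succ_le_of_lt hn) with h | h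
        · rw [hf n h y hy, mul_zero]
        · rw [← h, sub_self, zero_mul]
      have h2 : ⨆ (n : ℕ) (_ : n < m), natEigenspace T (n + 1) ≤
          (⨆ (n : ℕ) (_ : n < m), natEigenspace T (n + 1)).map
            (T - ((m + 1 : ℕ) : ℚ) • LinearMap.id) := by
        refine iSup₂_le fun n hn x hx => ⟨((n : ℚ) - m)⁻¹ • x, ?_, ?_⟩
        · exact Submodule.smul_mem _ _
            ((le_iSup₂_of_le n hn le_rfl : natEigenspace T (n + 1) ≤ _) hx)
        · have hnm : (n : ℚ) - m ≠ 0 := sub_ne_zero.mpr (by exact_mod_cast hn.ne)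
          change T (((n : ℚ) - m)⁻¹ • x) - ((m + 1 : ℕ) : ℚ) • ((n : ℚ) - m)⁻¹ • x = x
          rw [map_smul, mem_natEigenspace.mp hx, smul_smul, smul_smul, ← sub_smul]
          have : ((n : ℚ) - m)⁻¹ * ((n + 1 : ℕ) : ℚ) - ((m + 1 : ℕ) : ℚ) * ((n : ℚ) - m)⁻¹ = 1 := by
            push_cast; field_simp; ring
          rw [this, one_smul]
      obtain ⟨g, hg, hgf⟩ := h2 h1
      change T g - ((m + 1 : ℕ) : ℚ) • g = T f - ((m + 1 : ℕ) : ℚ) • f at hgf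
      have h3 : f - g ∈ natEigenspace T (m + 1) := by
        rw [mem_natEigenspace, map_sub, smul_sub, sub_eq_sub_iff_sub_eq_sub, hgf]
      rw [← sub_add_cancel f g]
      refine add_mem ((le_iSup₂_of_le m m.lt_succ_self le_rfl : natEigenspace T (m + 1) ≤ _) h3) ?_
      exact (iSup₂_mono' fun n hn => ⟨n, hn.trans m.lt_succ_self, le_rfl⟩ :
        (⨆ (n : ℕ) (_ : n < m), natEigenspace T (n + 1)) ≤ _) hg
  rw [eq_top_iff]
  intro f _
  obtain ⟨m, hm⟩ := f.2
  exact (iSup_mono fun n => iSup_le fun _ => le_rfl :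
    (⨆ (n : ℕ) (_ : n < m), natEigenspace T (n + 1)) ≤ _)
    (key m f fun n hn y hy => hm n hn.le y hy)

open ExteriorDifferential

theorem extDerivation_mem_two {W : Type u} [AddCommGroup W] [Module ℚ W] (N : W →ₗ[ℚ] W)
    {c : ExteriorAlgebra ℚ W} (hc : c ∈ ⋀[ℚ]^2 W) : extDerivation N c ∈ ⋀[ℚ]^2 W := by
  refine exteriorPower_two_induction (p := fun c => extDerivation N c ∈ ⋀[ℚ]^2 W) (fun v w => ?_)
    (fun x y hx hy => ?_) hc
  · have h : extDerivation N (ι ℚ w) = ι ℚ (N w) := by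
      have := extDerivation_ι_mul N w 1
      rwa [mul_one, mul_one, ← map_one (algebraMap ℚ _), extDerivation_algebraMap, mul_zero,
        add_zero] at this
    rw [extDerivation_ι_mul, h]
    exact add_mem (ι_mul_ι_mem _ _) (ι_mul_ι_mem _ _)
  · rw [map_add]; exact add_mem hx hy

theorem formValue_extDerivation {W : Type u} [AddCommGroup W] [Module ℚ W] (N : W →ₗ[ℚ] W)
    (φ ψ : Module.Dual ℚ W) {c : ExteriorAlgebra ℚ W} (hc : c ∈ ⋀[ℚ]^2 W) :
    formValue φ ψ (extDerivation N c) = formValue (φ ∘ₗ N) ψ c + formValue φ (ψ ∘ₗ N) c := by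
  refine exteriorPower_two_induction (p := fun c => formValue φ ψ (extDerivation N c) =
    formValue (φ ∘ₗ N) ψ c + formValue φ (ψ ∘ₗ N) c) (fun v w => ?_) (fun x y hx hy => ?_) hc
  · have h : extDerivation N (ι ℚ w) = ι ℚ (N w) := by
      have := extDerivation_ι_mul N w 1
      rwa [mul_one, mul_one, ← map_one (algebraMap ℚ _), extDerivation_algebraMap, mul_zero,
        add_zero] at this
    rw [extDerivation_ι_mul, h, map_add]
    simp only [formValue_ι_mul_ι, LinearMap.comp_apply]
    ring
  · simp only [map_add, hx, hy]; ring

/-- The bilinear form on the Lie algebra defined by a two-form on the graded dual. -/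
noncomputable def formBilin (t : X → 𝔤) (c : ExteriorAlgebra ℚ (GradedDual t)) :
    𝔤 →ₗ[ℚ] 𝔤 →ₗ[ℚ] ℚ :=
  LinearMap.mk₂ ℚ (fun x y => formValue (gradedDualEval t x) (gradedDualEval t y) c)
    (fun x x' y => by
      rw [← formValue_add_left]; exact congrArg (fun φ => formValue φ (gradedDualEval t y) c)
        (map_add (GradedDual.pairing t).flip x x'))
    (fun a x y => by
      rw [smul_eq_mul, ← formValue_smul_left]; exact congrArg (fun φ => formValue φ (gradedDualEval t y) c)
        (map_smul (GradedDual.pairing t).flip a x))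
    (fun x y y' => by
      rw [← formValue_add_right]; exact congrArg (fun φ => formValue (gradedDualEval t x) φ c)
        (map_add (GradedDual.pairing t).flip y y'))
    (fun a x y => by
      rw [smul_eq_mul, ← formValue_smul_right]; exact congrArg (fun φ => formValue (gradedDualEval t x) φ c)
        (map_smul (GradedDual.pairing t).flip a y))

theorem formBilin_apply (c : ExteriorAlgebra ℚ (GradedDual t)) (x y : 𝔤) :
    formBilin t c x y = formValue (gradedDualEval t x) (gradedDualEval t y) c := rfl

theorem formBilin_eq_pairing {c : ExteriorAlgebra ℚ (GradedDual t)} {x : 𝔤} {g : GradedDual t}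
    (h : extContract (gradedDualEval t x) c = ι ℚ g) (y : 𝔤) :
    formBilin t c x y = GradedDual.pairing t g y := by
  change ExteriorAlgebra.algebraMapInv (extContract _ (extContract _ c)) = _
  rw [h, extContract_ι]
  exact ExteriorAlgebra.algebraMap_leftInverse (GradedDual t) _

theorem formBilin_vanish {c : ExteriorAlgebra ℚ (GradedDual t)}
    (hc : c ∈ ⋀[ℚ]^2 (GradedDual t)) :
    ∃ m, ∀ n ≥ m, ∀ x, ∀ y ∈ lieWeight t n, formBilin t c x y = 0 := by
  refine exteriorPower_two_induction (p := fun c => ∃ m, ∀ n ≥ m, ∀ x, ∀ y ∈ lieWeight t n,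
    formBilin t c x y = 0) (fun f g => ?_) (fun c c' hc hc' => ?_) hc
  · obtain ⟨m, hm⟩ := f.2
    obtain ⟨m', hm'⟩ := g.2
    refine ⟨max m m', fun n hn x y hy => ?_⟩
    rw [formBilin_apply, formValue_ι_mul_ι]
    have h1 : gradedDualEval t y f = 0 := hm n (le_of_max_le_left hn) y hy
    have h2 : gradedDualEval t y g = 0 := hm' n (le_of_max_le_right hn) y hy
    rw [h1, h2, mul_zero, mul_zero, sub_zero]
  · obtain ⟨m, hm⟩ := hc
    obtain ⟨m', hm'⟩ := hc'
    refine ⟨max m m', fun n hn x y hy => ?_⟩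
    rw [formBilin_apply, map_add]
    have h1 := hm n (le_of_max_le_left hn) x y hy
    have h2 := hm' n (le_of_max_le_right hn) x y hy
    rw [formBilin_apply] at h1 h2
    rw [h1, h2, add_zero]

variable [Finite X]

theorem d_ι_comap_derivation (ht : LieGenerates t) (N : LieDerivation ℚ 𝔤 𝔤)
    (hN' : ∀ n, ∀ y ∈ lieWeight t n, (N : 𝔤 →ₗ[ℚ] 𝔤) y ∈ lieWeight t n) (f : GradedDual t) :
    (ceExterior ht).d (ι ℚ (GradedDual.comap (N : 𝔤 →ₗ[ℚ] 𝔤) hN' f)) =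
      extDerivation (GradedDual.comap (N : 𝔤 →ₗ[ℚ] 𝔤) hN') ((ceExterior ht).d (ι ℚ f)) := by
  have hmem := (ceExterior ht).d_ι_mem f
  rw [d_ι_eq_iff ht _ (extDerivation_mem_two _ hmem)]
  intro x y
  rw [formValue_extDerivation _ _ _ hmem, GradedDual.comap_apply]
  have h1 := formValue_d_ι ht f (N x) y
  have h2 := formValue_d_ι ht f x (N y)
  change GradedDual.pairing t f (N ⁅x, y⁆) = -(formValue (gradedDualEval t (N x)) _ _ +
    formValue _ (gradedDualEval t (N y)) _)
  rw [h1, h2, LieDerivation.apply_lie_eq_add, map_add]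
  ring

/-- A closed two-form is a two-cocycle of the Lie algebra. -/
theorem formBilin_cocycle (ht : LieGenerates t) {c : ExteriorAlgebra ℚ (GradedDual t)}
    (hc : c ∈ ⋀[ℚ]^2 (GradedDual t)) (hdc : (ceExterior ht).d c = 0) (x y z : 𝔤) :
    formBilin t c x ⁅y, z⁆ = formBilin t c ⁅x, y⁆ z + formBilin t c y ⁅x, z⁆ := by
  have hex : ∀ x, ∃ g, extContract (gradedDualEval t x) c = ι ℚ g := fun x =>
    mem_exteriorPower_one (extContract_mem (gradedDualEval t x) hc)
  choose g hg using hex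
  have hdc' : ceDifferential ht c = 0 := hdc
  have h1 := contract_ceLie ht x y c
  rw [ceLie, hdc', map_zero, add_zero, hg x, hg y, hg ⁅x, y⁆, ceDifferential_ι, contract_cobracket,
    ceLie, extContract_ι, ceDifferential_algebraMap, zero_add, ceDifferential_ι,
    contract_cobracket, ← map_neg (ι ℚ), ← map_neg (ι ℚ), ← map_sub (ι ℚ)] at h1
  have h2 := ExteriorAlgebra.ι_leftInverse.injective h1
  have h3 := congrArg (fun f => GradedDual.pairing t f z) h2
  simp only [map_neg, map_sub, LinearMap.neg_apply, LinearMap.sub_apply, coad_apply] at h3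
  rw [formBilin_eq_pairing (hg x), formBilin_eq_pairing (hg y), formBilin_eq_pairing (hg ⁅x, y⁆)]
  linarith

end WeightOperator

section FreeLie

variable {B : Type u} [Finite B]

/-- The second cohomology of a free Lie algebra vanishes. -/
theorem FreeLieAlgebra.exactAt_one :
    (ceExterior (FreeLieAlgebra.lieGenerates_of (B := B))).ExactAt 1 := by
  intro c hc hdc
  obtain ⟨α, -, hα⟩ := FreeLieAlgebra.exists_primitive_of_trivial
    (formBilin (FreeLieAlgebra.of ℚ : B → _) c) (fun x => formValue_self _ hc)
    (formBilin_cocycle _ hc hdc) 0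
  obtain ⟨m, hm⟩ := formBilin_vanish hc
  let f : GradedDual (FreeLieAlgebra.of ℚ : B → _) := ⟨-α, m + 2, fun n hn y hy => by
    obtain ⟨n, rfl⟩ := Nat.exists_eq_add_of_le' hn
    have : lieWeight (FreeLieAlgebra.of ℚ : B → _) (n + (m + 2)) ≤ LinearMap.ker (-α) := by
      refine lieWeight_succ_induction fun b y hy => ?_
      change -α _ = 0
      rw [hα, hm (n + m + 1) (by omega) _ y hy, neg_zero]
    exact this hy⟩
  refine ⟨ι ℚ f, ExteriorAux.ι_mem f, (d_ι_eq_iff _ f hc).mpr fun x y => ?_⟩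
  change -α ⁅x, y⁆ = _
  rw [hα, formBilin_apply]

/-- The cohomology of a free Lie algebra vanishes in degrees `≥ 2`. -/
theorem FreeLieAlgebra.exactAt (k : ℕ) :
    (ceExterior (FreeLieAlgebra.lieGenerates_of (B := B))).ExactAt (k + 1) := by
  obtain ⟨N, hN⟩ := FreeLieAlgebra.exists_derivation (FreeLieAlgebra.of ℚ : B → _)
  have hNw := N.apply_of_mem_lieWeight hN
  have hNm : ∀ n, ∀ y ∈ lieWeight (FreeLieAlgebra.of ℚ : B → _) n,
      (N : FreeLieAlgebra ℚ B →ₗ[ℚ] FreeLieAlgebra ℚ B) y ∈ lieWeight (FreeLieAlgebra.of ℚ) n :=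
    fun n y hy => by
      change N y ∈ lieWeight (FreeLieAlgebra.of ℚ) n
      rw [hNw n y hy]
      exact Submodule.smul_mem _ _ hy
  exact ExteriorDifferential.exactAt_of_exactAt_one _
    (iSup_natEigenspace_comap FreeLieAlgebra.lieGenerates_of _ hNw hNm)
    (d_ι_comap_derivation FreeLieAlgebra.lieGenerates_of N hNm) FreeLieAlgebra.exactAt_one k

end FreeLie

/-! ### Quadratic relations and Lie Koszul duals -/

section KoszulDual

variable {X : Type u} {R : Set (ExteriorAlgebra ℚ (X →₀ ℚ))}

theorem quadCoeff_eq_formValue (x y : X) :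
    quadCoeff x y = formValue (Finsupp.lapply x) (Finsupp.lapply y) := rfl

/-- A combination of pairs of generators that is orthogonal to `R`; its brackets are the defining
relations of the Lie Koszul dual. -/
def IsKoszulOrthogonal (R : Set (ExteriorAlgebra ℚ (X →₀ ℚ))) (c : X × X →₀ ℚ) : Prop :=
  ∀ r ∈ R, (c.sum fun p a => a * quadCoeff p.1 p.2 r) = 0

/-- The quotient map from the free Lie algebra to the Lie Koszul dual. -/
noncomputable def lieKoszulMk (R : Set (ExteriorAlgebra ℚ (X →₀ ℚ))) :
    FreeLieAlgebra ℚ X →ₗ⁅ℚ⁆ LieKoszulDual R :=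
  { (LieSubmodule.Quotient.mk' (lieKoszulRelations R) :
      FreeLieAlgebra ℚ X →ₗ[ℚ] FreeLieAlgebra ℚ X ⧸ lieKoszulRelations R) with
    map_lie' := rfl }

theorem lieKoszulMk_of (x : X) :
    lieKoszulMk R (FreeLieAlgebra.of ℚ x) = lieKoszulGen R x := rfl

theorem lieKoszulMk_surjective : Function.Surjective (lieKoszulMk R) :=
  LieSubmodule.Quotient.surjective_mk' _

theorem lieKoszulMk_eq_zero {z : FreeLieAlgebra ℚ X} :
    lieKoszulMk R z = 0 ↔ z ∈ lieKoszulRelations R :=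
  LieSubmodule.Quotient.mk_eq_zero _

theorem lieKoszulGen_relation {c : X × X →₀ ℚ} (hc : IsKoszulOrthogonal R c) :
    (c.sum fun p a => a • ⁅lieKoszulGen R p.1, lieKoszulGen R p.2⁆) = 0 := by
  have h : lieKoszulMk R
      (c.sum fun p a => a • ⁅FreeLieAlgebra.of ℚ p.1, FreeLieAlgebra.of ℚ p.2⁆) = 0 :=
    lieKoszulMk_eq_zero.mpr (LieSubmodule.subset_lieSpan ⟨c, hc, rfl⟩)
  rw [← h, Finsupp.sum, Finsupp.sum, map_sum]
  exact Finset.sum_congr rfl fun p _ => by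
    rw [map_smul, LieHom.map_lie, lieKoszulMk_of, lieKoszulMk_of]

/-- A linear map on the free Lie algebra that vanishes on the relations factors through the Lie
Koszul dual. -/
theorem exists_factor_lieKoszulMk {M : Type*} [AddCommGroup M] [Module ℚ M]
    (α : FreeLieAlgebra ℚ X →ₗ[ℚ] M) (h : ∀ z ∈ lieKoszulRelations R, α z = 0) :
    ∃ β : LieKoszulDual R →ₗ[ℚ] M, ∀ z, β (lieKoszulMk R z) = α z :=
  ⟨(lieKoszulRelations R).toSubmodule.liftQ α h, fun _ => rfl⟩

/-- The universal property of the Lie Koszul dual. -/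
theorem exists_lieKoszulDual_hom {G : Type*} [LieRing G] [LieAlgebra ℚ G] (T : X → G)
    (h : ∀ c, IsKoszulOrthogonal R c → (c.sum fun p a => a • ⁅T p.1, T p.2⁆) = 0) :
    ∃ φ : LieKoszulDual R →ₗ⁅ℚ⁆ G, ∀ x, φ (lieKoszulGen R x) = T x := by
  let ψ : FreeLieAlgebra ℚ X →ₗ⁅ℚ⁆ G := FreeLieAlgebra.lift ℚ T
  have hψ : lieKoszulRelations R ≤ ψ.ker := by
    rw [lieKoszulRelations, LieSubmodule.lieSpan_le]
    rintro _ ⟨c, hc, rfl⟩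
    rw [SetLike.mem_coe, LieHom.mem_ker, ← h c hc, Finsupp.sum, Finsupp.sum, map_sum]
    exact Finset.sum_congr rfl fun p _ => by
      rw [map_smul, LieHom.map_lie, FreeLieAlgebra.lift_of_apply,
        FreeLieAlgebra.lift_of_apply]
  obtain ⟨β, hβ⟩ := exists_factor_lieKoszulMk (R := R) (ψ : FreeLieAlgebra ℚ X →ₗ[ℚ] G)
    fun z hz => (LieHom.mem_ker ..).mp (hψ hz)
  refine ⟨{ β with map_lie' := fun {x y} => ?_ }, fun x => ?_⟩
  · obtain ⟨x, rfl⟩ := lieKoszulMk_surjective x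
    obtain ⟨y, rfl⟩ := lieKoszulMk_surjective y
    change β ⁅_, _⁆ = ⁅β _, β _⁆
    rw [← LieHom.map_lie, hβ, hβ, hβ]
    exact LieHom.map_lie ψ x y
  · change β _ = _
    rw [← lieKoszulMk_of, hβ]
    exact FreeLieAlgebra.lift_of_apply T x

theorem quadCoeff_ι_mul_ι (x y : X) (v w : X →₀ ℚ) :
    quadCoeff x y (ι ℚ v * ι ℚ w) = v x * w y - w x * v y :=
  formValue_ι_mul_ι _ _ v w

/-- The abelianization of the Lie Koszul dual, with values in the dual space. -/
theorem exists_abelianization [Finite X] (R : Set (ExteriorAlgebra ℚ (X →₀ ℚ))) :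
    ∃ ab : FreeLieAlgebra ℚ X →ₗ[ℚ] Module.Dual ℚ (X →₀ ℚ),
      (∀ x, ab (FreeLieAlgebra.of ℚ x) = Finsupp.lapply x) ∧ (∀ y z : FreeLieAlgebra ℚ X, ab ⁅y, z⁆ = 0) ∧
      ∀ z ∈ lieKoszulRelations R, ab z = 0 := by
  classical
  have := Fintype.ofFinite X
  have h1 : ∀ x : X, ∃ α : FreeLieAlgebra ℚ X →ₗ[ℚ] ℚ,
      (∀ b, α (FreeLieAlgebra.of ℚ b) = (Pi.single x 1 : X → ℚ) b) ∧
      ∀ y z : FreeLieAlgebra ℚ X, α ⁅y, z⁆ = 0 :=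
    fun x => FreeLieAlgebra.exists_primitive_of_trivial 0 (fun _ => rfl)
      (fun _ _ _ => (add_zero 0).symm) _
  choose α hα hα' using h1
  have hlie : ∀ y z : FreeLieAlgebra ℚ X, (∑ x, (α x).smulRight (Finsupp.lapply x : (X →₀ ℚ) →ₗ[ℚ] ℚ)) ⁅y, z⁆ = 0 := by
    intro y z
    rw [LinearMap.sum_apply]
    exact Finset.sum_eq_zero fun x _ => by rw [LinearMap.smulRight_apply, hα', zero_smul]
  refine ⟨∑ x, (α x).smulRight (Finsupp.lapply x : (X →₀ ℚ) →ₗ[ℚ] ℚ), fun b => ?_, hlie, ?_⟩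
  · rw [LinearMap.sum_apply, Finset.sum_eq_single b]
    · rw [LinearMap.smulRight_apply, hα, Pi.single_eq_same, one_smul]
    · intro x _ hx
      rw [LinearMap.smulRight_apply, hα, Pi.single_eq_of_ne (Ne.symm hx), zero_smul]
    · exact fun h => absurd (Finset.mem_univ b) h
  · set ab := ∑ x, (α x).smulRight (Finsupp.lapply x : (X →₀ ℚ) →ₗ[ℚ] ℚ)
    let Z : LieIdeal ℚ (FreeLieAlgebra ℚ X) :=
      { LinearMap.ker ab with lie_mem := fun {y z} _ => hlie y z }
    have hZ : lieKoszulRelations R ≤ Z := by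
      rw [lieKoszulRelations, LieSubmodule.lieSpan_le]
      rintro _ ⟨c, -, rfl⟩
      change ab _ = 0
      rw [Finsupp.sum, map_sum]
      exact Finset.sum_eq_zero fun p _ => by rw [map_smul, hlie, smul_zero]
    exact fun z hz => hZ hz

/-- Each relation of the quadratic algebra defines a central extension of the abelianization of
the free Lie algebra, which descends to the Lie Koszul dual: the linear form `u` is the central
component of the resulting homomorphism. -/
theorem exists_central_form {ab : FreeLieAlgebra ℚ X →ₗ[ℚ] Module.Dual ℚ (X →₀ ℚ)}
    (hab : ∀ x, ab (FreeLieAlgebra.of ℚ x) = Finsupp.lapply x) (hab' : ∀ y z : FreeLieAlgebra ℚ X, ab ⁅y, z⁆ = 0)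
    {r : ExteriorAlgebra ℚ (X →₀ ℚ)} (hr : r ∈ ⋀[ℚ]^2 (X →₀ ℚ)) (hrR : r ∈ R) :
    ∃ u : FreeLieAlgebra ℚ X →ₗ[ℚ] ℚ, (∀ y z : FreeLieAlgebra ℚ X, u ⁅y, z⁆ = formValue (ab y) (ab z) r) ∧
      ∀ z ∈ lieKoszulRelations R, u z = 0 := by
  let c : FreeLieAlgebra ℚ X →ₗ[ℚ] FreeLieAlgebra ℚ X →ₗ[ℚ] ℚ :=
    LinearMap.mk₂ ℚ (fun y z => formValue (ab y) (ab z) r)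
      (fun y y' z => by rw [map_add, formValue_add_left])
      (fun a y z => by rw [map_smul, formValue_smul_left, smul_eq_mul])
      (fun y z z' => by rw [map_add, formValue_add_right])
      (fun a y z => by rw [map_smul, formValue_smul_right, smul_eq_mul])
  have hc0 : ∀ y z, ab z = 0 → c y z = 0 := fun y z hz => by
    have : c y z = formValue (ab y) ((0 : ℚ) • ab z) r := by
      change formValue (ab y) (ab z) r = _
      rw [hz, smul_zero]
    rw [this, formValue_smul_right, zero_mul]
  have hc0' : ∀ y z, ab y = 0 → c y z = 0 := fun y z hy => by
    have h1 := formValue_swap (ab z) (ab y) hr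
    have h2 := hc0 z y hy
    change formValue (ab z) (ab y) r = 0 at h2
    change formValue (ab y) (ab z) r = 0
    rw [h1, h2, neg_zero]
  obtain ⟨u, hu, hlie⟩ := FreeLieAlgebra.exists_primitive_of_trivial c
    (fun y => formValue_self _ hr) (fun x y z => by
      rw [hc0 _ _ (hab' y z), hc0' _ _ (hab' x y), hc0 _ _ (hab' x z), add_zero]) 0
  refine ⟨u, hlie, ?_⟩
  let Z : LieIdeal ℚ (FreeLieAlgebra ℚ X) :=
    { LinearMap.ker u ⊓ LinearMap.ker ab with
      lie_mem := fun {y z} hz => ⟨(hlie y z).trans (hc0 y z hz.2), hab' y z⟩ }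
  have hZ : lieKoszulRelations R ≤ Z := by
    rw [lieKoszulRelations, LieSubmodule.lieSpan_le]
    rintro _ ⟨d, hd, rfl⟩
    refine ⟨?_, ?_⟩
    · change u _ = 0
      rw [← hd r hrR, Finsupp.sum, Finsupp.sum, map_sum]
      refine Finset.sum_congr rfl fun p _ => ?_
      rw [map_smul, hlie, smul_eq_mul, quadCoeff_eq_formValue, ← hab, ← hab]
      rfl
    · change ab _ = 0
      rw [Finsupp.sum, map_sum]
      exact Finset.sum_eq_zero fun p _ => by rw [map_smul, hab', smul_zero]
  exact fun z hz => (hZ hz).1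

theorem two_smul_eq_sum_quadCoeff [Fintype X] {ω : ExteriorAlgebra ℚ (X →₀ ℚ)}
    (hω : ω ∈ ⋀[ℚ]^2 (X →₀ ℚ)) :
    (2 : ℚ) • ω = ∑ x : X, ∑ y : X, quadCoeff x y ω •
      (ι ℚ (Finsupp.single x (1 : ℚ)) * ι ℚ (Finsupp.single y (1 : ℚ))) := by
  refine exteriorPower_two_induction (p := fun ω => (2 : ℚ) • ω = ∑ x : X, ∑ y : X,
    quadCoeff x y ω • (ι ℚ (Finsupp.single x (1 : ℚ)) * ι ℚ (Finsupp.single y (1 : ℚ))))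
    (fun v w => ?_) (fun x y hx hy => ?_) hω
  · have hsum : ∀ v : X →₀ ℚ, ι ℚ v = ∑ x, v x • ι ℚ (Finsupp.single x (1 : ℚ)) := by
      intro v
      conv_lhs => rw [← Finsupp.univ_sum_single v]
      rw [map_sum]
      refine Finset.sum_congr rfl fun x _ => ?_
      rw [← map_smul, Finsupp.smul_single, smul_eq_mul, mul_one]
    have hprod : ∀ v w : X →₀ ℚ, ι ℚ v * ι ℚ w = ∑ x, ∑ y, (v x * w y) •
        (ι ℚ (Finsupp.single x (1 : ℚ)) * ι ℚ (Finsupp.single y (1 : ℚ))) := by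
      intro v w
      rw [hsum v, hsum w, Finset.sum_mul_sum]
      exact Finset.sum_congr rfl fun x _ => Finset.sum_congr rfl fun y _ => by
        rw [smul_mul_smul_comm]
    simp only [quadCoeff_ι_mul_ι, sub_smul, Finset.sum_sub_distrib]
    rw [← hprod, ← hprod, ExteriorAux.ι_anticomm w v, sub_neg_eq_add, two_smul]
  · simp only [smul_add, map_add, add_smul, Finset.sum_add_distrib, hx, hy]

/-- Double annihilator: a two-form that is orthogonal to the orthogonal complement of `R` lies in
the span of `R`. -/
theorem mem_span_of_orthogonal [Finite X] (hR : ∀ r ∈ R, r ∈ ⋀[ℚ]^2 (X →₀ ℚ))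
    {ω : ExteriorAlgebra ℚ (X →₀ ℚ)} (hω : ω ∈ ⋀[ℚ]^2 (X →₀ ℚ))
    (h : ∀ c, IsKoszulOrthogonal R c → (c.sum fun p a => a * quadCoeff p.1 p.2 ω) = 0) :
    ω ∈ Submodule.span ℚ R := by
  classical
  have := Fintype.ofFinite X
  by_contra hn
  obtain ⟨φ, hφω, hφ⟩ := Submodule.exists_le_ker_of_notMem hn
  let c : X × X →₀ ℚ := Finsupp.equivFunOnFinite.symm fun p =>
    φ (ι ℚ (Finsupp.single p.1 (1 : ℚ)) * ι ℚ (Finsupp.single p.2 (1 : ℚ)))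
  have hc : ∀ η ∈ ⋀[ℚ]^2 (X →₀ ℚ), (c.sum fun p a => a * quadCoeff p.1 p.2 η) = 2 * φ η := by
    intro η hη
    rw [Finsupp.sum_fintype _ _ (fun _ => zero_mul _), ← smul_eq_mul, ← map_smul,
      two_smul_eq_sum_quadCoeff hη, Fintype.sum_prod_type, map_sum]
    refine Finset.sum_congr rfl fun x _ => ?_
    rw [map_sum]
    refine Finset.sum_congr rfl fun y _ => ?_
    rw [map_smul, smul_eq_mul, mul_comm]
    rfl
  have h1 := h c fun r hr => by
    rw [hc r (hR r hr), LinearMap.mem_ker.mp (hφ (Submodule.subset_span hr)), mul_zero]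
  rw [hc ω hω] at h1
  exact hφω (by linarith)

end KoszulDual

/-! ### Comparison of a quadratic algebra with the complex of its Lie Koszul dual -/

section Comparison

variable {X : Type u} [Finite X] {R : Set (ExteriorAlgebra ℚ (X →₀ ℚ))}

/-- The generators of the quadratic algebra, seen as closed elements of the graded dual of the Lie
Koszul dual; in the exterior algebra the relations of the quadratic algebra become exact. -/
theorem exists_closed_section (hR : ∀ r ∈ R, r ∈ ⋀[ℚ]^2 (X →₀ ℚ)) :
    ∃ θ : (X →₀ ℚ) →ₗ[ℚ] GradedDual (lieKoszulGen R),
      (∀ v x, GradedDual.pairing _ (θ v) (lieKoszulGen R x) = v x) ∧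
      (∀ v, (ceExterior (lieKoszulGen_generates R)).d (ι ℚ (θ v)) = 0) ∧
      ∀ r ∈ R, ∃ b, (ceExterior (lieKoszulGen_generates R)).d b = ExteriorAlgebra.map θ r := by
  obtain ⟨ab, hab, hlie, hrel⟩ := exists_abelianization R
  obtain ⟨ab', hab'⟩ := exists_factor_lieKoszulMk ab hrel
  have hlie' : ∀ y z : LieKoszulDual R, ab' ⁅y, z⁆ = 0 := by
    intro y z
    obtain ⟨y, rfl⟩ := lieKoszulMk_surjective y
    obtain ⟨z, rfl⟩ := lieKoszulMk_surjective z
    rw [← LieHom.map_lie, hab', hlie]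
  have hw : ∀ n, ∀ y ∈ lieWeight (lieKoszulGen R) (n + 2), ab' y = 0 := by
    intro n y hy
    have : lieWeight (lieKoszulGen R) (n + 2) ≤ LinearMap.ker ab' :=
      lieWeight_succ_induction fun x y _ => hlie' _ _
    exact this hy
  let θ : (X →₀ ℚ) →ₗ[ℚ] GradedDual (lieKoszulGen R) :=
    { toFun := fun v => ⟨ab'.flip v, 2, fun n hn y hy => by
        obtain ⟨n, rfl⟩ := Nat.exists_eq_add_of_le' hn
        rw [LinearMap.flip_apply, hw n y hy, LinearMap.zero_apply]⟩
      map_add' := fun v w => Subtype.ext (map_add ab'.flip v w)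
      map_smul' := fun a v => Subtype.ext (map_smul ab'.flip a v) }
  have hθ : ∀ v y, GradedDual.pairing _ (θ v) y = ab' y v := fun _ _ => rfl
  refine ⟨θ, fun v x => ?_, fun v => ?_, fun r hr => ?_⟩
  · rw [hθ, ← lieKoszulMk_of, hab', hab]
    rfl
  · rw [d_ι_eq_zero_iff]
    intro y z
    rw [hθ, hlie', LinearMap.zero_apply]
  · obtain ⟨u, hu, hurel⟩ := exists_central_form hab hlie (hR r hr) hr
    obtain ⟨u', hu'⟩ := exists_factor_lieKoszulMk u hurel
    have hulie : ∀ y z : LieKoszulDual R, u' ⁅y, z⁆ = formValue (ab' y) (ab' z) r := by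
      intro y z
      obtain ⟨y, rfl⟩ := lieKoszulMk_surjective y
      obtain ⟨z, rfl⟩ := lieKoszulMk_surjective z
      rw [← LieHom.map_lie, hu', hu, hab', hab']
    -- the sign makes up for the sign in the Chevalley--Eilenberg differential
    let f : GradedDual (lieKoszulGen R) := ⟨-u', 3, fun n hn y hy => by
      obtain ⟨n, rfl⟩ := Nat.exists_eq_add_of_le' hn
      have : lieWeight (lieKoszulGen R) (n + 3) ≤ LinearMap.ker (-u') := by
        refine lieWeight_succ_induction fun x y hy => ?_
        change -u' _ = 0
        have h0 : ab' y = (0 : ℚ) • ab' y := by rw [hw n y hy, smul_zero]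
        rw [hulie, h0, formValue_smul_right, zero_mul, neg_zero]
      exact this hy⟩
    refine ⟨ι ℚ f, (d_ι_eq_iff _ f (map_mem_exteriorPower θ (hR r hr))).mpr fun y z => ?_⟩
    rw [formValue_map _ _ _ (hR r hr)]
    change -u' ⁅y, z⁆ = -formValue (ab' y) (ab' z) r
    rw [hulie]

/-- The restriction of the elements of the graded dual to the generators. -/
noncomputable def gradedDualRestrict (R : Set (ExteriorAlgebra ℚ (X →₀ ℚ))) :
    GradedDual (lieKoszulGen R) →ₗ[ℚ] (X →₀ ℚ) :=
  (Finsupp.linearEquivFunOnFinite ℚ ℚ X).symm.toLinearMap ∘ₗ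
    LinearMap.pi fun x => (GradedDual.pairing (lieKoszulGen R)).flip (lieKoszulGen R x)

/-- Restriction to the generators sends differentials to combinations of relations. -/
theorem map_gradedDualRestrict_d_ι (hR : ∀ r ∈ R, r ∈ ⋀[ℚ]^2 (X →₀ ℚ))
    (f : GradedDual (lieKoszulGen R)) :
    ExteriorAlgebra.map (gradedDualRestrict R)
      ((ceExterior (lieKoszulGen_generates R)).d (ι ℚ f)) ∈ Submodule.span ℚ R := by
  have hmem := (ceExterior (lieKoszulGen_generates R)).d_ι_mem f
  refine mem_span_of_orthogonal hR (map_mem_exteriorPower _ hmem) fun c hc => ?_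
  have h1 : ∀ x y, quadCoeff x y (ExteriorAlgebra.map (gradedDualRestrict R)
      ((ceExterior (lieKoszulGen_generates R)).d (ι ℚ f))) =
      -GradedDual.pairing _ f ⁅lieKoszulGen R x, lieKoszulGen R y⁆ := by
    intro x y
    rw [quadCoeff_eq_formValue, formValue_map _ _ _ hmem]
    exact formValue_d_ι _ f _ _
  have h2 := congrArg (GradedDual.pairing _ f) (lieKoszulGen_relation hc)
  rw [Finsupp.sum, map_sum, map_zero] at h2
  rw [Finsupp.sum, ← neg_eq_zero, ← h2, ← Finset.sum_neg_distrib]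
  exact Finset.sum_congr rfl fun p _ => by rw [h1, map_smul, smul_eq_mul, mul_neg, neg_neg]

/-- A quadratic algebra is quasi-isomorphic to the Chevalley--Eilenberg complex of its Lie Koszul
dual as soon as the cohomology of the latter is generated in degree one. -/
theorem quasiIsomorphic_koszulCE (hR : ∀ r ∈ R, r ∈ ⋀[ℚ]^2 (X →₀ ℚ)) (A : GradedCommAlg.{u})
    (π : ExteriorAlgebra ℚ (X →₀ ℚ) →ₐ[ℚ] A.carrier)
    (hdeg : ∀ (i : ℕ) (a), a ∈ ⋀[ℚ]^i (X →₀ ℚ) → π a ∈ A.deg i) (hsurj : Function.Surjective π)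
    (hker : TwoSidedIdeal.ker π = TwoSidedIdeal.span R)
    (hgen : (ceExterior (lieKoszulGen_generates R)).GeneratedInDegreeOne) :
    Cdga.QuasiIsomorphic A.toCdga (koszulCE R) := by
  obtain ⟨θ, hθ, hθd, hθR⟩ := exists_closed_section hR
  set D := ceExterior (lieKoszulGen_generates R) with hD
  set τ := gradedDualRestrict R with hτ
  have hτθ : τ ∘ₗ θ = LinearMap.id := by
    refine LinearMap.ext fun v => Finsupp.ext fun x => ?_
    exact hθ v x
  let Φ : ExteriorAlgebra ℚ (GradedDual (lieKoszulGen R)) →ₐ[ℚ] A.carrier :=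
    π.comp (ExteriorAlgebra.map τ)
  have hπR : ∀ z ∈ Submodule.span ℚ R, π z = 0 := by
    have : Submodule.span ℚ R ≤ LinearMap.ker π.toLinearMap := by
      rw [Submodule.span_le]
      intro r hr
      have h1 : r ∈ TwoSidedIdeal.ker π := by rw [hker]; exact TwoSidedIdeal.subset_span hr
      exact (TwoSidedIdeal.mem_ker π).mp h1
    exact fun z hz => this hz
  have hΦd : ∀ a, Φ (D.d a) = 0 := by
    intro a
    induction a using ext_left_induction with
    | algebraMap r => rw [D.d_algebraMap, map_zero]
    | add x y hx hy => rw [map_add, map_add, hx, hy, add_zero]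
    | ι_mul b f hb =>
      have h1 : Φ (D.d (ι ℚ f)) = 0 := hπR _ (map_gradedDualRestrict_d_ι hR f)
      rw [D.d_ι_mul, map_sub, map_mul, map_mul, h1, hb, zero_mul, mul_zero, sub_zero]
  have hΦθ : ∀ v, Φ (ExteriorAlgebra.map θ v) = π v := by
    intro v
    change π (ExteriorAlgebra.map τ (ExteriorAlgebra.map θ v)) = π v
    have h1 : ExteriorAlgebra.map τ (ExteriorAlgebra.map θ v) = v := by
      rw [← AlgHom.comp_apply, ExteriorAlgebra.map_comp_map, hτθ, ExteriorAlgebra.map_id,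
        AlgHom.id_apply]
    rw [h1]
  have hθclosed : ∀ v, D.d (ExteriorAlgebra.map θ v) = 0 := by
    intro v
    induction v using ext_left_induction with
    | algebraMap r => rw [AlgHom.commutes, D.d_algebraMap]
    | add x y hx hy => rw [map_add, map_add, hx, hy, add_zero]
    | ι_mul b f hb =>
      rw [map_mul, ExteriorAlgebra.map_apply_ι, D.d_ι_mul, hθd, hb, zero_mul, mul_zero, sub_zero]
  -- the products of relations with other elements are exact
  have hexact : ∀ v ∈ TwoSidedIdeal.span R, ∃ b, D.d b = ExteriorAlgebra.map θ v := by
    intro v hv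
    induction hv using TwoSidedIdeal.span_induction with
    | mem r hr => exact hθR r hr
    | zero => exact ⟨0, by rw [map_zero, map_zero]⟩
    | add x y _ _ hx hy =>
      obtain ⟨a, ha⟩ := hx
      obtain ⟨b, hb⟩ := hy
      exact ⟨a + b, by rw [map_add, ha, hb, map_add]⟩
    | neg x _ hx =>
      obtain ⟨a, ha⟩ := hx
      exact ⟨-a, by rw [map_neg, ha, map_neg]⟩
    | left_absorb a x _ hx =>
      obtain ⟨b, hb⟩ := hx
      refine ⟨ExteriorAlgebra.map θ (extSign a) * b, ?_⟩
      rw [D.d_mul, hθclosed, zero_mul, zero_add, extSign_map, extSign_extSign, hb, map_mul]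
    | right_absorb a x _ hx =>
      obtain ⟨b, hb⟩ := hx
      exact ⟨b * ExteriorAlgebra.map θ a, by
        rw [D.d_mul, hθclosed, mul_zero, add_zero, hb, map_mul]⟩
  -- every closed element of the graded dual comes from a generator
  have hclosed : ∀ f, D.d (ι ℚ f) = 0 → f = θ (τ f) := by
    intro f hf
    rw [d_ι_eq_zero_iff] at hf
    have hf' := fun v => (d_ι_eq_zero_iff (lieKoszulGen_generates R) (θ v)).mp (hθd v)
    have hle : ⨆ n, lieWeight (lieKoszulGen R) n ≤
        LinearMap.ker (GradedDual.pairing _ (f - θ (τ f))) := by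
      refine iSup_le fun n => ?_
      rcases n with _ | _ | n
      · intro y hy
        rw [eq_zero_of_mem_lieWeight_zero hy]
        exact zero_mem _
      · rw [lieWeight_one_eq, Submodule.span_le]
        rintro _ ⟨x, rfl⟩
        change GradedDual.pairing _ (f - θ (τ f)) _ = 0
        rw [map_sub, LinearMap.sub_apply, hθ]
        exact sub_self _
      · refine lieWeight_succ_induction fun x y _ => ?_
        change GradedDual.pairing _ (f - θ (τ f)) _ = 0
        rw [map_sub, LinearMap.sub_apply, hf, hf', sub_zero]
    rw [← sub_eq_zero]
    refine GradedDual.ext fun y => ?_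
    have hy : y ∈ ⨆ n, lieWeight (lieKoszulGen R) n := by
      rw [iSup_lieWeight (lieKoszulGen_generates R)]; trivial
    rw [map_zero, LinearMap.zero_apply]
    exact hle hy
  have hadj : Algebra.adjoin ℚ (ι ℚ '' {w | D.d (ι ℚ w) = 0}) ≤
      (ExteriorAlgebra.map θ).range := by
    rw [Algebra.adjoin_le_iff]
    rintro _ ⟨w, hw, rfl⟩
    refine ⟨ι ℚ (τ w), ?_⟩
    change ExteriorAlgebra.map θ _ = _
    rw [ExteriorAlgebra.map_apply_ι, ← hclosed w hw]
  let F : Cdga.Hom (koszulCE R) A.toCdga :=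
    { toAlgHom := Φ
      map_deg := fun i a ha => hdeg i _ (map_mem_exteriorPower τ ha)
      map_d := hΦd }
  refine Relation.EqvGen.symm _ _ (Relation.EqvGen.rel _ _ ⟨F, ?_, ?_⟩)
  · rw [injective_iff_map_eq_zero]
    intro z hz
    obtain ⟨⟨a, ha⟩, rfl⟩ := Submodule.Quotient.mk_surjective _ z
    have ha' : D.d a = 0 := ha
    have hz' : F.mapCocycles ⟨a, ha⟩ ∈
        (LinearMap.range A.toCdga.d).comap A.toCdga.cocycles.subtype :=
      (Submodule.Quotient.mk_eq_zero _).mp hz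
    obtain ⟨y, hy⟩ := hz'
    have hΦa : Φ a = 0 := hy.symm
    obtain ⟨a', hadj', b, rfl⟩ := hgen a ha'
    obtain ⟨v, rfl⟩ := hadj hadj'
    rw [map_add, hΦd, add_zero] at hΦa
    have hv : v ∈ TwoSidedIdeal.span R := by
      rw [← hker, TwoSidedIdeal.mem_ker]
      exact (hΦθ v).symm.trans hΦa
    obtain ⟨b', hb'⟩ := hexact v hv
    refine (Submodule.Quotient.mk_eq_zero _).mpr ⟨b' + b, ?_⟩
    change D.d (b' + b) = ExteriorAlgebra.map θ v + D.d b
    rw [map_add, hb']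
  · intro z
    obtain ⟨⟨a, ha⟩, rfl⟩ := Submodule.Quotient.mk_surjective _ z
    obtain ⟨v, rfl⟩ := hsurj a
    refine ⟨Submodule.Quotient.mk ⟨ExteriorAlgebra.map θ v, hθclosed v⟩, ?_⟩
    change Submodule.Quotient.mk (F.mapCocycles _) = _
    exact congrArg Submodule.Quotient.mk (Subtype.ext (hΦθ v))

end Comparison

/-! ### Geometries of points and lines -/

/-- A geometry of points and lines: `line x y` is the line through `x` and `y`, and lines are
determined by any two of their points. -/
@[ext]
structure LineGeometry (X : Type u) where
  /-- the line through two points -/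
  line : X → X → Finset X
  left_mem : ∀ x y, x ∈ line x y
  right_mem : ∀ x y, y ∈ line x y
  line_eq : ∀ {p q x y}, x ∈ line p q → y ∈ line p q → x ≠ y → line x y = line p q

namespace LineGeometry

variable {X : Type u} (G : LineGeometry X)

theorem line_comm (x y : X) : G.line x y = G.line y x := by
  by_cases h : x = y
  · rw [h]
  · exact G.line_eq (G.right_mem y x) (G.left_mem y x) h

/-- The quadratic relations of a geometry: `(e_y - e_x) (e_z - e_x)` for collinear points. -/
def relations : Set (ExteriorAlgebra ℚ (X →₀ ℚ)) :=
  {r | ∃ x y z, z ∈ G.line x y ∧ r =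
    ι ℚ (Finsupp.single y 1 - Finsupp.single x 1) * ι ℚ (Finsupp.single z 1 - Finsupp.single x 1)}

theorem relations_mem : ∀ r ∈ G.relations, r ∈ ⋀[ℚ]^2 (X →₀ ℚ) := by
  rintro _ ⟨x, y, z, -, rfl⟩
  exact ι_mul_ι_mem _ _

/-- A function on pairs is orthogonal to the relations if and only if its antisymmetrization is
additive along each line; here is one of the implications. -/
theorem add_eq_of_orthogonal [Finite X] {c : X × X →₀ ℚ} (hc : IsKoszulOrthogonal G.relations c)
    {x y z : X} (h : z ∈ G.line x y) :
    c (x, z) - c (z, x) = (c (x, y) - c (y, x)) + (c (y, z) - c (z, y)) := by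
  classical
  have := Fintype.ofFinite X
  have h1 := hc _ ⟨x, y, z, h, rfl⟩
  rw [Finsupp.sum_fintype _ _ (fun _ => zero_mul _), Fintype.sum_prod_type] at h1
  simp only [quadCoeff_ι_mul_ι, Finsupp.sub_apply, Finsupp.single_apply, mul_sub,
    Finset.sum_sub_distrib, mul_ite, mul_one, mul_zero, Finset.sum_ite_eq, Finset.mem_univ,
    if_true] at h1
  linarith

section Bracket

variable {𝔤 : Type*} [LieRing 𝔤] [LieAlgebra ℚ 𝔤]

/-- The relations of the Lie Koszul dual of a geometry follow from the relations that each point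
commutes with the sum of the points of any line through it. -/
theorem sum_lie_eq_zero [Finite X] (T : X → 𝔤)
    (hT : ∀ p q, p ≠ q → ⁅T p, ∑ x ∈ G.line p q, T x⁆ = 0) {c : X × X →₀ ℚ}
    (hc : IsKoszulOrthogonal G.relations c) :
    (c.sum fun p a => a • ⁅T p.1, T p.2⁆) = 0 := by
  classical
  have := Fintype.ofFinite X
  set d : X → X → ℚ := fun x y => c (x, y) - c (y, x) with hd
  have hadd : ∀ {x y z}, z ∈ G.line x y → d x z = d x y + d y z :=
    fun h => G.add_eq_of_orthogonal hc h
  have hself : ∀ x, d x x = 0 := fun x => sub_self _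
  have hskew : ∀ x y, d y x = -d x y := fun x y => (neg_sub _ _).symm
  have hn : ∀ p q, ((G.line p q).card : ℚ) ≠ 0 := fun p q =>
    Nat.cast_ne_zero.mpr (Finset.card_ne_zero_of_mem (G.left_mem p q))
  -- the sum over a line, weighted by the distance from `p`
  have hA : ∑ p, ∑ q, ∑ b ∈ G.line p q, (((G.line p q).card : ℚ)⁻¹ * d p b) • ⁅T p, T q⁆ = 0 := by
    refine Finset.sum_eq_zero fun p _ => ?_
    have h1 : ∀ q, ∑ b ∈ G.line p q, (((G.line p q).card : ℚ)⁻¹ * d p b) • ⁅T p, T q⁆ =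
        ∑ b, if q ∈ G.line p b then (((G.line p b).card : ℚ)⁻¹ * d p b) • ⁅T p, T q⁆ else 0 := by
      intro q
      rw [← Finset.sum_filter_add_sum_filter_not Finset.univ (fun b => b ∈ G.line p q)]
      have h2 : ∑ b with ¬ b ∈ G.line p q,
          (if q ∈ G.line p b then (((G.line p b).card : ℚ)⁻¹ * d p b) • ⁅T p, T q⁆ else 0) = 0 := by
        refine Finset.sum_eq_zero fun b hb => ?_
        rw [Finset.mem_filter] at hb
        by_cases hpq : p = q
        · rw [hpq, lie_self, smul_zero, ite_self]
        rw [if_neg fun hq => hb.2 ?_]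
        rw [G.line_eq (G.left_mem p b) hq hpq]
        exact G.right_mem p b
      rw [h2, add_zero, Finset.filter_univ_mem]
      refine Finset.sum_congr rfl fun b hb => ?_
      by_cases hpb : p = b
      · rw [← hpb, hself, mul_zero, zero_smul, mul_zero, zero_smul, ite_self]
      rw [G.line_eq (G.left_mem p q) hb hpb, if_pos (G.right_mem p q)]
    rw [Finset.sum_congr rfl fun q _ => h1 q, Finset.sum_comm]
    refine Finset.sum_eq_zero fun b _ => ?_
    rw [← Finset.sum_filter, Finset.filter_univ_mem, ← Finset.smul_sum, ← lie_sum]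
    by_cases hpb : p = b
    · rw [← hpb, hself, mul_zero, zero_smul]
    · rw [hT p b hpb, smul_zero]
  have hB : ∑ p, ∑ q, ∑ b ∈ G.line p q, (((G.line p q).card : ℚ)⁻¹ * d b q) • ⁅T p, T q⁆ = 0 := by
    rw [← hA, Finset.sum_comm]
    refine Finset.sum_congr rfl fun p _ => Finset.sum_congr rfl fun q _ => ?_
    rw [G.line_comm q p]
    refine Finset.sum_congr rfl fun b _ => ?_
    rw [hskew p b, ← lie_skew, smul_neg, mul_neg, neg_smul, neg_neg]
  have hS : ∑ p, ∑ q, d p q • ⁅T p, T q⁆ = 0 := by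
    rw [← add_zero (0 : 𝔤)]
    nth_rewrite 1 [← hA]
    rw [← hB, ← Finset.sum_add_distrib]
    refine Finset.sum_congr rfl fun p _ => ?_
    rw [← Finset.sum_add_distrib]
    refine Finset.sum_congr rfl fun q _ => ?_
    rw [← Finset.sum_add_distrib]
    -- the distance from `p` to `q` is the mean of its decompositions at the points of the line
    have h1 : ∀ b ∈ G.line p q, (((G.line p q).card : ℚ)⁻¹ * d p b) • ⁅T p, T q⁆ +
        (((G.line p q).card : ℚ)⁻¹ * d b q) • ⁅T p, T q⁆ =
        (((G.line p q).card : ℚ)⁻¹ * d p q) • ⁅T p, T q⁆ := by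
      intro b hb
      have h2 := hadd hb
      rw [hskew b q] at h2
      rw [← add_smul, ← mul_add, h2, neg_add_cancel_right]
    rw [Finset.sum_congr rfl h1, Finset.sum_const, ← Nat.cast_smul_eq_nsmul ℚ, smul_smul,
      ← mul_assoc, mul_inv_cancel₀ (hn p q), one_mul]
  have h2 : (2 : ℚ) • (c.sum fun p a => a • ⁅T p.1, T p.2⁆) = 0 := by
    rw [← hS, Finsupp.sum_fintype c (fun p a => a • ⁅T p.1, T p.2⁆) (fun _ => zero_smul ℚ _),
      Fintype.sum_prod_type, two_smul]
    nth_rewrite 2 [Finset.sum_comm]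
    rw [← Finset.sum_add_distrib]
    refine Finset.sum_congr rfl fun p _ => ?_
    rw [← Finset.sum_add_distrib]
    refine Finset.sum_congr rfl fun q _ => ?_
    change c (p, q) • ⁅T p, T q⁆ + c (q, p) • ⁅T q, T p⁆ = (c (p, q) - c (q, p)) • ⁅T p, T q⁆
    rw [sub_smul, ← lie_skew (T q) (T p), smul_neg, sub_eq_add_neg]
  exact (smul_eq_zero.mp h2).resolve_left two_ne_zero

/-- Conversely, in the Lie Koszul dual each point commutes with the sum of the points of any line
through it. -/
theorem lieKoszulGen_lie_sum [Finite X] {p q : X} (hpq : p ≠ q) :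
    ⁅lieKoszulGen G.relations p, ∑ x ∈ G.line p q, lieKoszulGen G.relations x⁆ = 0 := by
  classical
  have := Fintype.ofFinite X
  set c : X × X →₀ ℚ := ∑ x ∈ G.line p q, Finsupp.single (p, x) 1 with hc
  have hsum : ∀ {M : Type u} [AddCommGroup M] [Module ℚ M] (f : X × X → M),
      (c.sum fun p a => a • f p) = ∑ x ∈ G.line p q, f (p, x) := by
    intro M _ _ f
    rw [hc, ← Finsupp.sum_finsetSum_index (h := fun p a => a • f p) (fun _ => zero_smul ℚ _)
      (fun _ _ _ => add_smul _ _ _)]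
    refine Finset.sum_congr rfl fun x _ => ?_
    rw [Finsupp.sum_single_index (h := fun p a => a • f p) (zero_smul ℚ _), one_smul]
  have hline : ∀ {s t}, s ≠ p → t ∈ G.line p s → s ∈ G.line p q → t ∈ G.line p q := by
    intro s t hs ht hsl
    rwa [← G.line_eq (G.left_mem p q) hsl hs.symm]
  have horth : IsKoszulOrthogonal G.relations c := by
    rintro _ ⟨x, y, z, hz, rfl⟩
    have h1 : (c.sum fun p a => a * quadCoeff p.1 p.2 (ι ℚ (Finsupp.single y (1 : ℚ) -
        Finsupp.single x 1) * ι ℚ (Finsupp.single z 1 - Finsupp.single x 1))) =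
        ∑ w ∈ G.line p q, quadCoeff p w (ι ℚ (Finsupp.single y (1 : ℚ) -
        Finsupp.single x 1) * ι ℚ (Finsupp.single z 1 - Finsupp.single x 1)) := by
      rw [hc, ← Finsupp.sum_finsetSum_index (fun _ => zero_mul _) (fun _ _ _ => add_mul _ _ _)]
      refine Finset.sum_congr rfl fun x _ => ?_
      rw [Finsupp.sum_single_index (zero_mul _), one_mul]
    rw [h1]
    simp only [quadCoeff_ι_mul_ι, Finset.sum_sub_distrib, ← Finset.mul_sum,
      Finsupp.sub_apply, Finsupp.single_apply, Finset.sum_ite_eq]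
    by_cases hxy : x = y
    · subst hxy; simp
    by_cases hxz : x = z
    · subst hxz; simp
    by_cases hyz : y = z
    · subst hyz; ring
    have hxyz : G.line x z = G.line x y := G.line_eq (G.left_mem x y) hz hxz
    have hyzx : G.line y z = G.line x y := G.line_eq (G.right_mem x y) hz hyz
    have hyx : y ∈ G.line x z := by rw [hxyz]; exact G.right_mem x y
    have hx : x ∈ G.line y z := by rw [hyzx]; exact G.left_mem x y
    by_cases hpx : x = p
    · subst hpx
      have h : z ∈ G.line x q ↔ y ∈ G.line x q :=
        ⟨hline (Ne.symm hxz) hyx, hline (Ne.symm hxy) hz⟩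
      simp [Ne.symm hxy, Ne.symm hxz, h]
    by_cases hpy : y = p
    · subst hpy
      have h : z ∈ G.line y q ↔ x ∈ G.line y q :=
        ⟨hline (Ne.symm hyz) hx, hline hxy (by rwa [G.line_comm])⟩
      simp [hpx, Ne.symm hyz, h]
    by_cases hpz : z = p
    · subst hpz
      have h : y ∈ G.line z q ↔ x ∈ G.line z q :=
        ⟨hline hyz (by rwa [G.line_comm]), hline hxz (by rwa [G.line_comm])⟩
      simp [hpx, hpy, h]
    simp [hpx, hpy, hpz]
  have h2 := lieKoszulGen_relation horth
  rw [hsum (fun p => ⁅lieKoszulGen G.relations p.1, lieKoszulGen G.relations p.2⁆)] at h2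
  rw [lie_sum]
  exact h2

end Bracket

end LineGeometry

/-! ### Commuting derivations of free Lie algebras -/

section Derivations

variable {B : Type u}

local notation "𝔉" => FreeLieAlgebra ℚ

/-- The sum of the generators in the class of a generator. -/
noncomputable def classSum (S : B → Finset B) (K : B) : 𝔉 B :=
  ∑ K' ∈ S K, FreeLieAlgebra.of ℚ K'

/-- The derivation that acts on each generator as the bracket with the sum of its class. -/
noncomputable def classDerivation (S : B → Finset B) : LieDerivation ℚ (𝔉 B) (𝔉 B) :=
  (FreeLieAlgebra.exists_derivation fun K => ⁅FreeLieAlgebra.of ℚ K, classSum S K⁆).choose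

theorem classDerivation_of (S : B → Finset B) (K : B) :
    classDerivation S (FreeLieAlgebra.of ℚ K) = ⁅FreeLieAlgebra.of ℚ K, classSum S K⁆ :=
  (FreeLieAlgebra.exists_derivation fun K => ⁅FreeLieAlgebra.of ℚ K, classSum S K⁆).choose_spec K

/-- A partition into classes, given by the class of each element. -/
structure IsPartition (S : B → Finset B) : Prop where
  mem_self : ∀ K, K ∈ S K
  eq_of_mem : ∀ {K K'}, K' ∈ S K → S K' = S K

variable {S S' : B → Finset B}

theorem classSum_eq_of_mem (hS : IsPartition S) {K K' : B} (h : K' ∈ S K) :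
    classSum S K' = classSum S K := by
  rw [classSum, hS.eq_of_mem h, classSum]

theorem classDerivation_classSum_of_le (hS' : IsPartition S') (hle : ∀ K, S K ⊆ S' K) (K : B) :
    classDerivation S' (classSum S K) = ⁅classSum S K, classSum S' K⁆ := by
  rw [classSum, map_sum, sum_lie]
  exact Finset.sum_congr rfl fun K' hK' => by
    rw [classDerivation_of, classSum_eq_of_mem hS' (hle K hK')]

variable [Fintype B]

/-- The derivation of a partition kills the sums over unions of classes. -/
theorem classDerivation_classSum_of_ge (hS : IsPartition S) (hS' : IsPartition S')
    (hle : ∀ K, S K ⊆ S' K) (K : B) : classDerivation S (classSum S' K) = 0 := by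
  classical
  have h1 : classDerivation S (classSum S' K) = ∑ K₁, ∑ K₂,
      if K₁ ∈ S' K ∧ K₂ ∈ S K₁ then ⁅FreeLieAlgebra.of ℚ K₁, FreeLieAlgebra.of ℚ K₂⁆ else 0 := by
    rw [classSum, map_sum, ← Finset.filter_univ_mem (S' K), Finset.sum_filter]
    refine Finset.sum_congr rfl fun K₁ _ => ?_
    split_ifs with h
    · rw [classDerivation_of, classSum, lie_sum, ← Finset.filter_univ_mem (S K₁),
        Finset.sum_filter]
      refine Finset.sum_congr rfl fun K₂ _ => ?_
      simp [h]
    · simp [h]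
  have h2 : classDerivation S (classSum S' K) = -classDerivation S (classSum S' K) := by
    conv_lhs => rw [h1, Finset.sum_comm]
    rw [h1, ← Finset.sum_neg_distrib]
    refine Finset.sum_congr rfl fun K₁ _ => ?_
    rw [← Finset.sum_neg_distrib]
    refine Finset.sum_congr rfl fun K₂ _ => ?_
    have h3 : ∀ {K₁ K₂}, (K₁ ∈ S' K ∧ K₂ ∈ S K₁) → (K₂ ∈ S' K ∧ K₁ ∈ S K₂) := by
      rintro K₁ K₂ ⟨ha, hb⟩
      refine ⟨?_, ?_⟩
      · rw [← hS'.eq_of_mem ha]; exact hle _ hb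
      · rw [hS.eq_of_mem hb]; exact hS.mem_self _
    by_cases h : K₁ ∈ S' K ∧ K₂ ∈ S K₁
    · rw [if_pos h, if_pos (h3 h), lie_skew]
    · rw [if_neg h, if_neg fun h' => h (h3 h'), neg_zero]
  have h3 : (2 : ℚ) • classDerivation S (classSum S' K) = 0 := by
    rw [two_smul]
    nth_rewrite 1 [h2]
    exact neg_add_cancel _
  exact (smul_eq_zero.mp h3).resolve_left two_ne_zero

/-- The derivations of a partition and of a refinement commute. -/
theorem classDerivation_commute (hS : IsPartition S) (hS' : IsPartition S')
    (hle : ∀ K, S K ⊆ S' K) : ⁅classDerivation S, classDerivation S'⁆ = 0 := by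
  refine LieDerivation.ext_of_lieSpan_eq_top _ FreeLieAlgebra.lieGenerates_of ?_
  rintro _ ⟨K, rfl⟩
  rw [LieDerivation.commutator_apply, classDerivation_of, classDerivation_of,
    LieDerivation.apply_lie_eq_add, LieDerivation.apply_lie_eq_add, classDerivation_of,
    classDerivation_of, classDerivation_classSum_of_le hS' hle,
    classDerivation_classSum_of_ge hS hS' hle, lie_zero, zero_add, LieDerivation.zero_apply]
  rw [lie_lie, leibniz_lie]
  rw [← lie_skew ⁅FreeLieAlgebra.of ℚ K, classSum S' K⁆ (classSum S K)]
  abel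

end Derivations

/-! ### Modular hyperplanes -/

namespace LineGeometry

variable {X : Type u} (G : LineGeometry X)

open Classical in
/-- The geometry induced on a set of points. -/
noncomputable def restrict (Y : Set X) : LineGeometry {x // x ∈ Y} where
  line x y := (G.line x y).subtype (· ∈ Y)
  left_mem x y := Finset.mem_subtype.mpr (G.left_mem x y)
  right_mem x y := Finset.mem_subtype.mpr (G.right_mem x y)
  line_eq hx hy hxy := by
    rw [G.line_eq (Finset.mem_subtype.mp hx) (Finset.mem_subtype.mp hy)
      fun h => hxy (Subtype.ext h)]

/-- A set `Y` of points that contains the line through any two of its points, meets every other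
line in a point, and such that being coplanar with a given line of `Y` is a transitive relation on
the points outside `Y`. -/
structure IsModularHyperplane (Y : Set X) : Prop where
  line_subset : ∀ {p q x}, p ∈ Y → q ∈ Y → p ≠ q → x ∈ G.line p q → x ∈ Y
  exists_mem : ∀ {p q}, p ∉ Y → p ≠ q → ∃ h ∈ Y, h ∈ G.line p q
  trans : ∀ {p q H H' K K' K''}, p ∈ Y → q ∈ Y → p ≠ q → K ∉ Y → K' ∉ Y → K'' ∉ Y →
    H ∈ G.line p q → H' ∈ G.line p q → K' ∈ G.line H K → K'' ∈ G.line H' K' →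
    ∃ H'' ∈ G.line p q, K'' ∈ G.line H'' K

namespace IsModularHyperplane

variable {G} {Y : Set X} (hY : G.IsModularHyperplane Y)

include hY in
theorem eq_of_mem_line {H H' p q : X} (hH : H ∈ Y) (hH' : H' ∈ Y) (h : H ∈ G.line p q)
    (h' : H' ∈ G.line p q) (hpq : p ∉ Y ∨ q ∉ Y) : H = H' := by
  by_contra hne
  have hl := G.line_eq h h' hne
  rcases hpq with hp | hq
  · exact hp (hY.line_subset hH hH' hne (by rw [hl]; exact G.left_mem p q))
  · exact hq (hY.line_subset hH hH' hne (by rw [hl]; exact G.right_mem p q))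

include hY in
theorem notMem_of_mem_line {H K x : X} (hH : H ∈ Y) (hK : K ∉ Y) (hx : x ∈ G.line H K)
    (hxH : x ≠ H) : x ∉ Y := fun h =>
  hxH (hY.eq_of_mem_line h hH hx (G.left_mem H K) (Or.inr hK))

open Classical in
/-- The points outside `Y` on the lines through a given point outside `Y` and a point of `E`. -/
noncomputable def cone [Fintype X] (G : LineGeometry X) (Y E : Set X) (K : {x // x ∉ Y}) :
    Finset {x // x ∉ Y} :=
  Finset.univ.filter fun K' => ∃ H ∈ E, (K' : X) ∈ G.line H K

theorem mem_cone [Fintype X] {E : Set X} {K K' : {x // x ∉ Y}} :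
    K' ∈ cone G Y E K ↔ ∃ H ∈ E, (K' : X) ∈ G.line H K := by
  simp [cone]

theorem mem_line_symm {H K K' : X} (hK' : K' ≠ H) (h : K' ∈ G.line H K) :
    K ∈ G.line H K' := by
  rw [G.line_eq (G.left_mem H K) h hK'.symm]
  exact G.right_mem H K

theorem isPartition_cone [Fintype X] {E : Set X} (hne : E.Nonempty) (hE : E ⊆ Y)
    (htrans : ∀ {H H' K K' K''}, K ∉ Y → K' ∉ Y → K'' ∉ Y → H ∈ E → H' ∈ E →
      K' ∈ G.line H K → K'' ∈ G.line H' K' → ∃ H'' ∈ E, K'' ∈ G.line H'' K) :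
    IsPartition (cone G Y E) where
  mem_self K := by
    obtain ⟨H, hH⟩ := hne
    exact mem_cone.mpr ⟨H, hH, G.right_mem _ _⟩
  eq_of_mem := by
    have hle : ∀ {K K' : {x // x ∉ Y}}, K' ∈ cone G Y E K → cone G Y E K' ⊆ cone G Y E K := by
      intro K K' h K'' h'
      obtain ⟨H, hH, h⟩ := mem_cone.mp h
      obtain ⟨H', hH', h'⟩ := mem_cone.mp h'
      exact mem_cone.mpr (htrans K.2 K'.2 K''.2 hH hH' h h')
    intro K K' h
    refine Finset.Subset.antisymm (hle h) (hle ?_)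
    obtain ⟨H, hH, h⟩ := mem_cone.mp h
    exact mem_cone.mpr ⟨H, hH, mem_line_symm (fun h' => K'.2 (h' ▸ hE hH)) h⟩

theorem isPartition_cone_singleton [Fintype X] {H : X} (hH : H ∈ Y) :
    IsPartition (cone G Y {H}) := by
  refine isPartition_cone (Set.singleton_nonempty H) (Set.singleton_subset_iff.mpr hH) ?_
  rintro H₁ H₂ K K' K'' hK hK' - rfl rfl h h'
  refine ⟨_, rfl, ?_⟩
  rwa [G.line_eq (G.left_mem _ K) h fun h0 => hK' (h0 ▸ hH)] at h'

include hY in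
theorem isPartition_cone_line [Fintype X] {p q : X} (hp : p ∈ Y) (hq : q ∈ Y) (hpq : p ≠ q) :
    IsPartition (cone G Y (G.line p q)) := by
  refine isPartition_cone ⟨p, G.left_mem p q⟩ (fun x hx => hY.line_subset hp hq hpq hx) ?_
  intro H H' K K' K'' hK hK' hK'' hH hH' h h'
  exact hY.trans hp hq hpq hK hK' hK'' hH hH' h h'

include hY in
/-- The derivation of a line of `Y` is the sum of the derivations of its points. -/
theorem sum_classDerivation_line [Fintype X] {p q : X} (hp : p ∈ Y) (hq : q ∈ Y) (hpq : p ≠ q) :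
    ∑ H ∈ G.line p q, classDerivation (cone G Y {H}) = classDerivation (cone G Y (G.line p q)) := by
  classical
  refine LieDerivation.ext_of_lieSpan_eq_top _ FreeLieAlgebra.lieGenerates_of ?_
  rintro _ ⟨K, rfl⟩
  have h1 : ∀ s : Finset X, (∑ H ∈ s, classDerivation (cone G Y {H})) (FreeLieAlgebra.of ℚ K) =
      ∑ H ∈ s, classDerivation (cone G Y {H}) (FreeLieAlgebra.of ℚ K) := by
    intro s
    induction s using Finset.induction_on with
    | empty => simp
    | insert a s ha ih => rw [Finset.sum_insert ha, Finset.sum_insert ha, LieDerivation.add_apply, ih]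
  have h2 : ∀ E : Set X, ⁅FreeLieAlgebra.of ℚ K, classSum (cone G Y E) K⁆ =
      ∑ K', if K' ∈ cone G Y E K then ⁅FreeLieAlgebra.of ℚ K, FreeLieAlgebra.of ℚ K'⁆ else 0 := by
    intro E
    rw [classSum, lie_sum, ← Finset.filter_univ_mem (cone G Y E K), Finset.sum_filter]
    simp
  rw [h1, classDerivation_of, h2]
  simp only [classDerivation_of, h2]
  rw [Finset.sum_comm]
  refine Finset.sum_congr rfl fun K' _ => ?_
  by_cases hK : K' = K
  · rw [hK, lie_self]; simp
  by_cases h : K' ∈ cone G Y (G.line p q) K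
  · rw [if_pos h]
    obtain ⟨H, hH, hm⟩ := mem_cone.mp h
    rw [Finset.sum_eq_single H, if_pos (mem_cone.mpr ⟨H, Set.mem_singleton H, hm⟩)]
    · intro H' hH' hne
      rw [if_neg]
      intro h'
      obtain ⟨_, rfl, hm'⟩ := mem_cone.mp h'
      have hKK : (K' : X) ≠ K := fun h => hK (Subtype.ext h)
      have e1 := G.line_eq hm (G.right_mem H K) hKK
      have e2 := G.line_eq hm' (G.right_mem _ K) hKK
      refine hne (hY.eq_of_mem_line (p := K') (q := K) (hY.line_subset hp hq hpq hH')
        (hY.line_subset hp hq hpq hH) ?_ ?_ (Or.inr K.2))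
      · rw [e2]; exact G.left_mem _ _
      · rw [e1]; exact G.left_mem _ _
    · exact fun h => absurd hH h
  · rw [if_neg h]
    refine Finset.sum_eq_zero fun H hH => if_neg fun h' => h ?_
    obtain ⟨_, rfl, hm⟩ := mem_cone.mp h'
    exact mem_cone.mpr ⟨_, hH, hm⟩

end IsModularHyperplane

end LineGeometry

/-! ### The Lie Koszul dual of a geometry with a modular hyperplane -/

/-- Lie algebra homomorphisms on a Lie Koszul dual are determined by the generators. -/
theorem lieKoszulDual_hom_ext {X : Type u} {R : Set (ExteriorAlgebra ℚ (X →₀ ℚ))} {G : Type*}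
    [LieRing G] [LieAlgebra ℚ G] {φ φ' : LieKoszulDual R →ₗ⁅ℚ⁆ G}
    (h : ∀ x, φ (lieKoszulGen R x) = φ' (lieKoszulGen R x)) (y : LieKoszulDual R) :
    φ y = φ' y := by
  obtain ⟨z, rfl⟩ := lieKoszulMk_surjective y
  have h1 : φ.comp (lieKoszulMk R) = φ'.comp (lieKoszulMk R) := FreeLieAlgebra.hom_ext fun x => by
    rw [LieHom.comp_apply, LieHom.comp_apply, lieKoszulMk_of, h]
  exact LieHom.congr_fun h1 z

namespace LineGeometry.IsModularHyperplane

variable {X : Type u} {G : LineGeometry X} {Y : Set X} (hY : G.IsModularHyperplane Y)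

include hY

/-- A sum over a line that is not contained in `Y` splits into its point in `Y` and the points
outside `Y`. -/
theorem sum_line [Fintype X] {M : Type*} [AddCommMonoid M] (T : X → M) {H : X} (hH : H ∈ Y)
    (K : {x // x ∉ Y}) :
    ∑ x ∈ G.line H K, T x = T H + ∑ K' ∈ cone G Y {H} K, T K' := by
  classical
  rw [← Finset.add_sum_erase _ _ (G.left_mem H K)]
  congr 1
  have h : (G.line H K).erase H = (cone G Y {H} K).map (Function.Embedding.subtype _) := by
    ext x
    simp only [Finset.mem_erase, Finset.mem_map, mem_cone, Function.Embedding.subtype_apply]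
    constructor
    · rintro ⟨hx, hl⟩
      exact ⟨⟨x, hY.notMem_of_mem_line hH K.2 hl hx⟩, ⟨H, Set.mem_singleton H, hl⟩, rfl⟩
    · rintro ⟨x, ⟨_, rfl, hl⟩, rfl⟩
      exact ⟨fun h => x.2 (h ▸ hH), hl⟩
  rw [h, Finset.sum_map]
  rfl

/-- A line that is not contained in `Y` passes through a point `H` of `Y` and a point `K` outside
`Y`; a given point of the line is `H` or lies outside `Y`. -/
theorem exists_line_eq {p q : X} (hpq : p ≠ q) (h : ¬ (p ∈ Y ∧ q ∈ Y)) :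
    ∃ H ∈ Y, ∃ K : {x // x ∉ Y}, G.line p q = G.line H K ∧
      (p = H ∨ p ∉ Y ∧ p ∈ G.line H K) := by
  by_cases hp : p ∈ Y
  · exact ⟨p, hp, ⟨q, fun hq => h ⟨hp, hq⟩⟩, rfl, Or.inl rfl⟩
  · obtain ⟨H, hH, hl⟩ := hY.exists_mem hp hpq
    exact ⟨H, hH, ⟨p, hp⟩, (G.line_eq hl (G.left_mem p q) fun h => hp (h ▸ hH)).symm,
      Or.inr ⟨hp, G.right_mem H p⟩⟩

/-- The retraction onto the Lie Koszul dual of a modular hyperplane. -/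
theorem exists_retraction [Finite X] :
    ∃ φ : LieKoszulDual G.relations →ₗ⁅ℚ⁆ LieKoszulDual (G.restrict Y).relations,
      (∀ y : {x // x ∈ Y}, φ (lieKoszulGen G.relations y) = lieKoszulGen _ y) ∧
      ∀ z : {x // x ∉ Y}, φ (lieKoszulGen G.relations z) = 0 := by
  classical
  have := Fintype.ofFinite X
  set T : X → LieKoszulDual (G.restrict Y).relations :=
    fun x => if hx : x ∈ Y then lieKoszulGen _ ⟨x, hx⟩ else 0 with hT
  have hTY : ∀ y : {x // x ∈ Y}, T y = lieKoszulGen _ y := fun y => dif_pos y.2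
  have hTZ : ∀ z : {x // x ∉ Y}, T z = 0 := fun z => dif_neg z.2
  obtain ⟨φ, hφ⟩ := exists_lieKoszulDual_hom T fun c hc => G.sum_lie_eq_zero T (fun p q hpq => by
    by_cases h : p ∈ Y ∧ q ∈ Y
    · obtain ⟨hp, hq⟩ := h
      rw [← Finset.sum_subtype_of_mem T fun x hx => hY.line_subset hp hq hpq hx,
        Finset.sum_congr rfl fun x _ => hTY x, hTY ⟨p, hp⟩]
      have h1 := (G.restrict Y).lieKoszulGen_lie_sum (p := ⟨p, hp⟩) (q := ⟨q, hq⟩)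
        (fun h => hpq (congrArg Subtype.val h))
      rw [← h1]
      congr 1
    · obtain ⟨H, hH, K, hl, hp⟩ := hY.exists_line_eq hpq h
      rw [hl, hY.sum_line T hH, Finset.sum_eq_zero fun K' _ => hTZ K', add_zero]
      rcases hp with rfl | ⟨hp, -⟩
      · exact lie_self _
      · rw [hTZ ⟨p, hp⟩, zero_lie]) hc
  exact ⟨φ, fun y => by rw [hφ, hTY], fun z => by rw [hφ, hTZ]⟩

/-- The inclusion of the Lie Koszul dual of a modular hyperplane. -/
theorem exists_section [Finite X] :
    ∃ σ : LieKoszulDual (G.restrict Y).relations →ₗ⁅ℚ⁆ LieKoszulDual G.relations,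
      ∀ y : {x // x ∈ Y}, σ (lieKoszulGen _ y) = lieKoszulGen G.relations y := by
  classical
  refine exists_lieKoszulDual_hom (fun y : {x // x ∈ Y} => lieKoszulGen G.relations y)
    fun c hc => (G.restrict Y).sum_lie_eq_zero (fun y : {x // x ∈ Y} =>
      lieKoszulGen G.relations y) (fun p q hpq => ?_) hc
  have hpq' : (p : X) ≠ q := fun h => hpq (Subtype.ext h)
  rw [← G.lieKoszulGen_lie_sum hpq', ← Finset.sum_subtype_of_mem _
    fun x hx => hY.line_subset p.2 q.2 hpq' hx]
  congr 1

/-- The points outside a modular hyperplane generate a free Lie algebra: the Lie Koszul dual acts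
on the free Lie algebra on these points, such that a point `H` of the hyperplane acts as the
derivation of the partition into lines through `H`. -/
theorem lift_injective [Finite X] :
    Function.Injective (FreeLieAlgebra.lift ℚ
      fun z : {x // x ∉ Y} => lieKoszulGen G.relations (z : X)) := by
  classical
  have := Fintype.ofFinite X
  set ψ : LieDerivation ℚ (FreeLieAlgebra ℚ {x // x ∉ Y}) (FreeLieAlgebra ℚ {x // x ∉ Y}) →ₗ⁅ℚ⁆
    LieDerivation ℚ (FreeLieAlgebra ℚ {x // x ∉ Y}) (FreeLieAlgebra ℚ {x // x ∉ Y}) :=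
    LieHom.id with hψ
  set inl := LieAlgebra.SemiDirectSum.inl ψ with hinl
  set inr := LieAlgebra.SemiDirectSum.inr ψ with hinr
  have hmix : ∀ D a, ⁅inr D, inl a⁆ = inl (D a) := by
    intro D a
    rw [hinl, hinr, LieAlgebra.SemiDirectSum.lie_eq_mk]
    simp [hψ]
  set T : X → FreeLieAlgebra ℚ {x // x ∉ Y} ⋊⁅ψ⁆
      LieDerivation ℚ (FreeLieAlgebra ℚ {x // x ∉ Y}) (FreeLieAlgebra ℚ {x // x ∉ Y}) :=
    fun x => if hx : x ∈ Y then inr (classDerivation (cone G Y {x}))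
      else inl (FreeLieAlgebra.of ℚ ⟨x, hx⟩) with hT
  have hTY : ∀ x ∈ Y, T x = inr (classDerivation (cone G Y {x})) := fun y hy => dif_pos hy
  have hTZ : ∀ z : {x // x ∉ Y}, T z = inl (FreeLieAlgebra.of ℚ z) := fun z => dif_neg z.2
  obtain ⟨φ, hφ⟩ := exists_lieKoszulDual_hom T fun c hc => G.sum_lie_eq_zero T (fun p q hpq => by
    by_cases h : p ∈ Y ∧ q ∈ Y
    · obtain ⟨hp, hq⟩ := h
      rw [Finset.sum_congr rfl fun x hx => hTY x (hY.line_subset hp hq hpq hx), ← map_sum,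
        hTY p hp, hY.sum_classDerivation_line hp hq hpq, ← LieHom.map_lie,
        classDerivation_commute (isPartition_cone_singleton hp)
          (hY.isPartition_cone_line hp hq hpq), map_zero]
      intro K K' hK
      obtain ⟨_, rfl, hl⟩ := mem_cone.mp hK
      exact mem_cone.mpr ⟨_, G.left_mem _ _, hl⟩
    · obtain ⟨H, hH, K, hl, hp⟩ := hY.exists_line_eq hpq h
      have hS := isPartition_cone_singleton (G := G) hH
      rw [hl, hY.sum_line T hH, Finset.sum_congr rfl fun K' _ => hTZ K', ← map_sum]
      change ⁅T p, T H + inl (classSum (cone G Y {H}) K)⁆ = 0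
      rcases hp with rfl | ⟨hp, hpl⟩
      · rw [lie_add, lie_self, zero_add, hTY p hH, hmix,
          classDerivation_classSum_of_ge hS hS (fun _ => Finset.Subset.refl _), map_zero]
      · rw [lie_add, hTZ ⟨p, hp⟩, hTY H hH, ← lie_skew, hmix, classDerivation_of,
          ← LieHom.map_lie, classSum_eq_of_mem hS
            (mem_cone.mpr ⟨H, Set.mem_singleton H, hpl⟩ : (⟨p, hp⟩ : {x // x ∉ Y}) ∈ _),
          neg_add_cancel]) hc
  have h : φ.comp (FreeLieAlgebra.lift ℚ
      fun z : {x // x ∉ Y} => lieKoszulGen G.relations (z : X)) = inl :=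
    FreeLieAlgebra.hom_ext fun z => by
      rw [LieHom.comp_apply, FreeLieAlgebra.lift_of_apply, hφ, hTZ]
  refine Function.Injective.of_comp (f := φ) ?_
  rw [← LieHom.coe_comp, h]
  exact LieAlgebra.SemiDirectSum.inl_injective ψ

/-- Fibration step: the cohomology of the Chevalley--Eilenberg complex is generated in degree one if
this holds for a modular hyperplane. -/
theorem generatedInDegreeOne [Finite X]
    (h : (ceExterior (lieKoszulGen_generates (G.restrict Y).relations)).GeneratedInDegreeOne) :
    (ceExterior (lieKoszulGen_generates G.relations)).GeneratedInDegreeOne := by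
  classical
  have := Fintype.ofFinite X
  obtain ⟨p, hpY, hpZ⟩ := hY.exists_retraction
  obtain ⟨σ, hσ⟩ := hY.exists_section
  have hj := hY.lift_injective
  set j := FreeLieAlgebra.lift ℚ fun z : {x // x ∉ Y} => lieKoszulGen G.relations (z : X) with hjdef
  have hjof : ∀ z, j (FreeLieAlgebra.of ℚ z) = lieKoszulGen G.relations (z : X) := fun z => by
    rw [hjdef, FreeLieAlgebra.lift_of_apply]
  have hpσ : ∀ y, p (σ y) = y := fun y =>
    lieKoszulDual_hom_ext (φ := p.comp σ) (φ' := LieHom.id) (fun x => by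
      rw [LieHom.comp_apply, hσ, hpY, LieHom.id_apply]) y
  have hpj : ∀ z, p (j z) = 0 := fun z => by
    have h1 : p.comp j = 0 := FreeLieAlgebra.hom_ext fun x => by
      rw [LieHom.comp_apply, hjof, hpZ, LieHom.zero_apply]
    exact LieHom.congr_fun h1 z
  obtain ⟨i, p', β, hext⟩ := exists_isExtension (lieKoszulGen_generates G.relations)
    (lieKoszulGen_generates (G.restrict Y).relations)
    (FreeLieAlgebra.lieGenerates_of (B := {x // x ∉ Y})) p σ j hpσ hpj hj
    (fun y => by rw [hσ]; exact gen_mem_lieWeight _ _)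
    (fun z => by rw [hjof]; exact gen_mem_lieWeight _ _)
    (fun x => by
      by_cases hx : x ∈ Y
      · exact Or.inl ⟨⟨x, hx⟩, (hσ ⟨x, hx⟩).symm⟩
      · exact Or.inr ⟨⟨x, hx⟩, (hjof ⟨x, hx⟩).symm⟩)
    (fun y z => by
      refine ⟨⁅FreeLieAlgebra.of ℚ z, classSum (cone G Y {(y : X)}) z⁆, ?_, ?_⟩
      · refine lieWeight_lie _ (m := 1) (n := 1) (gen_mem_lieWeight _ _) ?_
        exact Submodule.sum_mem _ fun _ _ => gen_mem_lieWeight _ _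
      · have h1 := G.lieKoszulGen_lie_sum (p := (z : X)) (q := y) fun h => z.2 (h ▸ y.2)
        rw [G.line_comm, hY.sum_line _ y.2, lie_add] at h1
        change j _ = _
        rw [LieHom.map_lie, hjof, classSum, map_sum, Finset.sum_congr rfl fun K _ => hjof K, hσ,
          ← lie_skew (lieKoszulGen G.relations (y : X))]
        exact (neg_eq_of_add_eq_zero_right h1).symm)
  exact hext.generatedInDegreeOne FreeLieAlgebra.exactAt h

end LineGeometry.IsModularHyperplane

/-! ### Rank in geometric lattices -/

/-- The join of an element with an element that is not below it, below a cover. -/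
theorem CovBy.sup_eq_of_not_le {L : Type*} [Lattice L] {F F' A : L} (h : F' ⋖ F)
    (hAF : A ≤ F) (hAF' : ¬ A ≤ F') : F' ⊔ A = F :=
  (h.eq_or_eq le_sup_left (sup_le h.le hAF)).resolve_left (left_lt_sup.mpr hAF').ne'

namespace IsGeometricLattice

variable {L : Type u} [Lattice L] [BoundedOrder L] (hL : IsGeometricLattice L)

theorem latticeRank_bot : latticeRank (⊥ : L) = 0 := by simp [latticeRank]

include hL

theorem latticeRank_lt {F G : L} (h : F < G) : latticeRank F < latticeRank G := by
  have := hL.finite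
  have := Fintype.ofFinite L
  have hfin : ∀ E : L, Order.height E < ⊤ := fun E => by
    rw [lt_top_iff_ne_top, Ne, Order.height_eq_top_iff]
    intro h
    obtain ⟨p, -, hp⟩ := h (Fintype.card L)
    exact p.length_lt_card.ne hp
  have h1 := hfin F
  have h2 := hfin G
  have h3 := Order.height_strictMono h h1
  rw [← ENat.natCast_toNat h1.ne, ← ENat.natCast_toNat h2.ne] at h3
  exact_mod_cast h3

theorem latticeRank_mono {F G : L} (h : F ≤ G) : latticeRank F ≤ latticeRank G := by
  rcases h.eq_or_lt with rfl | h
  · exact le_rfl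
  · exact (hL.latticeRank_lt h).le

theorem eq_of_le_of_latticeRank_le {F G : L} (h : F ≤ G) (hr : latticeRank G ≤ latticeRank F) :
    F = G := by
  by_contra hne
  exact (hL.latticeRank_lt (lt_of_le_of_ne h hne)).not_ge hr

theorem latticeRank_atom {A : L} (hA : IsAtom A) : latticeRank A = 1 := by
  have h1 := hL.latticeRank_lt hA.bot_lt
  rw [latticeRank_bot] at h1
  have h2 : Order.height A ≤ (1 : ℕ) := by
    rw [Order.height_le_coe_iff]
    intro B hB
    rw [hA.2 B hB]
    simp
  have h3 := ENat.toNat_le_toNat h2 (ENat.natCast_ne_top 1)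
  rw [ENat.toNat_natCast] at h3
  exact le_antisymm h3 h1

theorem exists_atom_le {F : L} (hF : F ≠ ⊥) : ∃ A, IsAtom A ∧ A ≤ F := by
  have := hL.finite
  exact (eq_bot_or_exists_atom_le F).resolve_left hF

theorem exists_atom_of_lt {F G : L} (h : F < G) : ∃ A, IsAtom A ∧ A ≤ G ∧ ¬ A ≤ F := by
  have := hL.atomic
  by_contra! h'
  exact h.not_ge (le_iff_atom_le_imp.mpr h')

theorem latticeRank_sup_atom {F A : L} (hA : IsAtom A) (h : ¬ A ≤ F) :
    latticeRank (F ⊔ A) = latticeRank F + 1 := by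
  have h1 := hL.semimodular F A
  rw [hL.latticeRank_atom hA] at h1
  have h2 := hL.latticeRank_lt (left_lt_sup.mpr h)
  omega

theorem latticeRank_sup_atom_le {F A : L} (hA : IsAtom A) :
    latticeRank (F ⊔ A) ≤ latticeRank F + 1 := by
  by_cases h : A ≤ F
  · rw [sup_eq_left.mpr h]; omega
  · exact (hL.latticeRank_sup_atom hA h).le

theorem latticeRank_atom_sup_atom {A B : L} (hA : IsAtom A) (hB : IsAtom B) (h : A ≠ B) :
    latticeRank (A ⊔ B) = 2 := by
  rw [hL.latticeRank_sup_atom hB fun hle => h ((hA.le_iff_eq hB.1).mp hle).symm,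
    hL.latticeRank_atom hA]

/-- Induction along a maximal chain. -/
theorem flag_induction (c : Flag L) {P : L → Prop} (bot : P ⊥)
    (step : ∀ F' ∈ c, ∀ F, F' ⋖ F → P F' → P F) : ∀ F ∈ c, P F := by
  have := hL.finite
  intro F
  induction F using WellFoundedLT.induction with
  | ind F ih =>
    intro hF
    by_cases hbot : F = ⊥
    · rw [hbot]; exact bot
    obtain ⟨F', hF', hmax⟩ := (Set.toFinite {E | E ∈ c ∧ E < F}).exists_maximal
      ⟨⊥, Flag.bot_mem c, bot_lt_iff_ne_bot.mpr hbot⟩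
    refine step F' hF'.1 F ⟨hF'.2, fun M hM hMF => ?_⟩ (ih F' hF'.2 hF'.1)
    have hMc : M ∈ c := by
      rw [Flag.mem_iff_forall_le_or_ge]
      intro E hE
      rcases c.le_or_le hF hE with h | h
      · exact Or.inl (hMF.le.trans h)
      · rcases h.eq_or_lt with rfl | h
        · exact Or.inl hMF.le
        right
        rcases c.le_or_le hE hF'.1 with h' | h'
        · exact h'.trans hM.le
        · exact (hmax ⟨hE, h⟩ h').trans hM.le
    exact hM.not_ge (hmax ⟨hMc, hMF⟩ hM.le)

/-- Every line below an element that covers a modular element meets the modular element. -/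
theorem exists_atom_le_of_covBy {F F' A B : L} (hF' : IsModularFlat F') (h : F' ⋖ F)
    (hA : IsAtom A) (hB : IsAtom B) (hAB : A ≠ B) (hAF : A ≤ F) (hBF : B ≤ F) :
    ∃ C, IsAtom C ∧ C ≤ F' ∧ C ≤ A ⊔ B := by
  obtain ⟨D, hD, hDF, hDF'⟩ := hL.exists_atom_of_lt h.lt
  have h1 := hF' (A ⊔ B)
  have h2 := hL.latticeRank_mono (sup_le h.le (sup_le hAF hBF))
  have h3 := hL.latticeRank_sup_atom hD hDF'
  rw [CovBy.sup_eq_of_not_le h hDF hDF'] at h3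
  rw [hL.latticeRank_atom_sup_atom hA hB hAB] at h1
  obtain ⟨C, hC, hle⟩ := hL.exists_atom_le (F := F' ⊓ (A ⊔ B)) fun h0 => by
    rw [h0, latticeRank_bot] at h1; omega
  exact ⟨C, hC, hle.trans inf_le_left, hle.trans inf_le_right⟩

/-- The modular law for a modular element `F'`, an element `m ≤ F'` and an atom. -/
theorem inf_sup_atom_eq {F' m A : L} (hF' : IsModularFlat F') (hm : m ≤ F') (hA : IsAtom A)
    (hAF' : ¬ A ≤ F') : F' ⊓ (m ⊔ A) = m := by
  have h1 := hF' (m ⊔ A)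
  rw [← sup_assoc, sup_eq_left.mpr hm, hL.latticeRank_sup_atom hA hAF',
    hL.latticeRank_sup_atom hA fun h => hAF' (h.trans hm)] at h1
  exact (hL.eq_of_le_of_latticeRank_le (le_inf hm le_sup_left) (by omega)).symm

end IsGeometricLattice

/-! ### The geometry of the atoms of a lattice -/

namespace LineGeometry

variable {L : Type u} [Lattice L] [BoundedOrder L] (hL : IsGeometricLattice L) {X : Type u}
  {a : X → L} (ha : Function.Injective a) (hat : ∀ x, IsAtom (a x))

open Classical in
/-- The geometry of a finite family of distinct atoms, in which the line through two atoms consists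
of the atoms below their join. -/
noncomputable def ofAtoms [Fintype X] : LineGeometry X where
  line x y := Finset.univ.filter fun z => a z ≤ a x ⊔ a y
  left_mem x y := by simp
  right_mem x y := by simp
  line_eq {p q x y} hx hy hxy := by
    rw [Finset.mem_filter] at hx hy
    suffices h : a x ⊔ a y = a p ⊔ a q by rw [h]
    refine hL.eq_of_le_of_latticeRank_le (sup_le hx.2 hy.2) ?_
    rw [hL.latticeRank_atom_sup_atom (hat x) (hat y) (ha.ne hxy)]
    have := hL.latticeRank_sup_atom_le (F := a p) (hat q)
    rwa [hL.latticeRank_atom (hat p)] at this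

theorem mem_ofAtoms_line [Fintype X] {x y z : X} :
    z ∈ (ofAtoms hL ha hat).line x y ↔ a z ≤ a x ⊔ a y := by
  simp [ofAtoms]

/-- The atoms below a modular element form a modular hyperplane among the atoms below a cover of
it. -/
theorem isModularHyperplane_ofAtoms [Fintype X] {F F' : L} (hF' : IsModularFlat F')
    (hcov : F' ⋖ F) (hle : ∀ x, a x ≤ F) (hrange : ∀ A, IsAtom A → A ≤ F → ∃ x, a x = A) :
    (ofAtoms hL ha hat).IsModularHyperplane {x | a x ≤ F'} := by
  have hmeet : ∀ {p q}, p ≠ q → ∃ h ∈ {x | a x ≤ F'}, h ∈ (ofAtoms hL ha hat).line p q := by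
    intro p q hpq
    obtain ⟨C, hC, hCF', hCl⟩ := hL.exists_atom_le_of_covBy hF' hcov (hat p) (hat q)
      (ha.ne hpq) (hle p) (hle q)
    obtain ⟨h, rfl⟩ := hrange C hC (hCF'.trans hcov.le)
    exact ⟨h, hCF', (mem_ofAtoms_line hL ha hat).mpr hCl⟩
  refine ⟨fun hp hq _ hx => ((mem_ofAtoms_line hL ha hat).mp hx).trans (sup_le hp hq),
    fun _ => hmeet, ?_⟩
  intro p q H H' K K' K'' hp hq hpq hK hK' hK'' hH hH' hK'l hK''l
  by_cases hKK : K'' = K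
  · exact ⟨p, LineGeometry.left_mem _ _ _, hKK ▸ LineGeometry.right_mem _ _ _⟩
  -- the required point is where the line through `K` and `K''` meets `F'`
  obtain ⟨h, hhY, hhl⟩ := hmeet hKK
  have hhK : h ≠ K := fun h0 => hK (h0 ▸ hhY)
  refine ⟨h, ?_, ?_⟩
  · rw [mem_ofAtoms_line] at hH hH' hK'l hK''l hhl ⊢
    rw [← hL.inf_sup_atom_eq hF' (sup_le hp hq) (hat K) hK]
    refine le_inf hhY (hhl.trans (sup_le ?_ le_sup_right))
    have h1 : a K' ≤ a p ⊔ a q ⊔ a K := hK'l.trans (sup_le_sup_right hH _)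
    exact hK''l.trans (sup_le (hH'.trans le_sup_left) h1)
  · rw [LineGeometry.line_eq _ hhl (LineGeometry.right_mem _ K'' K) hhK]
    exact LineGeometry.left_mem _ _ _

theorem restrict_ofAtoms [Fintype X] (Y : Set X) [Fintype {x // x ∈ Y}] :
    (ofAtoms hL ha hat).restrict Y = ofAtoms hL (a := fun x : {x // x ∈ Y} => a x)
      (ha.comp Subtype.val_injective) (fun x => hat x) := by
  classical
  ext x y z
  rw [mem_ofAtoms_line, restrict, Finset.mem_subtype, mem_ofAtoms_line]

/-- A geometry without points has a trivial Lie Koszul dual. -/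
theorem generatedInDegreeOne_of_isEmpty [IsEmpty X] (G : LineGeometry X) :
    (ceExterior (lieKoszulGen_generates G.relations)).GeneratedInDegreeOne := by
  have h0 : ∀ z : LieKoszulDual G.relations, z = 0 := fun z =>
    lieKoszulDual_hom_ext (φ := LieHom.id) (φ' := 0) (fun x => isEmptyElim x) z
  have hW : ∀ f : GradedDual (lieKoszulGen G.relations), f = 0 := fun f =>
    GradedDual.ext fun z => by rw [h0 z, map_zero, map_zero]
  intro c _
  refine ⟨c, ?_, 0, by rw [map_zero, add_zero]⟩
  clear * - hW
  induction c using ext_left_induction with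
  | algebraMap r => exact Subalgebra.algebraMap_mem _ r
  | add x y hx hy => exact add_mem hx hy
  | ι_mul x m _ => rw [hW m, map_zero, zero_mul]; exact zero_mem _

include hL in
/-- The fibration steps along a chain of modular elements. -/
theorem generatedInDegreeOne_ofAtoms (c : Flag L) (hc : ∀ F ∈ c, IsModularFlat F) (F : L)
    (hF : F ∈ c) {X : Type u} [Fintype X] {a : X → L} (ha : Function.Injective a)
    (hat : ∀ x, IsAtom (a x)) (hle : ∀ x, a x ≤ F)
    (hrange : ∀ A, IsAtom A → A ≤ F → ∃ x, a x = A) :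
    (ceExterior (lieKoszulGen_generates
      (ofAtoms hL ha hat).relations)).GeneratedInDegreeOne := by
  refine hL.flag_induction c (P := fun F => ∀ {X : Type u} [Fintype X] {a : X → L}
    (ha : Function.Injective a) (hat : ∀ x, IsAtom (a x)) (_ : ∀ x, a x ≤ F)
    (_ : ∀ A, IsAtom A → A ≤ F → ∃ x, a x = A), (ceExterior (lieKoszulGen_generates
      (ofAtoms hL ha hat).relations)).GeneratedInDegreeOne) ?_ ?_ F hF ha hat hle hrange
  · intro X _ a ha hat hle _
    have : IsEmpty X := ⟨fun x => (hat x).1 (le_bot_iff.mp (hle x))⟩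
    exact generatedInDegreeOne_of_isEmpty _
  · intro F' hF' F hcov ih X _ a ha hat hle hrange
    classical
    refine (isModularHyperplane_ofAtoms hL ha hat (hc F' hF') hcov hle
      hrange).generatedInDegreeOne ?_
    rw [restrict_ofAtoms hL ha hat]
    refine ih _ _ (fun x => x.2) fun A hA hAF' => ?_
    obtain ⟨x, rfl⟩ := hrange A hA (hAF'.trans hcov.le)
    exact ⟨⟨x, hAF'⟩, rfl⟩

end LineGeometry

/-! ### Quadratic presentation of the Orlik--Solomon algebra -/

section Contraction

variable {M : Type u} [AddCommGroup M] [Module ℚ M]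

theorem extContract_mul_eq (φ : Module.Dual ℚ M) (a b : ExteriorAlgebra ℚ M) :
    extContract φ (a * b) = extContract φ a * b + extSign a * extContract φ b := by
  induction a using ext_left_induction with
  | algebraMap r =>
    rw [extContract_algebraMap, ← Algebra.smul_def, map_smul, AlgHom.commutes, Algebra.smul_def,
      zero_mul, zero_add]
  | add x y hx hy => rw [add_mul, map_add, hx, hy, map_add, map_add]; noncomm_ring
  | ι_mul x m hx =>
    rw [mul_assoc, extContract_ι_mul, hx, extContract_ι_mul, map_mul, extSign_ι, mul_add, sub_mul,
      smul_mul_assoc]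
    noncomm_ring

/-- An ideal of an exterior algebra that is generated by quadratic elements that are killed by a
contraction is stable under this contraction. -/
theorem extContract_mem_span (φ : Module.Dual ℚ M) {R : Set (ExteriorAlgebra ℚ M)}
    (hR : ∀ r ∈ R, r ∈ ⋀[ℚ]^2 M) (hφ : ∀ r ∈ R, extContract φ r = 0) {x : ExteriorAlgebra ℚ M}
    (hx : x ∈ TwoSidedIdeal.span R) : extContract φ x ∈ TwoSidedIdeal.span R := by
  suffices h : extSign x ∈ TwoSidedIdeal.span R ∧ extContract φ x ∈ TwoSidedIdeal.span R from h.2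
  induction hx using TwoSidedIdeal.span_induction with
  | mem x hx =>
    rw [extSign_mem (hR x hx), hφ x hx, neg_one_sq, one_smul]
    exact ⟨TwoSidedIdeal.subset_span hx, zero_mem _⟩
  | zero => rw [map_zero, map_zero]; exact ⟨zero_mem _, zero_mem _⟩
  | add x y _ _ hx hy =>
    rw [map_add, map_add]; exact ⟨add_mem hx.1 hy.1, add_mem hx.2 hy.2⟩
  | neg x _ hx => rw [map_neg, map_neg]; exact ⟨neg_mem hx.1, neg_mem hx.2⟩
  | left_absorb a x h hx =>
    rw [map_mul, extContract_mul_eq]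
    exact ⟨TwoSidedIdeal.mul_mem_left _ _ _ hx.1, add_mem (TwoSidedIdeal.mul_mem_left _ _ _ h)
      (TwoSidedIdeal.mul_mem_left _ _ _ hx.2)⟩
  | right_absorb b x h hx =>
    rw [map_mul, extContract_mul_eq]
    exact ⟨TwoSidedIdeal.mul_mem_right _ _ _ hx.1, add_mem (TwoSidedIdeal.mul_mem_right _ _ _ hx.2)
      (TwoSidedIdeal.mul_mem_right _ _ _ hx.1)⟩

/-- Products of generators of an exterior algebra depend on the order of the factors only by a
sign. -/
theorem prod_map_ι_perm {X : Type*} (f : X → M) {l l' : List X} (h : l.Perm l') :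
    (l.map fun x => ι ℚ (f x)).prod = (l'.map fun x => ι ℚ (f x)).prod ∨
      (l.map fun x => ι ℚ (f x)).prod = -(l'.map fun x => ι ℚ (f x)).prod := by
  induction h with
  | nil => exact Or.inl rfl
  | cons x _ ih =>
    rw [List.map_cons, List.prod_cons, List.map_cons, List.prod_cons]
    rcases ih with ih | ih
    · exact Or.inl (by rw [ih])
    · exact Or.inr (by rw [ih, mul_neg])
  | swap x y l =>
    right
    simp only [List.map_cons, List.prod_cons]
    rw [← mul_assoc, ExteriorAux.ι_anticomm, neg_mul, mul_assoc]
  | trans _ _ ih ih' =>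
    rcases ih with ih | ih <;> rcases ih' with ih' | ih' <;> rw [ih, ih'] <;> simp

end Contraction

section OrlikSolomon

variable {L : Type u} [Lattice L] [BoundedOrder L] (hL : IsGeometricLattice L)

/-- The geometry of the atoms of a geometric lattice. -/
noncomputable def atomGeometry [Fintype (LatticeAtom L)] : LineGeometry (LatticeAtom L) :=
  LineGeometry.ofAtoms hL (a := Subtype.val) Subtype.val_injective Subtype.property

theorem mem_atomGeometry_line [Fintype (LatticeAtom L)] {x y z : LatticeAtom L} :
    z ∈ (atomGeometry hL).line x y ↔ (z : L) ≤ (x : L) ⊔ (y : L) :=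
  LineGeometry.mem_ofAtoms_line ..

/-- The relation `e_K e_K' = e_H e_K' - e_H e_K` for collinear atoms. -/
theorem osGen_mul_mem [Fintype (LatticeAtom L)] {H K K' : LatticeAtom L}
    (h : K' ∈ (atomGeometry hL).line H K) :
    osGen L K * osGen L K' - osGen L H * osGen L K' + osGen L H * osGen L K ∈
      TwoSidedIdeal.span (atomGeometry hL).relations := by
  have h1 : _ ∈ TwoSidedIdeal.span (atomGeometry hL).relations :=
    TwoSidedIdeal.subset_span ⟨H, K, K', h, rfl⟩
  have h2 := ExteriorAux.ι_anticomm (Finsupp.single K (1 : ℚ)) (Finsupp.single H 1)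
  have h3 := ExteriorAlgebra.ι_sq_zero (R := ℚ) (Finsupp.single H (1 : ℚ))
  rw [map_sub, map_sub, sub_mul, mul_sub, mul_sub, h2, h3] at h1
  convert h1 using 1
  rw [osGen, osGen, osGen]
  abel

open Classical in
/-- Products of atoms below a modular element whose rank is less than their number lie in the ideal
of the quadratic relations: in the fibration step, two atoms `K`, `K'` outside the smaller modular
element are replaced by the point `H` of the smaller modular element on the line through them. -/
theorem prod_osGen_mem_span [Fintype (LatticeAtom L)] (c : Flag L)
    (hc : ∀ F ∈ c, IsModularFlat F) (F : L) (hF : F ∈ c) :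
    ∀ l : List (LatticeAtom L), (∀ H ∈ l, (H : L) ≤ F) → atomsRank l.toFinset < l.length →
      (l.map (osGen L)).prod ∈ TwoSidedIdeal.span (atomGeometry hL).relations := by
  refine hL.flag_induction c (P := fun F => ∀ l : List (LatticeAtom L), (∀ H ∈ l, (H : L) ≤ F) →
    atomsRank l.toFinset < l.length → (l.map (osGen L)).prod ∈
      TwoSidedIdeal.span (atomGeometry hL).relations) ?_ ?_ F hF
  · intro l hl hr
    cases l with
    | nil => exact absurd hr (by simp)
    | cons H l => exact absurd (le_bot_iff.mp (hl H (by simp))) H.2.1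
  intro F' hF' F hcov ih
  have hperm : ∀ {l l' : List (LatticeAtom L)}, l.Perm l' →
      (l'.map (osGen L)).prod ∈ TwoSidedIdeal.span (atomGeometry hL).relations →
      (l.map (osGen L)).prod ∈ TwoSidedIdeal.span (atomGeometry hL).relations := by
    intro l l' h h'
    rcases prod_map_ι_perm (fun H => Finsupp.single H (1 : ℚ)) h with h1 | h1
    · exact h1 ▸ h'
    · exact h1 ▸ neg_mem h'
  -- induction on the number of factors that are not below `F'`
  suffices h : ∀ n, ∀ l₁ l₂ : List (LatticeAtom L), l₁.length = n → (∀ H ∈ l₁, (H : L) ≤ F) →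
      (∀ H ∈ l₂, (H : L) ≤ F') → atomsRank (l₁ ++ l₂).toFinset < (l₁ ++ l₂).length →
      ((l₁ ++ l₂).map (osGen L)).prod ∈ TwoSidedIdeal.span (atomGeometry hL).relations by
    intro l hl hr
    have hp := (List.filter_append_perm (fun H : LatticeAtom L => ¬ (H : L) ≤ F') l).symm
    refine hperm hp (h _ _ _ rfl (fun H hH => hl H (List.mem_of_mem_filter hH))
      (fun H hH => by simpa using (List.mem_filter.mp hH).2) ?_)
    rwa [← List.toFinset_eq_of_perm _ _ hp, ← hp.length_eq]
  intro n
  induction n with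
  | zero =>
    intro l₁ l₂ hn _ h₂ hr
    rw [List.length_eq_zero_iff.mp hn, List.nil_append] at hr ⊢
    exact ih l₂ h₂ hr
  | succ n ihn =>
    intro l₁ l₂ hn h₁ h₂ hr
    obtain ⟨K, l₁, rfl⟩ := List.exists_cons_of_length_eq_add_one hn
    have hn : l₁.length = n := by simpa using hn
    by_cases hK : (K : L) ≤ F'
    · have hp : (K :: l₁ ++ l₂).Perm (l₁ ++ K :: l₂) := List.perm_middle.symm
      refine hperm hp (ihn l₁ (K :: l₂) hn (fun H hH => h₁ H (List.mem_cons_of_mem _ hH)) ?_ ?_)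
      · intro H hH
        rcases List.mem_cons.mp hH with rfl | hH
        · exact hK
        · exact h₂ H hH
      · rwa [← List.toFinset_eq_of_perm _ _ hp, ← hp.length_eq]
    cases l₁ with
    | nil =>
      -- a single factor outside `F'` raises the rank
      rw [List.cons_append, List.nil_append, List.map_cons, List.prod_cons]
      refine TwoSidedIdeal.mul_mem_left _ _ _ (ih l₂ h₂ ?_)
      rw [List.cons_append, List.nil_append, List.toFinset_cons, List.length_cons, atomsRank,
        Finset.sup_insert, sup_comm, hL.latticeRank_sup_atom K.2] at hr
      · exact Nat.lt_of_add_lt_add_right hr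
      · exact fun h => hK (h.trans (Finset.sup_le fun H hH => h₂ H (List.mem_toFinset.mp hH)))
    | cons K' l =>
      simp only [List.cons_append, List.map_cons, List.prod_cons, ← mul_assoc]
      by_cases hKK : K = K'
      · rw [hKK, osGen, ι_sq_zero, zero_mul]; exact zero_mem _
      obtain ⟨H, hH, hHF', hHl⟩ := hL.exists_atom_le_of_covBy (hc F' hF') hcov K.2 K'.2
        (fun h => hKK (Subtype.ext h)) (h₁ K (by simp)) (h₁ K' (by simp))
      have hline : (⟨H, hH⟩ : LatticeAtom L) ∈ (atomGeometry hL).line K K' :=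
        (mem_atomGeometry_line hL).mpr hHl
      have hHK : (⟨H, hH⟩ : LatticeAtom L) ≠ K := by rintro rfl; exact hK hHF'
      have hline' : K' ∈ (atomGeometry hL).line ⟨H, hH⟩ K := by
        rw [LineGeometry.line_eq _ hline (LineGeometry.left_mem _ _ _) hHK]
        exact LineGeometry.right_mem _ _ _
      have hrel := osGen_mul_mem hL hline'
      have hstep : ∀ K'' ∈ [K, K'], osGen L ⟨H, hH⟩ * osGen L K'' *
          ((l ++ l₂).map (osGen L)).prod ∈ TwoSidedIdeal.span (atomGeometry hL).relations := by
        intro K'' hK''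
        have hp : (K'' :: l ++ ⟨H, hH⟩ :: l₂).Perm (⟨H, hH⟩ :: K'' :: l ++ l₂) := List.perm_middle
        have := hperm hp.symm (ihn (K'' :: l) (⟨H, hH⟩ :: l₂) (by simpa using hn) ?_ ?_ ?_)
        · simpa [mul_assoc] using this
        · intro E hE
          rcases List.mem_cons.mp hE with rfl | hE
          · refine h₁ _ ?_
            rcases List.mem_pair.mp hK'' with rfl | rfl <;> simp
          · exact h₁ E (by simp [hE])
        · intro E hE
          rcases List.mem_cons.mp hE with rfl | hE
          · exact hHF'
          · exact h₂ E hE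
        · rw [List.toFinset_eq_of_perm _ _ hp, hp.length_eq]
          refine lt_of_le_of_lt (hL.latticeRank_mono ?_) hr
          have hle : ∀ E ∈ K :: K' :: l ++ l₂, (E : L) ≤
              (K :: K' :: l ++ l₂).toFinset.sup fun H => (H : L) := fun E hE =>
            Finset.le_sup (f := fun H : LatticeAtom L => (H : L)) (List.mem_toFinset.mpr hE)
          refine Finset.sup_le fun E hE => ?_
          rw [List.mem_toFinset, List.cons_append, List.cons_append, List.mem_cons,
            List.mem_cons] at hE
          rcases hE with rfl | rfl | hE
          · exact hHl.trans (sup_le (hle K (by simp)) (hle K' (by simp)))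
          · refine hle _ ?_
            rcases List.mem_pair.mp hK'' with rfl | rfl <;> simp
          · exact hle E (by simp only [List.cons_append, List.mem_cons, hE, or_true])
      have h1 := TwoSidedIdeal.mul_mem_right _ _ ((l ++ l₂).map (osGen L)).prod hrel
      have h2 := sub_mem (add_mem h1 (hstep K' (by simp))) (hstep K (by simp))
      convert h2 using 1
      noncomm_ring

open Classical in
/-- The Orlik--Solomon relations of a supersolvable lattice are generated by the quadratic ones. -/
theorem span_osRelations [Fintype (LatticeAtom L)] (c : Flag L)
    (hc : ∀ F ∈ c, IsModularFlat F) :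
    TwoSidedIdeal.span (osRelations L) = TwoSidedIdeal.span (atomGeometry hL).relations := by
  have hδ : ∀ H K : LatticeAtom L, Finsupp.linearCombination ℚ (fun _ : LatticeAtom L => (1 : ℚ))
      (Finsupp.single K 1 - Finsupp.single H 1) = 0 := fun H K => by
    simp [Finsupp.linearCombination_single]
  refine le_antisymm (TwoSidedIdeal.span_le.mpr ?_) (TwoSidedIdeal.span_le.mpr ?_)
  · rintro _ ⟨l, hl, hC, rfl⟩
    refine extContract_mem_span _ (atomGeometry hL).relations_mem ?_ ?_
    · rintro _ ⟨x, y, z, -, rfl⟩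
      rw [extContract_ι_mul, extContract_ι, hδ, hδ, zero_smul, map_zero, mul_zero, sub_zero]
    · refine prod_osGen_mem_span hL c hc ⊤ c.top_mem l (fun _ _ => le_top) ?_
      have h1 := hC.1
      rw [List.toFinset_card_of_nodup hl] at h1
      omega
  · rintro _ ⟨x, y, z, hz, rfl⟩
    by_cases hxy : x = y
    · rw [hxy, sub_self, map_zero, zero_mul]; exact zero_mem _
    by_cases hxz : x = z
    · rw [hxz, sub_self, map_zero, mul_zero]; exact zero_mem _
    by_cases hyz : y = z
    · rw [hyz, ι_sq_zero]; exact zero_mem _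
    -- three collinear atoms form a circuit
    refine TwoSidedIdeal.subset_span ⟨[x, y, z], by simp [hxy, hxz, hyz], ?_, ?_⟩
    · have hpair : ∀ {p q : LatticeAtom L}, p ≠ q → atomsRank ({p, q} : Finset _) = 2 := by
        intro p q hpq
        rw [atomsRank, Finset.sup_insert, Finset.sup_singleton]
        exact hL.latticeRank_atom_sup_atom p.2 q.2 fun h => hpq (Subtype.ext h)
      have hset : [x, y, z].toFinset = {x, y, z} := by ext; simp
      have hcard : ({x, y, z} : Finset (LatticeAtom L)).card = 3 :=
        Finset.card_eq_three.mpr ⟨x, y, z, hxy, hxz, hyz, rfl⟩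
      rw [hset]
      refine ⟨?_, fun p hp => ?_⟩
      · have hle := (mem_atomGeometry_line hL).mp hz
        have hsup : atomsRank ({x, y, z} : Finset (LatticeAtom L)) = atomsRank {x, y} := by
          rw [atomsRank, atomsRank]
          simp only [Finset.sup_insert, Finset.sup_singleton]
          rw [← sup_assoc, sup_eq_left.mpr hle]
        rw [hcard, hsup, hpair hxy]
      · rw [hcard]
        rcases (by simpa using hp : p = x ∨ p = y ∨ p = z) with rfl | rfl | rfl
        · rw [show ({p, y, z} : Finset (LatticeAtom L)).erase p = {y, z} by
            ext w; simp; grind, hpair hyz]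
        · rw [show ({x, p, z} : Finset (LatticeAtom L)).erase p = {x, z} by
            ext w; simp; grind, hpair hxz]
        · rw [show ({x, y, p} : Finset (LatticeAtom L)).erase p = {x, y} by
            ext w; simp; grind, hpair hxy]
    · simp only [List.map_cons, List.map_nil, List.prod_cons, List.prod_nil, mul_one, osGen,
        osDelta, extContract_ι_mul, extContract_ι, Finsupp.linearCombination_single, smul_eq_mul,
        one_smul, map_one, map_sub, mul_sub, sub_mul, ι_sq_zero]
      rw [ExteriorAux.ι_anticomm (Finsupp.single y (1 : ℚ)) (Finsupp.single x 1)]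
      abel

end OrlikSolomon

/-- If a geometric lattice is supersolvable, then its Orlik--Solomon algebra is Koszul. -/
theorem mainTheorem4 {L : Type u} [Lattice L] [BoundedOrder L]
    (hgeom : IsGeometricLattice L) (hss : IsSupersolvableLattice L) :
    (orlikSolomon L).IsKoszul := by
  classical
  obtain ⟨c, hc⟩ := hss
  have := hgeom.finite
  have := Fintype.ofFinite (LatticeAtom L)
  have hdeg : ∀ (i : ℕ) (a), a ∈ ⋀[ℚ]^i (LatticeAtom L →₀ ℚ) →
      Ideal.Quotient.mkₐ ℚ (relIdeal (osRelations L)) a ∈ (orlikSolomon L).deg i :=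
    fun _ _ ha => mk_mem_quotDeg _ ha
  have hsurj : Function.Surjective (Ideal.Quotient.mkₐ ℚ (relIdeal (osRelations L))) :=
    Ideal.Quotient.mkₐ_surjective ℚ _
  have hker : TwoSidedIdeal.ker (Ideal.Quotient.mkₐ ℚ (relIdeal (osRelations L))) =
      TwoSidedIdeal.span (atomGeometry hgeom).relations := by
    rw [← span_osRelations hgeom c hc]
    ext x
    rw [TwoSidedIdeal.mem_ker, Ideal.Quotient.mkₐ_eq_mk, Ideal.Quotient.eq_zero_iff_mem,
      TwoSidedIdeal.mem_asIdeal]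
  have hR := (atomGeometry hgeom).relations_mem
  exact ⟨LatticeAtom L, inferInstance, Ideal.Quotient.mkₐ ℚ (relIdeal (osRelations L)),
    (atomGeometry hgeom).relations, hdeg, hsurj, hR, hker,
    quasiIsomorphic_koszulCE hR (orlikSolomon L) _ hdeg hsurj hker
      (LineGeometry.generatedInDegreeOne_ofAtoms hgeom c hc ⊤ c.top_mem _ _ (fun _ => le_top)
        fun A hA _ => ⟨⟨A, hA⟩, rfl⟩)⟩
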